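/- **Conventions.** For a Noetherian local ring $(S,\mathfrak m,k)$ and a finitely generated $S$-module $X$ put $P^S_X=\sum_n \dim_k \operatorname{Tor}^S_n(X,k)\,t^n$. A free resolution over $S$ is minimal if its differentials have image in $\mathfrak m$ times the target. Let $(Q,\mathfrak n,k)$ be a regular local ring, $d=\dim Q$, and $R=Q/I$ with $I\subseteq\mathfrak n^2$. A finitely generated $R$-module $X$ is *Golod* if $P^R_X = P^Q_X/\bigl(1-t(P^Q_R-1)\bigr)$; the ring $R$ is *Golod* if $k$ is a Golod $R$-module. Let $A\to R$ be a $Q$-free resolution with $A_0=Q$, and let $A_+=A_{\ge1}$. Let $A_+[1]$ be its shift, with $A_+[1]_n=(A_+)_{n-1}$. View $d_1^A$ as a map $A_+[1]\to Q$. All maps $m_n, m_n^G$ below have degree $-1$, and tensor products of maps follow the Koszul sign rule. An *$A_\infty$-algebra structure* on $A$ is a family $m_n:A_+[1]^{\otimes n}\to A_+[1]$, $n\ge1$, with $m_1=-d^A$ (restricted and corestricted to $A_+$) and $$\sum_{i=1}^{n}\sum_{j=0}^{n-i}m_{n-i+1}(1^{\otimes j}\otimes m_i\otimes1^{\otimes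 n-i-j})=\begin{cases}d_1^A\otimes1-1\otimes d_1^A,&n=2,\\0,&n\ne2.\end{cases}$$ Let $G\to X$ be a $Q$-free resolution of an $R$-module $X$. An *$A_\infty$ $A$-module structure* on $G$ is a family $m_n^G:A_+[1]^{\otimes n-1}\otimes G\to G$, $n\ge1$, with $m_1^G=d^G$ and $$\sum_{i=1}^{n}\sum_{j=0}^{n-i}m^G_{n-i+1}(1^{\otimes j}\otimes m_i\otimes1^{\otimes n-i-j})=\begin{cases}d_1^A\otimes1,&n=2,\\0,&n\neq 2,\end{cases}$$ where the inner $m_i$ is $m_i^G$ if $j=n-i$. The *bar resolution* built from these data is $\bigoplus_{n\ge0}R\otimes_Q A_+[1]^{\otimes n}\otimes_Q G$ with differential $$R\otimes\Bigl(\sum_{i=1}^{n}\sum_{j=0}^{n-i}1^{\otimes j}\otimes m_i\otimes1^{\otimes n-i-j}\otimes 1_G+\sum_{j=0}^{n}1^{\otimes j}\otimes m^G_{n-j+1}\Bigr)$$ on the $n$-th summand, and augmentation to $X$ given by $G\to X$ on the summand $n=0$ and by $0$ on the others. **Theorem.** Let $R$ be Golod and let $M$ be a finitely generated $R$-module. Then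 the minimal $R$-free resolution of $M$ can be constructed in finitely many steps, as follows. 1. $\operatorname{pd}_QM\le d$. Let $c$ be an integer with $\operatorname{pd}_QM\le c$ (for example $c=\operatorname{pd}_QM$ if $M\neq0$). The minimal $R$-free resolution of $M$ can be built degree by degree, by successive minimal free covers of syzygies. Let $F_c\to\cdots\to F_0\to M$ be its part of degrees $\le c$; it has finite rank. Its syzygy $N=\ker(F_c\to F_{c-1})$ (with $F_{-1}=M$) is a Golod module. 2. The minimal $Q$-free resolutions $A$ of $R$ and $G$ of $N$ can likewise be built degree by degree. They are complete after degree $d$ and have finite total rank. 3. The maps $m_1,m_2,\dots$ can be found one after the other: any $m_1,\dots,m_n$ that satisfy the relations not involving later maps can be completed by some $m_{n+1}$ satisfying the next relation. In any $A_\infty$-algebra structure $m$ on $A$ only finitely many $m_n$ are nonzero. Any maps $(m_n)$ of degree $-1$ with $m_1=-d^A$ that satisfy the relations up to some $n=N$ with $2N\ge d+2$ satisfy all of them. The same holds for the maps $m^G_1,m^G_2,\dots$ over any fixed $A_\infty$-algebra structure $m$: any such maps satisfying the relations up to $n=N+1$, with $2N\ge d+2$, satisfy all of them. 4. For every $A_\infty$-algebra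 structure $m$ on $A$ and every $A_\infty$ $A$-module structure $m^G$ on $G$, the bar resolution built from $A,G,m,m^G$ is a minimal $R$-free resolution of $N$. Splicing it with $F_c\to\cdots\to F_0$ along its augmentation to $N\subseteq F_c$ gives a minimal $R$-free resolution of $M$. -/

import Mathlib

universe u

noncomputable section

/-! ### Golod modules and Golod rings -/

/-- The Poincaré series `∑ dim_k Tor_n^S(X, k) t^n` of a finitely generated module `X` over a
Noetherian local ring `S` with residue field `k`.  The module `Tor_n^S(X, k)` is annihilated by the
maximal ideal, so that its length over `S` is its dimension over `k`. -/
def poincareSeries (S : Type u) [CommRing S] [IsLocalRing S] (X : Type u) [AddCommGroup X]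
    [Module S X] : PowerSeries ℚ :=
  PowerSeries.mk fun n =>
    ((Module.length S
      ↑(((CategoryTheory.Tor (ModuleCat.{u} S) n).obj (ModuleCat.of S X)).obj
        (ModuleCat.of S (IsLocalRing.ResidueField S)))).toNat : ℚ)

/-- `X` is a Golod `R`-module (with respect to `Q → R`): the Golod bound
`P^R_X ≤ P^Q_X / (1 - t (P^Q_R - 1))` is an equality.  (The denominator has constant coefficient
`1`, so `⁻¹` is the honest inverse of power series.) -/
def IsGolodModule (Q R X : Type u) [CommRing Q] [IsLocalRing Q] [CommRing R] [IsLocalRing R]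
    [Algebra Q R] [AddCommGroup X] [Module Q X] [Module R X] : Prop :=
  poincareSeries R X =
    poincareSeries Q X * (1 - PowerSeries.X * (poincareSeries Q R - 1))⁻¹

/-- `R` is a Golod ring (via `Q → R`): its residue field is a Golod module. -/
def IsGolodRing (Q R : Type u) [CommRing Q] [IsLocalRing Q] [CommRing R] [IsLocalRing R]
    [Algebra Q R] : Prop :=
  IsGolodModule Q R (IsLocalRing.ResidueField R)

/-! ### Free complexes with a homogeneous basis -/

/-- The data of a nonnegatively graded free `S`-module with homogeneous basis `ι` (the basis element
`x` has degree `deg x`), with a differential and an augmentation to the `S`-module `X`, both given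
by their values on the basis.  The underlying module is `ι →₀ S`. -/
structure FreeComplex (S X : Type u) [CommRing S] [AddCommGroup X] [Module S X] where
  /-- the homogeneous basis -/
  ι : Type
  /-- the degrees of the basis elements -/
  deg : ι → ℕ
  /-- the differential on the basis -/
  d : ι → ι →₀ S
  /-- the augmentation on the basis -/
  ε : ι → X

namespace FreeComplex

variable {S X : Type u} [CommRing S] [AddCommGroup X] [Module S X]

/-- The differential. -/
def D (F : FreeComplex S X) : (F.ι →₀ S) →ₗ[S] (F.ι →₀ S) := Finsupp.linearCombination S F.d

/-- The augmentation. -/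
def aug (F : FreeComplex S X) : (F.ι →₀ S) →ₗ[S] X := Finsupp.linearCombination S F.ε

/-- The differential has degree `-1` and square zero, and the augmentation is a chain map to `X`
placed in degree `0`. -/
structure IsComplex (F : FreeComplex S X) : Prop where
  deg_d : ∀ x y, F.d x y ≠ 0 → F.deg x = F.deg y + 1
  aug_eq_zero : ∀ x, F.deg x ≠ 0 → F.ε x = 0
  D_D : ∀ z, F.D (F.D z) = 0
  aug_D : ∀ z, F.aug (F.D z) = 0

/-- `F` is a minimal free resolution of `X` over the local ring `S`:
`⋯ → F₁ → F₀ → X → 0` is exact, and the matrices of the differentials have all their entries in the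
maximal ideal. -/
structure IsMinimalFreeResolution [IsLocalRing S] (F : FreeComplex S X) : Prop where
  isComplex : F.IsComplex
  surjective : Function.Surjective F.aug
  exact : ∀ z, F.D z = 0 → F.aug z = 0 → ∃ z', F.D z' = z
  minimal : ∀ x y, F.d x y ∈ IsLocalRing.maximalIdeal S

/-- `F` is the part `F_n → ⋯ → F₀ → X → 0` of degrees `≤ n` of a minimal free resolution of `X`:
the sequence is exact at all places except possibly `F_n`, and for all `i ≤ n` the
kernel of `F_i → F_{i-1}` (of `F₀ → X` if `i = 0`) lies in `𝔪 F_i`. -/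
structure IsMinimalStart [IsLocalRing S] (F : FreeComplex S X) (n : ℕ) : Prop where
  isComplex : F.IsComplex
  deg_le : ∀ x, F.deg x ≤ n
  surjective : Function.Surjective F.aug
  exact : ∀ z, (∀ x, z x ≠ 0 → F.deg x < n) → F.D z = 0 → F.aug z = 0 → ∃ z', F.D z' = z
  minimal : ∀ z, F.D z = 0 → F.aug z = 0 → ∀ x, z x ∈ IsLocalRing.maximalIdeal S

/-- The `(n+1)`-st syzygy of `X` computed by `F`: the kernel of `F_n → F_{n-1}`, or of `F₀ → X` if
`n = 0`. -/
def syzygy (F : FreeComplex S X) (n : ℕ) : Submodule S (F.ι →₀ S) :=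
  Finsupp.supported S S {x | F.deg x = n} ⊓ (LinearMap.ker F.D ⊓ LinearMap.ker F.aug)

/-- The complex `⋯ → L₁ → L₀ → F_n → ⋯ → F₀` obtained from a complex `F` concentrated in degrees
`≤ n` and a complex `L` augmented to the `(n+1)`-st syzygy of `F`, by splicing along
`L₀ → syzygy ⊆ F_n`. -/
def splice (F : FreeComplex S X) (n : ℕ) (L : FreeComplex S (F.syzygy n)) : FreeComplex S X where
  ι := F.ι ⊕ L.ι
  deg := Sum.elim F.deg fun y => L.deg y + n + 1
  d := Sum.elim (fun x => (F.d x).mapDomain Sum.inl) fun y =>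
    (L.d y).mapDomain Sum.inr + (L.ε y : F.ι →₀ S).mapDomain Sum.inl
  ε := Sum.elim F.ε fun _ => 0

end FreeComplex

/-- The minimal free resolution of `X` can be built degree by degree: degree `0` exists, and each
part `F_n → ⋯ → F₀` that has been built has finite rank and is extended to degree `n+1` by any
minimal free cover `L` of its syzygy, which exists. -/
def StepwiseResolvable (S X : Type u) [CommRing S] [IsLocalRing S] [AddCommGroup X]
    [Module S X] : Prop :=
  (∃ F : FreeComplex S X, F.IsMinimalStart 0) ∧
  ∀ (n : ℕ) (F : FreeComplex S X), F.IsMinimalStart n →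
    Finite F.ι ∧
    (∃ L : FreeComplex S (F.syzygy n), L.IsMinimalStart 0) ∧
    ∀ L : FreeComplex S (F.syzygy n), L.IsMinimalStart 0 → (F.splice n L).IsMinimalStart (n + 1)

/-! ### A-infinity structures -/

namespace FreeComplex

variable {Q R X : Type u} [CommRing Q] [CommRing R] [Algebra Q R]
  [AddCommGroup X] [Module Q X] [Module R X]

/-- `A₀ = Q`, free on the single basis element `e`, which is mapped to `1 ∈ R`. -/
structure IsUnital (A : FreeComplex Q R) (e : A.ι) : Prop where
  deg_eq : A.deg e = 0
  unique : ∀ x, A.deg x = 0 → x = e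
  aug_eq : A.ε e = 1

/-- The homogeneous basis of `A₊ = A_{≥ 1}`. -/
abbrev Pos (A : FreeComplex Q R) : Type := {x : A.ι // 0 < A.deg x}

/-- The degree of `[x₁|⋯|x_n] ∈ A₊[1]^{⊗ n}`.  The words of length `n` in `A.Pos` form a basis of
`A₊[1]^{⊗ n}`. -/
def wordDeg (A : FreeComplex Q R) (w : List A.Pos) : ℕ := (w.map fun x => A.deg x + 1).sum

/-- The sign produced by a map of degree `-1` when it passes the word `w`. -/
def sgn (A : FreeComplex Q R) (w : List A.Pos) : ℤ := (-1) ^ A.wordDeg w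

/-- The curvature term `d₁ ⊗ 1 - 1 ⊗ d₁ : A₊[1]^{⊗ 2} → A₊[1]`, and zero on words of other
lengths. -/
def curvature (A : FreeComplex Q R) (e : A.ι) : List A.Pos → (A.Pos →₀ Q)
  | [x, y] => Finsupp.single y (A.d x e) - Finsupp.single x (A.d y e)
  | _ => 0

/-- The maps `m_n : A₊[1]^{⊗ n} → A₊[1]` of degree `-1`, given by their values `m w` on words `w` of
length `n`, satisfy `m₁ = d^{A[1]}` (so `m₁ = -d^A`, restricted and corestricted to `A₊`) and the
relations of an A-infinity algebra structure on `A`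
`∑_{i,j} m_{n-i+1} (1^{⊗ j} ⊗ m_i ⊗ 1^{⊗ n-i-j}) = (curvature)` for all `n ≤ N`. -/
structure IsAInfAlgebraUpTo (A : FreeComplex Q R) (e : A.ι) (N : ℕ)
    (m : List A.Pos → (A.Pos →₀ Q)) : Prop where
  map_nil : m [] = 0
  map_one : ∀ x : A.Pos, m [x] = -(A.d x).subtypeDomain fun y => 0 < A.deg y
  degree : ∀ w y, m w y ≠ 0 → (A.deg y + 1) + 1 = A.wordDeg w
  relation : ∀ w : List A.Pos, w.length ≤ N →
    ∑ i ∈ Finset.Icc 1 w.length, ∑ j ∈ Finset.range (w.length - i + 1),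
      A.sgn (w.take j) • (m ((w.drop j).take i)).sum
        (fun b q => q • m (w.take j ++ b :: w.drop (j + i))) = A.curvature e w

/-- An A-infinity algebra structure on `A`. -/
def IsAInfAlgebra (A : FreeComplex Q R) (e : A.ι) (m : List A.Pos → (A.Pos →₀ Q)) : Prop :=
  ∀ N, A.IsAInfAlgebraUpTo e N m

/-- The curvature term `d₁ ⊗ 1 : A₊[1] ⊗ G → G`, and zero on words of other lengths. -/
def moduleCurvature (A : FreeComplex Q R) (e : A.ι) (G : FreeComplex Q X) :
    List A.Pos → G.ι → (G.ι →₀ Q)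
  | [x], c => Finsupp.single c (A.d x e)
  | _, _ => 0

/-- The maps `m^G_n : A₊[1]^{⊗ n-1} ⊗ G → G` of degree `-1`, given by their values `mG w c` on words
`w` of length `n - 1` and basis elements `c` of `G`, satisfy `m^G₁ = d^G` and the relations of an
A-infinity `A`-module structure on `G` for all `n` with `n - 1 ≤ N`. -/
structure IsAInfModuleUpTo (A : FreeComplex Q R) (e : A.ι) (m : List A.Pos → (A.Pos →₀ Q))
    (G : FreeComplex Q X) (N : ℕ) (mG : List A.Pos → G.ι → (G.ι →₀ Q)) : Prop where
  map_nil : ∀ c, mG [] c = G.d c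
  degree : ∀ w c y, mG w c y ≠ 0 → G.deg y + 1 = A.wordDeg w + G.deg c
  relation : ∀ (w : List A.Pos) (c : G.ι), w.length ≤ N →
    (∑ i ∈ Finset.Icc 1 w.length, ∑ j ∈ Finset.range (w.length - i + 1),
      A.sgn (w.take j) • (m ((w.drop j).take i)).sum
        (fun b q => q • mG (w.take j ++ b :: w.drop (j + i)) c)) +
    (∑ j ∈ Finset.range (w.length + 1),
      A.sgn (w.take j) • (mG (w.drop j) c).sum (fun c' q => q • mG (w.take j) c')) =
    A.moduleCurvature e G w c

/-- An A-infinity `A`-module structure on `G`. -/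
def IsAInfModule (A : FreeComplex Q R) (e : A.ι) (m : List A.Pos → (A.Pos →₀ Q))
    (G : FreeComplex Q X) (mG : List A.Pos → G.ι → (G.ι →₀ Q)) : Prop :=
  ∀ N, A.IsAInfModuleUpTo e m G N mG

/-- The bar resolution `R ⊗ Bar A ⊗ G = ⨁_n R ⊗ A₊[1]^{⊗ n} ⊗ G`, with basis the elements
`[x₁|⋯|x_n] ⊗ c`, with differential
`∑ ± [x₁|⋯|x_j|m_i[x_{j+1}|⋯|x_{j+i}]|⋯|x_n] ⊗ c + ∑ ± [x₁|⋯|x_j] ⊗ m^G_{n-j+1}([x_{j+1}|⋯|x_n] ⊗ c)`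
and with the augmentation `[] ⊗ c ↦ ε_G c`, and `[x₁|⋯|x_n] ⊗ c ↦ 0` for `n ≥ 1`. -/
def bar (A : FreeComplex Q R) (m : List A.Pos → (A.Pos →₀ Q)) (G : FreeComplex Q X)
    (mG : List A.Pos → G.ι → (G.ι →₀ Q)) : FreeComplex R X where
  ι := List A.Pos × G.ι
  deg := fun p => A.wordDeg p.1 + G.deg p.2
  d := fun ⟨w, c⟩ =>
    (∑ i ∈ Finset.Icc 1 w.length, ∑ j ∈ Finset.range (w.length - i + 1),
      A.sgn (w.take j) • (m ((w.drop j).take i)).sum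
        (fun b q => Finsupp.single (w.take j ++ b :: w.drop (j + i), c) (algebraMap Q R q))) +
    ∑ j ∈ Finset.range (w.length + 1),
      A.sgn (w.take j) • (mG (w.drop j) c).sum
        (fun c' q => Finsupp.single (w.take j, c') (algebraMap Q R q))
  ε := fun p => match p with
    | ([], c) => G.ε c
    | (_ :: _, _) => 0

end FreeComplex

end

/-! The engine is a count of ranks. Let `A` and `G` be finite minimal `Q`-free resolutions of `R`
and of an `R`-module `X`, with A-infinity structures. The bar differential already makes sense over
`Q`; its square sends `[x₁|⋯|x_n] ⊗ c` to `d₁(x₁) [x₂|⋯|x_n] ⊗ c`, so it vanishes over `R`.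
Exactness over `R` follows from that of `A → R` and `G → X`, by descending induction on the degree
of what follows the first letter (`exists_barCurv_eq`, `bar_isFreeResolution`). The ranks of the bar
resolution satisfy `r_n = β^Q_n(X) + ∑_x r_{n-|x|-1}`, where `x` runs through the basis of `A₊`.
This is the Golod identity with its denominator cleared, so the bar resolution is minimal exactly
when `X` is Golod; it even suffices that the Betti numbers `β^R_n(X)` satisfy the recursion as a
lower bound (`bar_isMinimalFreeResolution`).

Applied to the residue field, this shows that over a Golod ring every `m_n` has its coefficients in
the maximal ideal, because each of them is an entry of the minimal bar resolution of `k`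
(`IsGolodRing.algebraMap_residueField_eq_zero`). Now take any `M` with a `Q`-resolution of length at
most `c` and reduce its bar resolution modulo the maximal ideal. Only the module operations survive,
and in degrees at least `c + 2` none of them can swallow a whole word, since its value would lie
above the top of the `Q`-resolution. So the first letter is inert there, the ranks of the reduced
differentials obey a recursion (`resRank_bar`), and `β^R_i(M) = ∑_x β^R_{i-|x|-1}(M)` for `i ≥ c +
2` (`bettiNumber_eq_shiftSum`).

For the syzygy `N` one has `β^R_n(N) = β^R_{n+c+1}(M)`. The terms of the recursion for `M` not
accounted for by `N` are `∑_{j≤c} β^R_j(M) β^Q_{n+c-j}(R)` for `n ≥ 1`, and the long exact sequences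
of Tor over `Q` bound `β^Q_n(N)` by this same sum. Hence `N` satisfies the lower bound
(`bettiNumber_syzygy_le`), so its bar resolution is minimal and `N` is Golod.

The operations are constructed by obstruction theory: the defect of the next relation is a cycle in
an acyclic complex, by the formula for the square of a coderivation. Finiteness is a matter of
degrees: a letter of `A₊[1]` has degree at least `2`, while `A` and `G` stop at `dim Q`, because
modules over a regular local ring have finite projective dimension. -/

noncomputable section

open CategoryTheory IsLocalRing

/-! ### Regular local rings: domains of finite global dimension. -/

namespace IsRegularLocalRing

/-- A minimal prime of a domain-like situation: if a prime `(x)` contains a prime `p` not containing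
`x`, then `p = 0`. -/
lemma eq_bot_of_le_span_singleton {Q : Type*} [CommRing Q] [IsLocalRing Q] [IsNoetherianRing Q]
    {x : Q} (hx : x ∈ maximalIdeal Q) (p : Ideal Q) [p.IsPrime] (hp : p ≤ Ideal.span {x})
    (hxp : x ∉ p) : p = ⊥ := by
  refine Submodule.eq_bot_of_le_smul_of_le_jacobson_bot (maximalIdeal Q) p
    (IsNoetherian.noetherian p) (fun y hy => ?_) (IsLocalRing.maximalIdeal_le_jacobson _)
  obtain ⟨z, rfl⟩ := Ideal.mem_span_singleton.1 (hp hy)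
  exact Ideal.mul_mem_mul hx ((Ideal.IsPrime.mem_or_mem ‹_› hy).resolve_left hxp)

/-- Prime avoidance. The minimal primes are avoided as well because `Q` is not yet known to be a
domain; this is what makes the domain property inducible from the quotient by `x`. -/
lemma exists_mem_notMem_sq {Q : Type*} [CommRing Q] [IsRegularLocalRing Q]
    (h0 : 0 < ringKrullDim Q) :
    ∃ x ∈ maximalIdeal Q, x ∉ maximalIdeal Q ^ 2 ∧ ∀ p ∈ minimalPrimes Q, x ∉ p := by
  by_contra! hcon
  have hfin : (insert (maximalIdeal Q ^ 2) (minimalPrimes Q)).Finite :=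
    (minimalPrimes.finite_of_isNoetherianRing Q).insert _
  have hsub : ((maximalIdeal Q : Ideal Q) : Set Q) ⊆
      ⋃ I ∈ insert (maximalIdeal Q ^ 2) (minimalPrimes Q), (I : Set Q) := by
    intro x hx
    by_cases hx2 : x ∈ maximalIdeal Q ^ 2
    · exact Set.mem_biUnion (Set.mem_insert _ _) hx2
    · obtain ⟨p, hp, hxp⟩ := hcon x hx hx2
      exact Set.mem_biUnion (Set.mem_insert_of_mem _ hp) hxp
  have hne : maximalIdeal Q ^ 2 ≠ ⊤ := fun h =>
    (maximalIdeal.isMaximal Q).ne_top (top_le_iff.1 (h ▸ Ideal.pow_le_self two_ne_zero))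
  -- Avoidance tolerates two ideals that are not prime, and `𝔪²` is passed for both. The outcome is
  -- that `𝔪` is itself one of the ideals: `𝔪 = 𝔪²` forces `𝔪 = 0` by Nakayama, and a minimal `𝔪`
  -- has height `0`; either contradicts positive dimension.
  rw [Ideal.subset_iUnion_iff_mem_of_isMaximal_of_finite hfin (maximalIdeal Q ^ 2)
    (maximalIdeal Q ^ 2) ?_ hne hne] at hsub
  · rcases hsub with h | h
    · have hb : maximalIdeal Q = ⊥ := by
        refine Submodule.eq_bot_of_le_smul_of_le_jacobson_bot (maximalIdeal Q) _
          (IsNoetherian.noetherian _) ?_ (IsLocalRing.maximalIdeal_le_jacobson _)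
        rw [smul_eq_mul, ← sq]; exact h.le
      have := IsRegularLocalRing.spanFinrank_maximalIdeal (R := Q)
      rw [hb, Submodule.spanFinrank_bot] at this
      simp [← this] at h0
    · have h1 := Ideal.height_eq_zero_iff.2 h
      have h2 := maximalIdeal_height_eq_ringKrullDim (R := Q)
      rw [h1] at h2
      simp [← h2] at h0
  · intro I hI h1 _
    exact (hI.resolve_left h1).1.1

/-- Exchange argument: as `x ∉ 𝔪²`, some coefficient of `x` in a minimal generating set is a unit,
and that generator becomes redundant modulo `x`. The embedding dimension thus drops, whereas the
Krull dimension drops by at most one. -/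
lemma quotient_span_singleton {Q : Type*} [CommRing Q] [IsRegularLocalRing Q] {x : Q}
    (hx : x ∈ maximalIdeal Q) (hx2 : x ∉ maximalIdeal Q ^ 2) {n : ℕ}
    (hn : (maximalIdeal Q).spanFinrank = n + 1) :
    IsRegularLocalRing (Q ⧸ Ideal.span {x}) ∧ ringKrullDim (Q ⧸ Ideal.span {x}) = n := by
  classical
  have hle : Ideal.span {x} ≤ maximalIdeal Q := (Ideal.span_singleton_le_iff_mem _).2 hx
  have : Nontrivial (Q ⧸ Ideal.span {x}) := Ideal.Quotient.nontrivial_iff.2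
    (ne_top_of_le_ne_top (maximalIdeal.isMaximal Q).ne_top hle)
  have : IsLocalRing (Q ⧸ Ideal.span {x}) := .of_surjective' _ Ideal.Quotient.mk_surjective
  obtain ⟨s, hs, hspan⟩ := Submodule.FG.exists_span_finset_card_eq_spanFinrank
    (IsNoetherian.noetherian (maximalIdeal Q))
  have hxs : x ∈ Submodule.span Q (s : Set Q) := hspan ▸ hx
  obtain ⟨a, ha, hax⟩ := Submodule.mem_span_finset.1 hxs
  obtain ⟨y, hy, hay⟩ : ∃ y ∈ s, IsUnit (a y) := by
    by_contra! h
    refine hx2 (hax ▸ Ideal.sum_mem _ fun y hy => ?_)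
    rw [sq]
    exact Ideal.mul_mem_mul ((mem_maximalIdeal _).2 (h y hy))
      (hspan ▸ Submodule.subset_span hy)
  have hmap : maximalIdeal (Q ⧸ Ideal.span {x}) =
      (maximalIdeal Q).map (Ideal.Quotient.mk (Ideal.span {x})) := by
    refine ((IsLocalRing.eq_maximalIdeal ?_)).symm
    exact Ideal.IsMaximal.map_of_surjective_of_ker_le Ideal.Quotient.mk_surjective
      (by rwa [Ideal.mk_ker])
  have hmap2 : maximalIdeal (Q ⧸ Ideal.span {x}) =
      Submodule.span _ ((s.erase y).image (Ideal.Quotient.mk (Ideal.span {x})) :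
        Finset (Q ⧸ Ideal.span {x})) := by
    apply le_antisymm
    · rw [hmap, ← hspan]
      change Ideal.map _ (Ideal.span _) ≤ _
      rw [Ideal.map_span]
      refine Submodule.span_le.2 ?_
      rintro _ ⟨z, hz, rfl⟩
      by_cases hzy : z = y
      · subst hzy
        have h0 : (Ideal.Quotient.mk (Ideal.span {x})) x = 0 :=
          Ideal.Quotient.eq_zero_iff_mem.2 (Ideal.mem_span_singleton_self x)
        have hax' := congrArg (Ideal.Quotient.mk (Ideal.span {x})) hax
        rw [h0, ← Finset.add_sum_erase _ _ hy, map_add, smul_eq_mul, map_mul] at hax'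
        replace h0 := hax'
        obtain ⟨b, hb⟩ := hay.exists_left_inv
        have h1 : (Ideal.Quotient.mk (Ideal.span {x})) z = Ideal.Quotient.mk (Ideal.span {x}) (-b) *
            ∑ w ∈ s.erase z, Ideal.Quotient.mk (Ideal.span {x}) (a w) *
              Ideal.Quotient.mk (Ideal.span {x}) w := by
          rw [map_sum] at h0
          simp only [smul_eq_mul, map_mul] at h0
          rw [eq_neg_of_add_eq_zero_right h0, map_neg, neg_mul_neg, ← mul_assoc, ← map_mul, hb,
            map_one, one_mul]
        rw [h1]
        refine Ideal.mul_mem_left _ _ (Ideal.sum_mem _ fun w hw => Ideal.mul_mem_left _ _ ?_)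
        exact Submodule.subset_span (by simpa using ⟨w, (Finset.mem_erase.1 hw).symm, rfl⟩)
      · exact Submodule.subset_span (by simpa using ⟨z, ⟨hz, hzy⟩, rfl⟩)
    · refine Submodule.span_le.2 ?_
      intro z hz
      simp only [Finset.coe_image, Set.mem_image] at hz
      obtain ⟨w, hw, rfl⟩ := hz
      rw [hmap]
      exact Ideal.mem_map_of_mem _ (hspan ▸ Submodule.subset_span (Finset.mem_of_mem_erase hw))
  have hrank : (maximalIdeal (Q ⧸ Ideal.span {x})).spanFinrank ≤ n := by
    rw [hmap2]
    refine (Submodule.spanFinrank_span_le_ncard_of_finite (Finset.finite_toSet _)).trans ?_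
    rw [Set.ncard_coe_finset]
    refine Finset.card_image_le.trans ?_
    rw [Finset.card_erase_of_mem hy, hs, hn]; simp
  have hdim : (n : WithBot ℕ∞) ≤ ringKrullDim (Q ⧸ Ideal.span {x}) := by
    have h1 := ringKrullDim_le_ringKrullDim_quotient_add_encard {x} (by
      simpa [← IsLocalRing.ringJacobson_eq_maximalIdeal] using hx)
    rw [← IsRegularLocalRing.spanFinrank_maximalIdeal, hn, Set.encard_singleton] at h1
    exact (ENat.WithBot.add_le_add_natCast_right_iff (c := 1)).1 (by exact_mod_cast h1)
  have hreg : IsRegularLocalRing (Q ⧸ Ideal.span {x}) :=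
    of_spanFinrank_maximalIdeal_le _ ((Nat.cast_le.2 hrank).trans hdim)
  refine ⟨hreg, le_antisymm ?_ hdim⟩
  rw [← hreg.spanFinrank_maximalIdeal]
  exact Nat.cast_le.2 hrank

/-- The free module `Y →₀ Q ⧸ (x)` has projective dimension at most one over `Q`. -/
lemma hasProjectiveDimensionLT_two_finsupp_quotient {Q : Type u} [CommRing Q] {x : Q}
    (hx : x ∈ nonZeroDivisors Q) (Y : Type u) :
    HasProjectiveDimensionLT (ModuleCat.of Q (Y →₀ (Q ⧸ Ideal.span {x}))) 2 := by
  let f : (Y →₀ Q) →ₗ[Q] (Y →₀ Q) := LinearMap.lsmul Q _ x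
  let g : (Y →₀ Q) →ₗ[Q] (Y →₀ (Q ⧸ Ideal.span {x})) :=
    Finsupp.mapRange.linearMap (Ideal.Quotient.mkₐ Q (Ideal.span {x})).toLinearMap
  have hfg : g ∘ₗ f = 0 := by
    ext y i
    simp [f, g]
  let S : ShortComplex (ModuleCat.{u} Q) := ⟨ModuleCat.ofHom f, ModuleCat.ofHom g, by
    rw [← ModuleCat.ofHom_comp, hfg]; rfl⟩
  have hS : S.ShortExact :=
    { exact := by
        rw [ShortComplex.moduleCat_exact_iff]
        intro z hz
        change g z = 0 at hz
        have h : ∀ y, ∃ a, x * a = z y := fun y => by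
          have := DFunLike.congr_fun hz y
          simp only [g, Finsupp.mapRange.linearMap_apply, Finsupp.mapRange_apply] at this
          obtain ⟨a, ha⟩ := Ideal.mem_span_singleton.1
            (Ideal.Quotient.eq_zero_iff_mem.1 this)
          exact ⟨a, ha.symm⟩
        choose a ha using h
        refine ⟨z.support.sum fun y => Finsupp.single y (a y), ?_⟩
        change f _ = z
        rw [map_sum]
        conv_rhs => rw [← Finsupp.sum_single z]
        exact Finset.sum_congr rfl fun y _ => by simp [f, ha]
      mono_f := by
        rw [ModuleCat.mono_iff_injective]
        intro a b hab
        ext y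
        have := DFunLike.congr_fun (show f a = f b from hab) y
        simp only [f, LinearMap.lsmul_apply, Finsupp.smul_apply, smul_eq_mul] at this
        exact (mul_cancel_left_mem_nonZeroDivisors hx).1 this
      epi_g := by
        rw [ModuleCat.epi_iff_surjective]
        exact Finsupp.mapRange_surjective _ (map_zero _) Ideal.Quotient.mk_surjective }
  exact hS.hasProjectiveDimensionLT_X₃ 1 (inferInstanceAs
    (HasProjectiveDimensionLT (ModuleCat.of Q (Y →₀ Q)) 1)) (inferInstanceAs
    (HasProjectiveDimensionLT (ModuleCat.of Q (Y →₀ Q)) (1 + 1)))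

/-- Change of rings. A projective module over `Q ⧸ (x)` is a retract of a free one, which has
projective dimension at most `1` over `Q`; the general case descends to syzygies. -/
lemma hasProjectiveDimensionLE_succ_of_quotient {Q : Type u} [CommRing Q] {x : Q}
    (hx : x ∈ nonZeroDivisors Q) (n : ℕ) :
    ∀ (Y : Type u) [AddCommGroup Y] [Module Q Y] [Module (Q ⧸ Ideal.span {x}) Y]
      [IsScalarTower Q (Q ⧸ Ideal.span {x}) Y],
      HasProjectiveDimensionLE (ModuleCat.of (Q ⧸ Ideal.span {x}) Y) n →
        HasProjectiveDimensionLE (ModuleCat.of Q Y) (n + 1) := by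
  induction n with
  | zero =>
    intro Y _ _ _ _ h
    have hproj : Module.Projective (Q ⧸ Ideal.span {x}) Y :=
      (IsProjective.iff_projective _).2 (projective_iff_hasProjectiveDimensionLT_one.2 h)
    obtain ⟨s, hs⟩ := hproj.out
    have h2 := hasProjectiveDimensionLT_two_finsupp_quotient hx Y
    let r : Retract (ModuleCat.of Q Y) (ModuleCat.of Q (Y →₀ (Q ⧸ Ideal.span {x}))) :=
      { i := ModuleCat.ofHom (s.restrictScalars Q)
        r := ModuleCat.ofHom
          ((Finsupp.linearCombination (Q ⧸ Ideal.span {x}) (id : Y → Y)).restrictScalars Q)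
        retract := by
          ext y
          exact hs y }
    exact r.hasProjectiveDimensionLT 2
  | succ n ih =>
    intro Y _ _ _ _ h
    let f : (Y →₀ (Q ⧸ Ideal.span {x})) →ₗ[Q ⧸ Ideal.span {x}] Y :=
      Finsupp.linearCombination _ (id : Y → Y)
    have hf : Function.Surjective f := fun y => ⟨Finsupp.single y 1, by simp [f]⟩
    have h1 := ((LinearMap.shortExact_shortComplexKer hf).hasProjectiveDimensionLT_X₃_iff n
      (inferInstanceAs (Projective (ModuleCat.of _ (Y →₀ (Q ⧸ Ideal.span {x})))))).1 h
    have h2 := ih (LinearMap.ker f) h1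
    have h3 : HasProjectiveDimensionLT (ModuleCat.of Q (LinearMap.ker (f.restrictScalars Q)))
      (n + 1 + 1) := h2
    have h4 := hasProjectiveDimensionLT_two_finsupp_quotient hx Y
    exact (LinearMap.shortExact_shortComplexKer (f := f.restrictScalars Q) hf)
      |>.hasProjectiveDimensionLT_X₃ (n + 1 + 1) h3 (hasProjectiveDimensionLT_of_ge _ 2 _ (by lia))

/-- A regular local ring is a domain, and its global dimension is at most its Krull dimension. -/
theorem isDomain_and_hasProjectiveDimensionLE (n : ℕ) :
    ∀ (Q : Type u) [CommRing Q] [IsRegularLocalRing Q], (maximalIdeal Q).spanFinrank = n →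
      IsDomain Q ∧ ∀ (M : Type u) [AddCommGroup M] [Module Q M] [Module.Finite Q M],
        HasProjectiveDimensionLE (ModuleCat.of Q M) n := by
  induction n with
  | zero =>
    intro Q _ _ hn
    have hbot : maximalIdeal Q = ⊥ :=
      (Submodule.spanFinrank_eq_zero_iff_eq_bot (IsNoetherian.noetherian _)).1 hn
    have hfield := IsLocalRing.isField_iff_maximalIdeal_eq.2 hbot
    refine ⟨hfield.isDomain, fun M _ _ _ => ?_⟩
    let := hfield.toField
    exact inferInstanceAs (HasProjectiveDimensionLT (ModuleCat.of Q M) 1)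
  | succ n ih =>
    intro Q _ _ hn
    have hdim : ringKrullDim Q = (n + 1 : ℕ) := by
      rw [← IsRegularLocalRing.spanFinrank_maximalIdeal, hn]
    obtain ⟨x, hx, hx2, hmin⟩ := exists_mem_notMem_sq (Q := Q) (by
      rw [hdim]; exact_mod_cast n.succ_pos)
    obtain ⟨hreg, hdimq⟩ := quotient_span_singleton hx hx2 hn
    have hnq : (maximalIdeal (Q ⧸ Ideal.span {x})).spanFinrank = n := by
      have := hreg.spanFinrank_maximalIdeal
      rw [hdimq] at this
      exact_mod_cast this
    obtain ⟨hdom, hpd⟩ := ih (Q ⧸ Ideal.span {x}) hnq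
    have hprime : (Ideal.span {x}).IsPrime := (Ideal.Quotient.isDomain_iff_prime _).1 hdom
    have hQ : IsDomain Q := by
      -- A minimal prime inside the prime `(x)` does not contain `x`, so it equals `x` times itself
      -- and vanishes by Nakayama.
      obtain ⟨p, hp, hpx⟩ := Ideal.exists_minimalPrimes_le (bot_le : ⊥ ≤ Ideal.span {x})
      have := hp.1.1
      have hpb := eq_bot_of_le_span_singleton hx p hpx (hmin p hp)
      rw [hpb] at this
      exact IsDomain.of_bot_isPrime Q
    refine ⟨hQ, fun M _ _ _ => ?_⟩
    have hx0 : x ∈ nonZeroDivisors Q := mem_nonZeroDivisors_of_ne_zero (by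
      rintro rfl; exact hx2 (zero_mem _))
    obtain ⟨b, f, hf⟩ := Module.Finite.exists_fin' Q M
    let g : (ULift.{u} (Fin b) → Q) →ₗ[Q] M := f ∘ₗ LinearMap.funLeft Q Q ULift.up
    have hg : Function.Surjective g := hf.comp
      (LinearMap.funLeft_surjective_of_injective _ _ _ ULift.up_injective)
    -- `M` may have `x`-torsion, but its first syzygy sits in a free module over the domain `Q`. For
    -- the syzygy, division by `x` raises the projective dimension by exactly one, and the quotient
    -- is controlled by induction over `Q ⧸ (x)`.
    have hN : IsSMulRegular (LinearMap.ker g) x := by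
      intro a b hab
      ext i
      have := congrFun (congrArg Subtype.val hab) i
      simpa [nonZeroDivisors.ne_zero hx0] using this
    have h1 := ModuleCat.projectiveDimension_quotSMulTop_eq_succ_of_isSMulRegular
      (ModuleCat.of Q (LinearMap.ker g)) x hN hx
    have h2 : HasProjectiveDimensionLE (ModuleCat.of Q (QuotSMulTop x (LinearMap.ker g)))
        (n + 1) := by
      have := hasProjectiveDimensionLE_succ_of_quotient hx0 n
        (TensorProduct Q (Q ⧸ Ideal.span {x}) (LinearMap.ker g)) (hpd _)
      exact hasProjectiveDimensionLT_of_iso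
        (QuotSMulTop.equivQuotTensor x (LinearMap.ker g)).symm.toModuleIso _
    rw [← projectiveDimension_le_iff] at h2
    have h3 : projectiveDimension (ModuleCat.of Q (LinearMap.ker g)) ≤ (n : ℕ) := by
      have h4 := h1.symm.le.trans h2
      exact (ENat.WithBot.add_le_add_natCast_right_iff (c := 1)).1 (by exact_mod_cast h4)
    rw [projectiveDimension_le_iff] at h3
    exact (LinearMap.shortExact_shortComplexKer hg).hasProjectiveDimensionLT_X₃ (n + 1) h3
      (hasProjectiveDimensionLT_of_ge (ModuleCat.of Q (ULift.{u} (Fin b) → Q)) 1 _ (by lia))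

/-- Auslander–Buchsbaum–Serre: finitely generated modules over a regular local ring `Q` have
projective dimension at most `dim Q`. -/
theorem projectiveDimension_le_ringKrullDim {Q : Type u} [CommRing Q] [IsRegularLocalRing Q]
    (M : Type u) [AddCommGroup M] [Module Q M] [Module.Finite Q M] :
    projectiveDimension (ModuleCat.of Q M) ≤ ringKrullDim Q := by
  rw [← IsRegularLocalRing.spanFinrank_maximalIdeal, projectiveDimension_le_iff]
  exact (isDomain_and_hasProjectiveDimensionLE _ Q rfl).2 M

end IsRegularLocalRing

end

noncomputable section

open CategoryTheory MonoidalCategory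

/-! ### Lengths of Tor modules -/

/-- The length of `Tor_n^S(X, k)`. -/
def torLength (S : Type u) [CommRing S] [IsLocalRing S] (X : Type u) [AddCommGroup X]
    [Module S X] (n : ℕ) : ℕ∞ :=
  Module.length S
      ↑(((CategoryTheory.Tor (ModuleCat.{u} S) n).obj (ModuleCat.of S X)).obj
        (ModuleCat.of S (IsLocalRing.ResidueField S)))

section

variable {S : Type u} [CommRing S]

/-- The tensor product of a module with a complex. -/
abbrev tensorComplex (X : ModuleCat.{u} S) (K : ChainComplex (ModuleCat.{u} S) ℕ) :
    ChainComplex (ModuleCat.{u} S) ℕ :=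
  (((tensoringLeft (ModuleCat.{u} S)).obj X).mapHomologicalComplex _).obj K

/-- The short complex of complexes obtained by tensoring a short complex of modules with a
complex. -/
def tensorShortComplex (C : ShortComplex (ModuleCat.{u} S))
    (K : ChainComplex (ModuleCat.{u} S) ℕ) : ShortComplex (ChainComplex (ModuleCat.{u} S) ℕ) where
  X₁ := tensorComplex C.X₁ K
  X₂ := tensorComplex C.X₂ K
  X₃ := tensorComplex C.X₃ K
  f := (NatTrans.mapHomologicalComplex ((tensoringLeft (ModuleCat.{u} S)).map C.f) _).app K
  g := (NatTrans.mapHomologicalComplex ((tensoringLeft (ModuleCat.{u} S)).map C.g) _).app K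
  zero := by
    ext i : 1
    change C.f ▷ K.X i ≫ C.g ▷ K.X i = 0
    rw [← MonoidalCategory.comp_whiskerRight, C.zero, MonoidalPreadditive.zero_whiskerRight]

/-- Flatness of the terms of `K` keeps every degree exact; this is the input of all long exact
sequences of Tor below. -/
lemma tensorShortComplex_shortExact {C : ShortComplex (ModuleCat.{u} S)} (hC : C.ShortExact)
    (K : ChainComplex (ModuleCat.{u} S) ℕ) (hK : ∀ i, Module.Flat S (K.X i)) :
    (tensorShortComplex C K).ShortExact := by
  refine HomologicalComplex.shortExact_of_degreewise_shortExact _ fun i => ?_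
  have := hK i
  change (C.map (tensorRight (K.X i))).ShortExact
  have := hC.mono_f
  have := hC.epi_g
  exact
    { exact := Module.Flat.rTensor_shortComplex_exact (K.X i) C hC.exact
      mono_f := inferInstanceAs (Mono ((tensorRight (K.X i)).map C.f))
      epi_g := by
        rw [ModuleCat.epi_iff_surjective]
        exact LinearMap.rTensor_surjective _ ((ModuleCat.epi_iff_surjective _).1 hC.epi_g) }

lemma length_le_of_shortComplex_exact {C : ShortComplex (ModuleCat.{u} S)} (hC : C.Exact) :
    Module.length S C.X₂ ≤ Module.length S C.X₁ + Module.length S C.X₃ := by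
  rw [CategoryTheory.ShortComplex.ShortExact.moduleCat_exact_iff_function_exact] at hC
  rw [Module.length_eq_add_of_exact (LinearMap.ker C.g.hom).subtype C.g.hom.rangeRestrict
    (Submodule.subtype_injective _) C.g.hom.surjective_rangeRestrict (by
      rw [LinearMap.exact_iff, LinearMap.ker_rangeRestrict, Submodule.range_subtype])]
  refine add_le_add ?_ (Module.length_le_of_injective _ (Submodule.subtype_injective _))
  rw [LinearMap.exact_iff.1 hC]
  exact Module.length_le_of_surjective _ C.f.hom.surjective_rangeRestrict

variable [IsLocalRing S]

variable (S) in
/-- A projective resolution of the residue field. -/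
def residueFieldResolution :
    ProjectiveResolution (ModuleCat.of S (IsLocalRing.ResidueField S)) :=
  ProjectiveResolution.of _

lemma flat_residueFieldResolution (i : ℕ) :
    Module.Flat S ((residueFieldResolution S).complex.X i) := by
  have : Module.Projective S ((residueFieldResolution S).complex.X i) :=
    (IsProjective.iff_projective _).2 ((residueFieldResolution S).projective i)
  infer_instance

/-- Tor is derived in its second variable, so one fixed resolution of the residue field serves all
`X` and is functorial in `X`. -/
lemma torLength_eq_homology (X : Type u) [AddCommGroup X] [Module S X] (n : ℕ) :
    torLength S X n = Module.length S
      ((tensorComplex (ModuleCat.of S X) (residueFieldResolution S).complex).homology n) :=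
  (((residueFieldResolution S).isoLeftDerivedObj
    ((tensoringLeft (ModuleCat.{u} S)).obj (ModuleCat.of S X)) n).toLinearEquiv).length_eq

lemma torLength_congr {X Y : Type u} [AddCommGroup X] [Module S X] [AddCommGroup Y] [Module S Y]
    (e : X ≃ₗ[S] Y) (n : ℕ) : torLength S X n = torLength S Y n :=
  ((((CategoryTheory.Tor (ModuleCat.{u} S) n).mapIso e.toModuleIso).app _).toLinearEquiv).length_eq

lemma torLength_zero (X : Type u) [AddCommGroup X] [Module S X] :
    torLength S X 0 = Module.length S (TensorProduct S X (IsLocalRing.ResidueField S)) :=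
  ((((tensorLeft (ModuleCat.of S X)).leftDerivedZeroIsoSelf).app _).toLinearEquiv).length_eq

lemma isZero_homology_tensorComplex_of_flat (X : Type u) [AddCommGroup X] [Module S X]
    [Module.Flat S X] (n : ℕ) :
    Limits.IsZero ((tensorComplex (ModuleCat.of S X)
      (residueFieldResolution S).complex).homology (n + 1)) := by
  have h := (residueFieldResolution S).complex_exactAt_succ n
  rw [HomologicalComplex.exactAt_iff' _ (n + 2) (n + 1) n (by simp) (by simp)] at h
  rw [← HomologicalComplex.exactAt_iff_isZero_homology,
    HomologicalComplex.exactAt_iff' _ (n + 2) (n + 1) n (by simp) (by simp)]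
  generalize (residueFieldResolution S).complex = K at h ⊢
  rw [ShortComplex.ShortExact.moduleCat_exact_iff_function_exact] at h ⊢
  exact Module.Flat.lTensor_exact X h

lemma torLength_succ_of_flat (X : Type u) [AddCommGroup X] [Module S X] [Module.Flat S X] (n : ℕ) :
    torLength S X (n + 1) = 0 := by
  rw [torLength_eq_homology, Module.length_eq_zero_iff]
  exact ModuleCat.isZero_iff_subsingleton.1 (isZero_homology_tensorComplex_of_flat X n)

section ShortExact

variable {N F Z : Type u} [AddCommGroup N] [Module S N] [AddCommGroup F] [Module S F]
  [AddCommGroup Z] [Module S Z] {f : N →ₗ[S] F} {g : F →ₗ[S] Z}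

lemma exists_shortExact_tensorComplex (hf : Function.Injective f) (hg : Function.Surjective g)
    (h : Function.Exact f g) :
    ∃ C : ShortComplex (ChainComplex (ModuleCat.{u} S) ℕ), C.ShortExact ∧
      (∀ n, torLength S N n = Module.length S (C.X₁.homology n)) ∧
      (∀ n, torLength S F n = Module.length S (C.X₂.homology n)) ∧
      (∀ n, torLength S Z n = Module.length S (C.X₃.homology n)) := by
  let C : ShortComplex (ModuleCat.{u} S) := ⟨ModuleCat.ofHom f, ModuleCat.ofHom g, by
    ext x; exact h.apply_apply_eq_zero x⟩
  have hC : C.ShortExact :=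
    { exact := (ShortComplex.ShortExact.moduleCat_exact_iff_function_exact C).2 h
      mono_f := (ModuleCat.mono_iff_injective _).2 hf
      epi_g := (ModuleCat.epi_iff_surjective _).2 hg }
  exact ⟨tensorShortComplex C _, tensorShortComplex_shortExact hC _ flat_residueFieldResolution,
    torLength_eq_homology N, torLength_eq_homology F, torLength_eq_homology Z⟩

variable (hf : Function.Injective f) (hg : Function.Surjective g) (h : Function.Exact f g)
include hf hg h

lemma torLength_middle_le (n : ℕ) : torLength S F n ≤ torLength S N n + torLength S Z n := by
  obtain ⟨C, hC, h1, h2, h3⟩ := exists_shortExact_tensorComplex hf hg h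
  rw [h1, h2, h3]
  exact length_le_of_shortComplex_exact (hC.homology_exact₂ n)

lemma torLength_left_le (n : ℕ) : torLength S N n ≤ torLength S Z (n + 1) + torLength S F n := by
  obtain ⟨C, hC, h1, h2, h3⟩ := exists_shortExact_tensorComplex hf hg h
  rw [h1, h2, h3]
  exact length_le_of_shortComplex_exact (hC.homology_exact₁ (n + 1) n (by simp))

lemma torLength_right_le (n : ℕ) :
    torLength S Z (n + 1) ≤ torLength S F (n + 1) + torLength S N n := by
  obtain ⟨C, hC, h1, h2, h3⟩ := exists_shortExact_tensorComplex hf hg h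
  rw [h1, h2, h3]
  exact length_le_of_shortComplex_exact (hC.homology_exact₃ (n + 1) n (by simp))

lemma torLength_succ_succ_of_flat [Module.Flat S F] (n : ℕ) :
    torLength S Z (n + 2) = torLength S N (n + 1) := by
  apply le_antisymm
  · simpa [torLength_succ_of_flat] using torLength_right_le hf hg h (n + 1)
  · simpa [torLength_succ_of_flat] using torLength_left_le hf hg h (n + 1)

/-- Alternating sum of lengths along `0 → Tor₁(Z) → N ⊗ k → F ⊗ k → Z ⊗ k → 0`, arranged without
subtraction since lengths may be infinite. -/
lemma torLength_one_of_flat [Module.Flat S F] :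
    torLength S Z 1 + torLength S F 0 = torLength S N 0 + torLength S Z 0 := by
  obtain ⟨C, hC, h1, h2, h3⟩ := exists_shortExact_tensorComplex hf hg h
  have hF : Limits.IsZero (C.X₂.homology 1) := ModuleCat.isZero_iff_subsingleton.2 <|
    (Module.length_eq_zero_iff (R := S)).1 ((h2 1).symm.trans (torLength_succ_of_flat F 0))
  have e1 := hC.homology_exact₁ 1 0 (by simp)
  have e2 := hC.homology_exact₂ 0
  have m : Mono (hC.δ 1 0 (by simp)) := hC.mono_δ 1 0 (by simp) hF
  have := hC.epi_g
  have p : Epi (HomologicalComplex.homologyMap C.g 0) :=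
    HomologicalComplex.epi_homologyMap_of_epi_of_not_rel _ _ (by simp)
  rw [ModuleCat.mono_iff_injective] at m
  rw [ModuleCat.epi_iff_surjective] at p
  rw [ShortComplex.ShortExact.moduleCat_exact_iff_function_exact] at e1 e2
  have l1 := Module.length_eq_add_of_exact (hC.δ 1 0 (by simp)).hom
    (HomologicalComplex.homologyMap C.f 0).hom.rangeRestrict m
    (LinearMap.surjective_rangeRestrict _) (by
      rw [LinearMap.exact_iff, LinearMap.ker_rangeRestrict]
      exact LinearMap.exact_iff.1 e1)
  have l2 := Module.length_eq_add_of_exact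
    (LinearMap.range (HomologicalComplex.homologyMap C.f 0).hom).subtype
    (HomologicalComplex.homologyMap C.g 0).hom (Submodule.subtype_injective _) p (by
      rw [LinearMap.exact_iff, Submodule.range_subtype]
      exact LinearMap.exact_iff.1 e2)
  rw [h3, h2, h1, h3, l2, l1, add_assoc]

end ShortExact

/-- The length of `Tor` of a direct sum of `b` copies of `X`. -/
lemma torLength_pi_le (X : Type u) [AddCommGroup X] [Module S X] (n b : ℕ) :
    torLength S (Fin b → X) n ≤ b * torLength S X n := by
  induction b with
  | zero =>
    have h : torLength S (Fin 0 → X) n ≤ 0 := by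
      rcases n with _ | n
      · rw [torLength_zero, Module.length_eq_zero_iff.2 inferInstance]
      · exact (torLength_succ_of_flat _ n).le
    simpa using h
  | succ b ih =>
    -- The split sequence `X → X^{b+1} → X^b`; an upper bound is all that is used later, so the
    -- splitting plays no role.
    have h := torLength_middle_le (S := S) (N := X) (F := Fin (b + 1) → X) (Z := Fin b → X)
      (f := LinearMap.single S (fun _ : Fin (b + 1) => X) 0)
      (g := LinearMap.funLeft S X Fin.succ)
      (Pi.single_injective (M := fun _ : Fin (b + 1) => X) 0)
      (LinearMap.funLeft_surjective_of_injective _ _ _ (Fin.succ_injective b))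
      (fun z => ⟨fun hz => ⟨z 0, by
        ext i
        refine Fin.cases ?_ (fun j => ?_) i
        · simp
        · simpa using (congrFun hz j).symm⟩, by
        rintro ⟨y, rfl⟩
        ext j
        simp⟩) n
    refine h.trans ?_
    push_cast
    rw [add_mul, one_mul, add_comm]
    exact add_le_add_left ih _

end

end

noncomputable section

open IsLocalRing

/-! ### Graded free complexes, partial resolutions and their syzygies. -/

namespace FreeComplex

variable {S X : Type u} [CommRing S] [AddCommGroup X] [Module S X] {F : FreeComplex S X}

/-! ### Homogeneous components -/

@[simp] lemma D_single (F : FreeComplex S X) (x : F.ι) (a : S) :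
    F.D (Finsupp.single x a) = a • F.d x :=
  Finsupp.linearCombination_single ..

@[simp] lemma aug_single (F : FreeComplex S X) (x : F.ι) (a : S) :
    F.aug (Finsupp.single x a) = a • F.ε x :=
  Finsupp.linearCombination_single ..

/-- The part of degree `n` of `F`. -/
abbrev degreePart (F : FreeComplex S X) (n : ℕ) : Submodule S (F.ι →₀ S) :=
  Finsupp.supported S S {x | F.deg x = n}

lemma mem_degreePart {n : ℕ} {z : F.ι →₀ S} :
    z ∈ F.degreePart n ↔ ∀ x, F.deg x ≠ n → z x = 0 :=
  Finsupp.mem_supported' ..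

lemma filter_mem_degreePart (n : ℕ) (z : F.ι →₀ S) :
    z.filter (fun x => F.deg x = n) ∈ F.degreePart n :=
  mem_degreePart.2 fun _ hx => Finsupp.filter_apply_neg _ _ hx

lemma D_filter {p q : F.ι → Prop} [DecidablePred p] [DecidablePred q]
    (h : ∀ x y, F.d x y ≠ 0 → (p x ↔ q y)) (z : F.ι →₀ S) :
    F.D (z.filter p) = (F.D z).filter q := by
  induction z using Finsupp.induction_linear with
  | zero => simp [Finsupp.filter_zero]
  | add f g hf hg => rw [Finsupp.filter_add, map_add, hf, hg, map_add, Finsupp.filter_add]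
  | single x a =>
    ext y
    by_cases hxy : F.d x y = 0
    · have h0 : (F.D (Finsupp.single x a)) y = 0 := by simp [hxy]
      rw [Finsupp.filter_apply, h0, ite_self]
      by_cases hp : p x
      · rw [Finsupp.filter_single_of_pos _ hp, h0]
      · simp [Finsupp.filter_single_of_neg _ hp]
    · have := h x y hxy
      by_cases hp : p x
      · rw [Finsupp.filter_single_of_pos _ hp, Finsupp.filter_apply_pos _ _ (this.1 hp)]
      · rw [Finsupp.filter_single_of_neg _ hp, Finsupp.filter_apply_neg _ _ (mt this.2 hp)]
        simp

lemma aug_eq_zero_of_deg (h : F.IsComplex) {z : F.ι →₀ S} (hz : ∀ x, F.deg x = 0 → z x = 0) :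
    F.aug z = 0 := by
  rw [aug, Finsupp.linearCombination_apply, Finsupp.sum]
  refine Finset.sum_eq_zero fun x _ => ?_
  by_cases hx : F.deg x = 0
  · rw [hz x hx, zero_smul]
  · rw [h.aug_eq_zero x hx, smul_zero]

lemma D_apply (z : F.ι →₀ S) (y : F.ι) : F.D z y = z.sum fun x a => a * F.d x y := by
  rw [D, Finsupp.linearCombination_apply, Finsupp.sum_apply]
  rfl

lemma IsComplex.D_apply_eq_zero (h : F.IsComplex) {z : F.ι →₀ S} {y : F.ι}
    (hz : ∀ x, F.deg x = F.deg y + 1 → z x = 0) : F.D z y = 0 := by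
  rw [D_apply, Finsupp.sum]
  refine Finset.sum_eq_zero fun x _ => ?_
  by_cases hx : F.d x y = 0
  · rw [hx, mul_zero]
  · rw [hz x (h.deg_d x y hx), zero_mul]

lemma IsComplex.D_mem_degreePart (h : F.IsComplex) {n : ℕ} {z : F.ι →₀ S}
    (hz : z ∈ F.degreePart (n + 1)) : F.D z ∈ F.degreePart n := by
  rw [mem_degreePart] at hz ⊢
  intro y hy
  exact h.D_apply_eq_zero fun x hx => hz x (by omega)

lemma IsComplex.D_eq_zero (h : F.IsComplex) {z : F.ι →₀ S} (hz : z ∈ F.degreePart 0) :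
    F.D z = 0 := by
  ext y
  exact h.D_apply_eq_zero fun x hx => mem_degreePart.1 hz x (by omega)

lemma IsComplex.aug_eq_zero_of_mem (h : F.IsComplex) {n : ℕ} {z : F.ι →₀ S}
    (hz : z ∈ F.degreePart (n + 1)) : F.aug z = 0 :=
  aug_eq_zero_of_deg h fun x hx => mem_degreePart.1 hz x (by omega)

lemma IsComplex.D_filter_deg (h : F.IsComplex) (n : ℕ) (z : F.ι →₀ S) :
    F.D (z.filter fun x => F.deg x = n + 1) = (F.D z).filter fun x => F.deg x = n :=
  D_filter (fun x y hxy => by have := h.deg_d x y hxy; omega) z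

lemma IsComplex.aug_filter_deg_zero (h : F.IsComplex) (z : F.ι →₀ S) :
    F.aug (z.filter fun x => F.deg x = 0) = F.aug z := by
  conv_rhs => rw [← Finsupp.filter_add_filter_not z (fun x => F.deg x = 0), map_add]
  rw [aug_eq_zero_of_deg h (z := z.filter fun x => ¬ F.deg x = 0), add_zero]
  exact fun x hx => Finsupp.filter_apply_neg _ _ (not_not.2 hx)

lemma mem_syzygy {n : ℕ} {z : F.ι →₀ S} :
    z ∈ F.syzygy n ↔ z ∈ F.degreePart n ∧ F.D z = 0 ∧ F.aug z = 0 :=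
  Iff.rfl

/-! ### Resolutions -/

/-- A free resolution of `X`, not necessarily minimal. -/
structure IsFreeResolution (F : FreeComplex S X) : Prop where
  isComplex : F.IsComplex
  surjective : Function.Surjective F.aug
  exact : ∀ z, F.D z = 0 → F.aug z = 0 → ∃ z', F.D z' = z

/-- A complex that is a resolution in degrees below `n`. -/
structure IsResolutionBelow (F : FreeComplex S X) (n : ℕ) : Prop where
  isComplex : F.IsComplex
  surjective : Function.Surjective F.aug
  exact : ∀ z, (∀ x, z x ≠ 0 → F.deg x < n) → F.D z = 0 → F.aug z = 0 → ∃ z', F.D z' = z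

lemma IsFreeResolution.isResolutionBelow (h : F.IsFreeResolution) (n : ℕ) :
    F.IsResolutionBelow n :=
  ⟨h.isComplex, h.surjective, fun z _ => h.exact z⟩

lemma IsMinimalStart.isResolutionBelow [IsLocalRing S] {n : ℕ} (h : F.IsMinimalStart n) :
    F.IsResolutionBelow n :=
  ⟨h.isComplex, h.surjective, h.exact⟩

lemma IsMinimalFreeResolution.isFreeResolution [IsLocalRing S] (h : F.IsMinimalFreeResolution) :
    F.IsFreeResolution :=
  ⟨h.isComplex, h.surjective, h.exact⟩

lemma IsResolutionBelow.exists_degreePart {n m : ℕ} (h : F.IsResolutionBelow n) (hm : m < n)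
    {z : F.ι →₀ S} (hz : z ∈ F.syzygy m) : ∃ z' ∈ F.degreePart (m + 1), F.D z' = z := by
  obtain ⟨h1, h2, h3⟩ := mem_syzygy.1 hz
  obtain ⟨z', hz'⟩ := h.exact z (fun x hx => by
    by_contra hlt
    exact hx (mem_degreePart.1 h1 x (by omega))) h2 h3
  refine ⟨_, filter_mem_degreePart (m + 1) z', ?_⟩
  rw [h.isComplex.D_filter_deg, hz']
  ext x
  rw [Finsupp.filter_apply]
  split_ifs with hx
  · rfl
  · exact (mem_degreePart.1 h1 x hx).symm

lemma IsComplex.D_mem_syzygy (h : F.IsComplex) {n : ℕ} {z : F.ι →₀ S}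
    (hz : z ∈ F.degreePart (n + 1)) : F.D z ∈ F.syzygy n :=
  ⟨h.D_mem_degreePart hz, h.D_D z, h.aug_D z⟩

/-- The differential as a map from the degree `n + 1` part onto the syzygy. -/
def toSyzygy (h : F.IsComplex) (n : ℕ) : F.degreePart (n + 1) →ₗ[S] F.syzygy n :=
  (F.D.comp (F.degreePart (n + 1)).subtype).codRestrict _ fun z => h.D_mem_syzygy z.2

/-- The augmentation on the degree `0` part. -/
def augZero (F : FreeComplex S X) : F.degreePart 0 →ₗ[S] X :=
  F.aug.comp (F.degreePart 0).subtype

/-- The inclusion of the syzygy. -/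
def syzygyIncl (F : FreeComplex S X) (n : ℕ) : F.syzygy n →ₗ[S] F.degreePart n :=
  Submodule.inclusion inf_le_left

lemma syzygyIncl_injective (n : ℕ) : Function.Injective (F.syzygyIncl n) :=
  Submodule.inclusion_injective _

lemma IsResolutionBelow.toSyzygy_surjective {n m : ℕ} (h : F.IsResolutionBelow n) (hm : m < n) :
    Function.Surjective (toSyzygy h.isComplex m) := fun z => by
  obtain ⟨z', h1, h2⟩ := h.exists_degreePart hm z.2
  exact ⟨⟨z', h1⟩, Subtype.ext h2⟩

lemma toSyzygy_exact (h : F.IsComplex) (n : ℕ) :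
    Function.Exact (F.syzygyIncl (n + 1)) (toSyzygy h n) := fun z => by
  constructor
  · intro hz
    exact ⟨⟨z, z.2, congrArg Subtype.val hz, h.aug_eq_zero_of_mem z.2⟩, rfl⟩
  · rintro ⟨y, rfl⟩
    exact Subtype.ext y.2.2.1

lemma IsResolutionBelow.augZero_surjective {n : ℕ} (h : F.IsResolutionBelow n) :
    Function.Surjective F.augZero := fun x => by
  obtain ⟨z, rfl⟩ := h.surjective x
  exact ⟨⟨_, filter_mem_degreePart 0 z⟩, h.isComplex.aug_filter_deg_zero z⟩

lemma augZero_exact (h : F.IsComplex) : Function.Exact (F.syzygyIncl 0) F.augZero := fun z => by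
  constructor
  · intro hz
    exact ⟨⟨z, z.2, h.D_eq_zero z.2, hz⟩, rfl⟩
  · rintro ⟨y, rfl⟩
    exact y.2.2.2

/-- A complex that is a minimal resolution in degrees below `n`. -/
structure IsMinimalBelow [IsLocalRing S] (F : FreeComplex S X) (n : ℕ) : Prop extends
    F.IsResolutionBelow n where
  minimal : ∀ z, F.D z = 0 → F.aug z = 0 → ∀ x, z x ∈ maximalIdeal S

lemma IsMinimalStart.isMinimalBelow [IsLocalRing S] {n : ℕ} (h : F.IsMinimalStart n) :
    F.IsMinimalBelow n :=
  ⟨h.isResolutionBelow, h.minimal⟩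

lemma IsMinimalFreeResolution.isMinimalBelow [IsLocalRing S] (h : F.IsMinimalFreeResolution)
    (n : ℕ) : F.IsMinimalBelow n := by
  refine ⟨h.isFreeResolution.isResolutionBelow n, fun z h1 h2 x => ?_⟩
  obtain ⟨z', rfl⟩ := h.exact z h1 h2
  rw [D_apply]
  exact Ideal.sum_mem _ fun y _ => Ideal.mul_mem_left _ _ (h.minimal y x)

/-! ### Finiteness -/

/-- Minimal generators of a Noetherian module are finite in number. -/
lemma finite_of_ker_le {ι : Type*} {Y : Type*} [AddCommGroup Y] [Module S Y] [IsLocalRing S]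
    [IsNoetherian S Y] (f : (ι →₀ S) →ₗ[S] Y) (J : Set ι)
    (h : ∀ z ∈ Finsupp.supported S S J, f z = 0 → ∀ x, z x ∈ maximalIdeal S) : J.Finite := by
  classical
  have hfg : (Submodule.span S ((fun x => f (Finsupp.single x 1)) '' J)).FG :=
    IsNoetherian.noetherian _
  obtain ⟨t, ht, hspan⟩ := Submodule.fg_span_iff_fg_span_finset_subset _ |>.1 hfg
  obtain ⟨t', ht', hJ, himg⟩ : ∃ t' : Finset ι, ↑t' ⊆ J ∧
      (fun x => f (Finsupp.single x 1)) '' ↑t' = ↑t ∧ True := by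
    obtain ⟨t', h1, h2⟩ := Finset.subset_set_image_iff.1 ht
    exact ⟨t', h1, by rw [← h2, Finset.coe_image], trivial⟩
  refine t'.finite_toSet.subset fun x hx => ?_
  by_contra hxt
  have hmem : f (Finsupp.single x 1) ∈ Submodule.span S
      ((fun x => f (Finsupp.single x 1)) '' (t' : Set ι)) := by
    rw [hJ, ← hspan]
    exact Submodule.subset_span ⟨x, hx, rfl⟩
  rw [Finsupp.mem_span_image_iff_linearCombination] at hmem
  obtain ⟨l, hl, hle⟩ := hmem
  have hfl : Finsupp.linearCombination S (fun x => f (Finsupp.single x 1)) l = f l := by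
    rw [Finsupp.linearCombination_apply]
    conv_rhs => rw [← Finsupp.sum_single l, map_finsuppSum]
    refine Finsupp.sum_congr fun y _ => ?_
    rw [← map_smul, Finsupp.smul_single, smul_eq_mul, mul_one]
  rw [hfl] at hle
  -- The basis element `x` is not among the finitely many chosen ones, so this relation has
  -- coefficient `1` at `x`, which minimality forbids.
  have h1 := h (Finsupp.single x 1 - l) (sub_mem (Finsupp.single_mem_supported S _ hx)
    (Finsupp.supported_mono ht' hl)) (by rw [map_sub, hle, sub_self]) x
  have h2 : l x = 0 := (Finsupp.mem_supported' S l).1 hl x hxt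
  rw [Finsupp.sub_apply, Finsupp.single_eq_same, h2, sub_zero] at h1
  exact (Ideal.ne_top_iff_one _).1 (maximalIdeal.isMaximal S).ne_top h1

lemma isNoetherian_supported [IsNoetherianRing S] {ι : Type*} {J : Set ι} (hJ : J.Finite) :
    IsNoetherian S (Finsupp.supported S S J) := by
  have := hJ.to_subtype
  exact isNoetherian_of_linearEquiv (Finsupp.supportedEquivFinsupp (M := S) (R := S) J).symm

variable [IsLocalRing S] [IsNoetherianRing S]

/-- By induction the target of the differential in degree `n + 1` is a finite free module, hence
Noetherian, and minimality makes the images of the basis elements minimal generators. -/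
lemma finite_deg_eq [Module.Finite S X] (h : F.IsComplex)
    (hmin : ∀ z, F.D z = 0 → F.aug z = 0 → ∀ x, z x ∈ maximalIdeal S) (n : ℕ) :
    {x | F.deg x = n}.Finite := by
  induction n with
  | zero => exact finite_of_ker_le F.aug _ fun z hz h0 => hmin z (h.D_eq_zero hz) h0
  | succ n ih =>
    have := isNoetherian_supported (S := S) ih
    let f : (F.ι →₀ S) →ₗ[S] F.degreePart n := (Finsupp.restrictDom S S _).comp F.D
    refine finite_of_ker_le (Y := F.degreePart n) f _ fun z hz h0 =>
      hmin z ?_ (h.aug_eq_zero_of_mem hz)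
    ext y
    by_cases hy : F.deg y = n
    · have := DFunLike.congr_fun (congrArg Subtype.val h0) y
      simpa [f, Finsupp.restrictDom_apply, Finsupp.filter_apply, hy] using this
    · exact mem_degreePart.1 (h.D_mem_degreePart hz) y hy

lemma IsMinimalStart.finite [Module.Finite S X] {n : ℕ} (h : F.IsMinimalStart n) :
    Finite F.ι := by
  rw [← Set.finite_univ_iff]
  refine ((Set.finite_Iic n).biUnion fun m _ => finite_deg_eq h.isComplex h.minimal m).subset ?_
  exact fun x _ => Set.mem_biUnion (h.deg_le x) rfl

lemma IsMinimalFreeResolution.finite_deg_eq [Module.Finite S X] (h : F.IsMinimalFreeResolution)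
    (n : ℕ) : {x | F.deg x = n}.Finite :=
  FreeComplex.finite_deg_eq h.isComplex (h.isMinimalBelow 0).minimal n

end FreeComplex

end

noncomputable section

open IsLocalRing CategoryTheory

namespace FreeComplex

variable {S X : Type u} [CommRing S] [AddCommGroup X] [Module S X] {F : FreeComplex S X}

/-! ### Splicing -/

lemma sumFinsuppLEquiv_symm_eq {α β : Type*} (u : α →₀ S) (v : β →₀ S) :
    (Finsupp.sumFinsuppLEquivProdFinsupp S).symm (u, v) =
      v.mapDomain Sum.inr + u.mapDomain Sum.inl := by
  ext (x | x)
  · rw [Finsupp.sumFinsuppLEquivProdFinsupp_symm_inl, Finsupp.add_apply,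
      Finsupp.mapDomain_of_notMem_range _ _ (by simp), zero_add,
      Finsupp.mapDomain_apply Sum.inl_injective]
  · rw [Finsupp.sumFinsuppLEquivProdFinsupp_symm_inr, Finsupp.add_apply,
      Finsupp.mapDomain_apply Sum.inr_injective,
      Finsupp.mapDomain_of_notMem_range _ _ (by simp), add_zero]

section Splice

variable {n : ℕ} {L : FreeComplex S (F.syzygy n)}

/-- The module underlying a splice is a direct sum. -/
def spliceJoin (F : FreeComplex S X) (n : ℕ) (L : FreeComplex S (F.syzygy n)) :
    ((F.ι →₀ S) × (L.ι →₀ S)) ≃ₗ[S] ((F.splice n L).ι →₀ S) :=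
  (Finsupp.sumFinsuppLEquivProdFinsupp S).symm

@[simp] lemma spliceJoin_inl (p : (F.ι →₀ S) × (L.ι →₀ S)) (x : F.ι) :
    spliceJoin F n L p (Sum.inl x) = p.1 x :=
  Finsupp.sumFinsuppLEquivProdFinsupp_symm_inl ..

@[simp] lemma spliceJoin_inr (p : (F.ι →₀ S) × (L.ι →₀ S)) (x : L.ι) :
    spliceJoin F n L p (Sum.inr x) = p.2 x :=
  Finsupp.sumFinsuppLEquivProdFinsupp_symm_inr ..

lemma splice_d_inl (x : F.ι) : (F.splice n L).d (Sum.inl x) = spliceJoin F n L (F.d x, 0) := by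
  refine Eq.trans ?_ (sumFinsuppLEquiv_symm_eq _ _).symm
  rw [Finsupp.mapDomain_zero, zero_add]
  rfl

lemma splice_d_inr (x : L.ι) :
    (F.splice n L).d (Sum.inr x) = spliceJoin F n L (L.ε x, L.d x) :=
  (sumFinsuppLEquiv_symm_eq _ _).symm

lemma spliceJoin_single_inl (x : F.ι) (a : S) :
    spliceJoin F n L (Finsupp.single x a, 0) = Finsupp.single (Sum.inl x : F.ι ⊕ L.ι) a := by
  refine (sumFinsuppLEquiv_symm_eq _ _).trans ?_
  rw [Finsupp.mapDomain_zero, zero_add, Finsupp.mapDomain_single]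

lemma spliceJoin_single_inr (x : L.ι) (a : S) :
    spliceJoin F n L (0, Finsupp.single x a) = Finsupp.single (Sum.inr x : F.ι ⊕ L.ι) a := by
  refine (sumFinsuppLEquiv_symm_eq _ _).trans ?_
  rw [Finsupp.mapDomain_zero, add_zero, Finsupp.mapDomain_single]

lemma splice_D (u : F.ι →₀ S) (v : L.ι →₀ S) : (F.splice n L).D (spliceJoin F n L (u, v)) =
    spliceJoin F n L (F.D u + L.aug v, L.D v) := by
  have h1 : ∀ u, (F.splice n L).D (spliceJoin F n L (u, 0)) = spliceJoin F n L (F.D u, 0) := by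
    intro u
    induction u using Finsupp.induction_linear with
    | zero => simp only [map_zero, Prod.mk_zero_zero]
    | add f g hf hg =>
      have : ((f + g, 0) : (F.ι →₀ S) × (L.ι →₀ S)) = (f, 0) + (g, 0) := by simp
      rw [this, map_add, map_add, hf, hg, ← map_add]
      simp
    | single x a =>
      rw [spliceJoin_single_inl]
      erw [D_single]
      rw [D_single, splice_d_inl, ← map_smul]
      simp
  have h2 : ∀ v, (F.splice n L).D (spliceJoin F n L (0, v)) =
      spliceJoin F n L (L.aug v, L.D v) := by
    intro v
    induction v using Finsupp.induction_linear with
    | zero => simp only [map_zero, Submodule.coe_zero, Prod.mk_zero_zero]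
    | add f g hf hg =>
      have : ((0, f + g) : (F.ι →₀ S) × (L.ι →₀ S)) = (0, f) + (0, g) := by simp
      rw [this, map_add, map_add, hf, hg, ← map_add]
      simp
    | single x a =>
      rw [spliceJoin_single_inr]
      erw [D_single]
      rw [D_single, splice_d_inr, ← map_smul, aug_single]
      simp
  have : ((u, v) : (F.ι →₀ S) × (L.ι →₀ S)) = (u, 0) + (0, v) := by simp
  rw [this, map_add, map_add, h1, h2, ← map_add]
  simp

lemma splice_aug (u : F.ι →₀ S) (v : L.ι →₀ S) :
    (F.splice n L).aug (spliceJoin F n L (u, v)) = F.aug u := by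
  have h1 : (F.splice n L).aug (spliceJoin F n L (0, v)) = 0 := by
    rw [aug, Finsupp.linearCombination_apply]
    refine Finset.sum_eq_zero ?_
    rintro (x | x) _
    · rw [spliceJoin_inl]; exact zero_smul _ _
    · exact smul_zero _
  have : ((u, v) : (F.ι →₀ S) × (L.ι →₀ S)) = (u, 0) + (0, v) := by simp
  rw [this, map_add, map_add, h1, add_zero]
  induction u using Finsupp.induction_linear with
  | zero => simp only [map_zero, Prod.mk_zero_zero]
  | add f g hf hg =>
    have : ((f + g, 0) : (F.ι →₀ S) × (L.ι →₀ S)) = (f, 0) + (g, 0) := by simp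
    rw [this, map_add, map_add, hf (by simp), hg (by simp), map_add]
  | single x a =>
    rw [spliceJoin_single_inl]
    erw [aug_single]
    rw [aug_single]
    rfl

lemma exists_spliceJoin_eq (z : (F.splice n L).ι →₀ S) : ∃ u v, z = spliceJoin F n L (u, v) := by
  obtain ⟨⟨u, v⟩, rfl⟩ := (spliceJoin F n L).surjective z
  exact ⟨u, v, rfl⟩

lemma spliceJoin_eq_zero {u : F.ι →₀ S} {v : L.ι →₀ S} (h : spliceJoin F n L (u, v) = 0) :
    u = 0 ∧ v = 0 := by
  have := (spliceJoin F n L).injective (h.trans (map_zero _).symm)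
  exact ⟨congrArg Prod.fst this, congrArg Prod.snd this⟩

lemma splice_isComplex (hF : F.IsComplex) (hL : L.IsComplex) : (F.splice n L).IsComplex where
  deg_d := by
    rintro (x | x) (y | y) h
    · rw [splice_d_inl, spliceJoin_inl] at h
      exact hF.deg_d x y h
    · rw [splice_d_inl, spliceJoin_inr] at h
      exact absurd rfl h
    · rw [splice_d_inr, spliceJoin_inl] at h
      change L.deg x + n + 1 = F.deg y + 1
      have h1 : F.deg y = n := by
        by_contra hy
        exact h (mem_degreePart.1 (mem_syzygy.1 (L.ε x).2).1 y hy)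
      have h2 : L.deg x = 0 := by
        by_contra hx
        exact h (by rw [hL.aug_eq_zero x hx]; rfl)
      omega
    · rw [splice_d_inr, spliceJoin_inr] at h
      have := hL.deg_d x y h
      change L.deg x + n + 1 = L.deg y + n + 1 + 1
      omega
  aug_eq_zero := by
    rintro (x | x) h
    · exact hF.aug_eq_zero x h
    · rfl
  D_D z := by
    obtain ⟨u, v, rfl⟩ := exists_spliceJoin_eq z
    have h1 : F.D (L.aug v : F.ι →₀ S) = 0 := (mem_syzygy.1 (L.aug v).2).2.1
    rw [splice_D, splice_D, map_add, hF.D_D, hL.D_D, hL.aug_D, h1]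
    simp
  aug_D z := by
    obtain ⟨u, v, rfl⟩ := exists_spliceJoin_eq z
    have h1 : F.aug (L.aug v : F.ι →₀ S) = 0 := (mem_syzygy.1 (L.aug v).2).2.2
    rw [splice_D, splice_aug, map_add, hF.aug_D, h1, add_zero]

lemma splice_aug_surjective (hF : Function.Surjective F.aug) :
    Function.Surjective (F.splice n L).aug := fun x => by
  obtain ⟨u, rfl⟩ := hF x
  exact ⟨_, splice_aug u 0⟩

/-- No cancellation is possible between `F.D u`, which lives in degrees below `n`, and the
augmentation of `v`, which lives in degree `n`. -/
lemma of_splice_D_eq_zero (hF : F.IsComplex) (hdeg : ∀ x, F.deg x ≤ n) {u : F.ι →₀ S}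
    {v : L.ι →₀ S} (h : (F.splice n L).D (spliceJoin F n L (u, v)) = 0) :
    F.D u = 0 ∧ L.D v = 0 ∧ L.aug v = 0 := by
  rw [splice_D] at h
  obtain ⟨h1, h2⟩ := spliceJoin_eq_zero h
  have h3 : F.D u = 0 := by
    ext y
    by_cases hy : F.deg y = n
    · exact hF.D_apply_eq_zero fun x hx => absurd (hdeg x) (by omega)
    · have := DFunLike.congr_fun h1 y
      rwa [Finsupp.add_apply, mem_degreePart.1 (mem_syzygy.1 (L.aug v).2).1 y hy, add_zero] at this
  rw [h3, zero_add] at h1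
  exact ⟨h3, h2, Subtype.ext h1⟩

/-- A cycle `u` splits into its part of degree `n`, a syzygy and so hit by `L.aug`, and its lower
part, a boundary by exactness of `F` below `n`. The degree `0` part of `v` is discarded: it does not
affect `L.D v`, and it would disturb the augmentation. -/
lemma exists_splice_D_eq (hF : F.IsResolutionBelow n) (hdeg : ∀ x, F.deg x ≤ n)
    (hL : L.IsComplex) (hL' : Function.Surjective L.aug) {u : F.ι →₀ S} (h1 : F.D u = 0)
    (h2 : F.aug u = 0) (v : L.ι →₀ S) :
    ∃ z, (F.splice n L).D z = spliceJoin F n L (u, L.D v) := by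
  have hu := Finsupp.filter_add_filter_not u (fun x => F.deg x = n)
  have hs : u.filter (fun x => F.deg x = n) ∈ F.syzygy n := by
    refine ⟨filter_mem_degreePart n u, ?_, ?_⟩
    · rcases n with _ | n
      · exact hF.isComplex.D_eq_zero (filter_mem_degreePart 0 u)
      · change F.D _ = 0
        rw [hF.isComplex.D_filter_deg, h1, Finsupp.filter_zero]
    · rcases n with _ | n
      · exact (hF.isComplex.aug_filter_deg_zero u).trans h2
      · exact hF.isComplex.aug_eq_zero_of_mem (filter_mem_degreePart (n + 1) u)
  obtain ⟨u', hu'⟩ := hF.exact (u.filter fun x => ¬ F.deg x = n) (fun x hx => by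
      have h3 : ¬ F.deg x = n := fun h => hx (Finsupp.filter_apply_neg _ _ (not_not.2 h))
      have := hdeg x
      omega)
    (by rw [← hu, map_add, (mem_syzygy.1 hs).2.1, zero_add] at h1; exact h1)
    (by rw [← hu, map_add, (mem_syzygy.1 hs).2.2, zero_add] at h2; exact h2)
  obtain ⟨w, hw⟩ := hL' ⟨_, hs⟩
  have hv := Finsupp.filter_add_filter_not v (fun x => L.deg x = 0)
  refine ⟨spliceJoin F n L (u',
    w.filter (fun x => L.deg x = 0) + v.filter (fun x => ¬ L.deg x = 0)), ?_⟩
  have e1 : L.aug (v.filter fun x => ¬ L.deg x = 0) = 0 :=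
    aug_eq_zero_of_deg hL fun x hx => Finsupp.filter_apply_neg _ _ (not_not.2 hx)
  have e2 : L.D (v.filter fun x => ¬ L.deg x = 0) = L.D v := by
    conv_rhs => rw [← hv, map_add, hL.D_eq_zero (filter_mem_degreePart 0 v), zero_add]
  rw [splice_D, map_add, map_add, hL.aug_filter_deg_zero, hw,
    hL.D_eq_zero (filter_mem_degreePart 0 w), e1, e2, hu', add_zero, zero_add,
    add_comm (Finsupp.filter _ u), hu]

lemma IsFreeResolution.splice (hF : F.IsResolutionBelow n) (hdeg : ∀ x, F.deg x ≤ n)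
    (hL : L.IsFreeResolution) : (F.splice n L).IsFreeResolution where
  isComplex := splice_isComplex hF.isComplex hL.isComplex
  surjective := splice_aug_surjective hF.surjective
  exact z h1 h2 := by
    obtain ⟨u, v, rfl⟩ := exists_spliceJoin_eq z
    obtain ⟨h3, h4, h5⟩ := of_splice_D_eq_zero hF.isComplex hdeg h1
    obtain ⟨v', rfl⟩ := hL.exact v h4 h5
    rw [splice_aug] at h2
    exact exists_splice_D_eq hF hdeg hL.isComplex hL.surjective h3 h2 v'

variable [IsLocalRing S]

lemma IsMinimalBelow.d_mem (hF : F.IsMinimalBelow n) (x y : F.ι) :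
    F.d x y ∈ maximalIdeal S := by
  have h := hF.minimal (F.D (Finsupp.single x 1)) (hF.isComplex.D_D _) (hF.isComplex.aug_D _) y
  rwa [D_single, one_smul] at h

lemma IsMinimalFreeResolution.splice (hF : F.IsMinimalStart n) (hL : L.IsMinimalFreeResolution) :
    (F.splice n L).IsMinimalFreeResolution := by
  have h := IsFreeResolution.splice hF.isResolutionBelow hF.deg_le hL.isFreeResolution
  refine ⟨h.isComplex, h.surjective, h.exact, ?_⟩
  rintro (x | x) (y | y)
  · rw [splice_d_inl, spliceJoin_inl]
    exact hF.isMinimalBelow.d_mem x y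
  · rw [splice_d_inl, spliceJoin_inr]
    exact zero_mem _
  · rw [splice_d_inr, spliceJoin_inl]
    exact hF.minimal _ (L.ε x).2.2.1 (L.ε x).2.2.2 y
  · rw [splice_d_inr, spliceJoin_inr]
    exact hL.minimal x y

lemma IsMinimalStart.splice (hF : F.IsMinimalStart n) (hL : L.IsMinimalStart 0) :
    (F.splice n L).IsMinimalStart (n + 1) where
  isComplex := splice_isComplex hF.isComplex hL.isComplex
  deg_le := by
    rintro (x | x)
    · exact (hF.deg_le x).trans n.le_succ
    · have := hL.deg_le x
      change L.deg x + n + 1 ≤ n + 1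
      omega
  surjective := splice_aug_surjective hF.surjective
  exact z h1 h2 h3 := by
    obtain ⟨u, v, rfl⟩ := exists_spliceJoin_eq z
    obtain ⟨h4, h5, h6⟩ := of_splice_D_eq_zero hF.isComplex hF.deg_le h2
    rw [splice_aug] at h3
    have hv : v = 0 := by
      ext y
      by_contra hy
      have := h1 (Sum.inr y) (by rwa [spliceJoin_inr])
      change L.deg y + n + 1 < n + 1 at this
      omega
    have := exists_splice_D_eq hF.isResolutionBelow hF.deg_le hL.isComplex hL.surjective h4 h3 0
    rwa [map_zero, ← hv] at this
  minimal z h1 h2 := by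
    obtain ⟨u, v, rfl⟩ := exists_spliceJoin_eq z
    obtain ⟨h4, h5, h6⟩ := of_splice_D_eq_zero hF.isComplex hF.deg_le h1
    rw [splice_aug] at h2
    rintro (x | y)
    · rw [spliceJoin_inl]
      exact hF.minimal u h4 h2 x
    · rw [spliceJoin_inr]
      exact hL.minimal v h5 h6 y

end Splice

/-! ### Existence -/

/-- The complex given by a family of generators. -/
def ofGenerators {Y : Type u} [AddCommGroup Y] [Module S Y] {ι : Type} (f : ι → Y) :
    FreeComplex S Y where
  ι := ι
  deg _ := 0
  d _ := 0
  ε := f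

lemma ofGenerators_isMinimalStart [IsLocalRing S] {Y : Type u} [AddCommGroup Y] [Module S Y]
    {ι : Type} (f : ι → Y) (hf : Function.Surjective (Finsupp.linearCombination S f))
    (hmin : ∀ z, Finsupp.linearCombination S f z = 0 → ∀ x, z x ∈ maximalIdeal S) :
    (ofGenerators (S := S) f).IsMinimalStart 0 := by
  have hD : ∀ z, (ofGenerators (S := S) f).D z = 0 := fun z => by
    rw [D, Finsupp.linearCombination_apply]
    exact Finset.sum_eq_zero fun x _ => smul_zero (M := S) (A := ι →₀ S) (z x)
  refine ⟨⟨fun x y h => absurd rfl h, fun x h => absurd rfl h, fun z => hD _,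
    fun z => by rw [hD, map_zero]⟩, fun _ => le_rfl, hf, fun z h _ _ => ⟨0, ?_⟩,
    fun z _ h => hmin z h⟩
  rw [map_zero]
  ext x
  by_contra hx
  exact absurd (h x (Ne.symm hx)) (by simp)

/-- Take a generating family of least cardinality: a relation with a unit coefficient would express
one generator by the others. -/
lemma exists_isMinimalStart_zero [IsLocalRing S] (Y : Type u) [AddCommGroup Y] [Module S Y]
    [Module.Finite S Y] : ∃ L : FreeComplex S Y, L.IsMinimalStart 0 := by
  classical
  have hex : ∃ n, ∃ f : Fin n → Y, Submodule.span S (Set.range f) = ⊤ :=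
    Module.Finite.exists_fin
  obtain ⟨f, hf⟩ := Nat.find_spec hex
  have hmin := fun m (hm : m < Nat.find hex) => Nat.find_min hex hm
  generalize Nat.find hex = n at f hmin
  refine ⟨_, ofGenerators_isMinimalStart (S := S) f ?_ ?_⟩
  · rw [← LinearMap.range_eq_top, Finsupp.range_linearCombination, hf]
  · intro z hz x
    by_contra hx
    rw [mem_maximalIdeal, mem_nonunits_iff, not_not] at hx
    obtain ⟨b, hb⟩ := hx.exists_left_inv
    rcases n with _ | n
    · exact x.elim0
    refine hmin n n.lt_succ_self ⟨fun i => f (x.succAbove i), ?_⟩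
    rw [eq_top_iff, ← hf, Submodule.span_le]
    rintro _ ⟨i, rfl⟩
    rcases eq_or_ne i x with rfl | hix
    · rw [Finsupp.linearCombination_apply, Finsupp.sum_fintype _ _ (by simp),
        Fin.sum_univ_succAbove _ i] at hz
      have h1 : f i = -(b • ∑ j, z (i.succAbove j) • f (i.succAbove j)) := by
        rw [← neg_eq_of_add_eq_zero_right hz, smul_neg, neg_neg, smul_smul, hb, one_smul]
      rw [h1]
      exact neg_mem (Submodule.smul_mem _ _ (Submodule.sum_mem _ fun j _ =>
        Submodule.smul_mem _ _ (Submodule.subset_span ⟨j, rfl⟩)))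
    · obtain ⟨j, rfl⟩ := Fin.exists_succAbove_eq hix
      exact Submodule.subset_span ⟨j, rfl⟩

section

variable [IsLocalRing S] [IsNoetherianRing S] [Module.Finite S X]

lemma IsMinimalStart.finite_syzygy {n : ℕ} (hF : F.IsMinimalStart n) :
    Module.Finite S (F.syzygy n) := by
  have := hF.finite
  infer_instance

lemma stepwiseResolvable : StepwiseResolvable S X :=
  ⟨exists_isMinimalStart_zero X, fun n F hF => ⟨hF.finite, by
    have := hF.finite_syzygy
    exact exists_isMinimalStart_zero _, fun L hL => hF.splice hL⟩⟩

lemma exists_isMinimalStart (n : ℕ) : ∃ F : FreeComplex S X, F.IsMinimalStart n := by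
  induction n with
  | zero => exact exists_isMinimalStart_zero X
  | succ n ih =>
    obtain ⟨F, hF⟩ := ih
    have := hF.finite_syzygy
    obtain ⟨L, hL⟩ := exists_isMinimalStart_zero (S := S) (F.syzygy n)
    exact ⟨_, hF.splice hL⟩

end

/-! ### Projective dimension -/

/-- The projector onto the kernel furnished by a splitting carries `𝔪P` into `𝔪` times the kernel,
so the kernel equals `𝔪` times itself and Nakayama applies. -/
lemma ker_eq_bot_of_projective [IsLocalRing S] {P Y : Type*} [AddCommGroup P] [Module S P]
    [AddCommGroup Y] [Module S Y] [Module.Projective S Y] (f : P →ₗ[S] Y)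
    (hf : Function.Surjective f) (hfg : (LinearMap.ker f).FG)
    (hle : LinearMap.ker f ≤ maximalIdeal S • ⊤) : LinearMap.ker f = ⊥ := by
  obtain ⟨s, hs⟩ := Module.projective_lifting_property f LinearMap.id hf
  refine Submodule.eq_bot_of_le_smul_of_le_jacobson_bot (maximalIdeal S) _ hfg ?_
    (IsLocalRing.maximalIdeal_le_jacobson _)
  intro x hx
  have h1 := Submodule.mem_map_of_mem (f := LinearMap.id - s.comp f) (hle hx)
  rw [Submodule.map_smul''] at h1
  have h2 : (LinearMap.id - s.comp f : P →ₗ[S] P) x = x := by simp [LinearMap.mem_ker.1 hx]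
  rw [h2] at h1
  refine Submodule.smul_mono le_rfl ?_ h1
  rintro _ ⟨y, -, rfl⟩
  have h3 := LinearMap.congr_fun hs (f y)
  simp only [LinearMap.comp_apply, LinearMap.id_apply] at h3
  simp [h3]

lemma hasProjectiveDimensionLT_of_exact {N P Z : Type u} [AddCommGroup N] [Module S N]
    [AddCommGroup P] [Module S P] [AddCommGroup Z] [Module S Z] [Module.Projective S P]
    {f : N →ₗ[S] P} {g : P →ₗ[S] Z} (hf : Function.Injective f) (hg : Function.Surjective g)
    (h : Function.Exact f g) {n : ℕ} (hZ : HasProjectiveDimensionLT (ModuleCat.of S Z) (n + 2)) :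
    HasProjectiveDimensionLT (ModuleCat.of S N) (n + 1) := by
  let C : ShortComplex (ModuleCat.{u} S) := ⟨ModuleCat.ofHom f, ModuleCat.ofHom g, by
    ext x; exact h.apply_apply_eq_zero x⟩
  have hC : C.ShortExact :=
    { exact := (ShortComplex.ShortExact.moduleCat_exact_iff_function_exact C).2 h
      mono_f := (ModuleCat.mono_iff_injective _).2 hf
      epi_g := (ModuleCat.epi_iff_surjective _).2 hg }
  exact (hC.hasProjectiveDimensionLT_X₃_iff n
    ((IsProjective.iff_projective (R := S) P).1 inferInstance)).1 hZ

instance free_degreePart (n : ℕ) : Module.Free S (F.degreePart n) :=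
  Module.Free.of_equiv (Finsupp.supportedEquivFinsupp (M := S) (R := S) {x | F.deg x = n}).symm

lemma hasProjectiveDimensionLT_syzygy_zero {n m : ℕ} (hF : F.IsResolutionBelow n)
    (hX : HasProjectiveDimensionLT (ModuleCat.of S X) (m + 2)) :
    HasProjectiveDimensionLT (ModuleCat.of S (F.syzygy 0)) (m + 1) :=

  hasProjectiveDimensionLT_of_exact (N := F.syzygy 0) (P := F.degreePart 0) (Z := X)
    (f := F.syzygyIncl 0) (g := F.augZero) (syzygyIncl_injective 0)
    hF.augZero_surjective (augZero_exact hF.isComplex) hX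

lemma hasProjectiveDimensionLT_syzygy_succ {n m j : ℕ} (hF : F.IsResolutionBelow n) (hj : j < n)
    (hX : HasProjectiveDimensionLT (ModuleCat.of S (F.syzygy j)) (m + 2)) :
    HasProjectiveDimensionLT (ModuleCat.of S (F.syzygy (j + 1))) (m + 1) :=
  hasProjectiveDimensionLT_of_exact (N := F.syzygy (j + 1)) (P := F.degreePart (j + 1))
    (Z := F.syzygy j) (f := F.syzygyIncl (j + 1)) (g := toSyzygy hF.isComplex j)
    (syzygyIncl_injective (j + 1))
    (hF.toSyzygy_surjective hj) (toSyzygy_exact hF.isComplex j) hX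

lemma hasProjectiveDimensionLT_syzygy {n : ℕ} (hF : F.IsResolutionBelow n) (m j : ℕ)
    (hj : j < n) (hX : HasProjectiveDimensionLT (ModuleCat.of S X) (m + j + 2)) :
    HasProjectiveDimensionLT (ModuleCat.of S (F.syzygy j)) (m + 1) := by
  induction j generalizing m with
  | zero => exact hasProjectiveDimensionLT_syzygy_zero hF hX
  | succ j ih =>
    refine hasProjectiveDimensionLT_syzygy_succ hF (by omega) (ih (m + 1) (by omega) ?_)
    rwa [show m + 1 + j + 2 = m + (j + 1) + 2 by omega]

lemma mem_smul_top_of_forall_mem {n : ℕ} (I : Ideal S) (z : F.degreePart n)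
    (hz : ∀ x, (z : F.ι →₀ S) x ∈ I) : z ∈ I • (⊤ : Submodule S (F.degreePart n)) := by
  have h1 : z = ∑ x ∈ (z : F.ι →₀ S).support.attach, (z : F.ι →₀ S) x •
      (⟨Finsupp.single x 1, Finsupp.single_mem_supported S _ (z.2 x.2)⟩ : F.degreePart n) := by
    apply Subtype.ext
    rw [AddSubmonoidClass.coe_finsetSum]
    simp only [Submodule.coe_smul, Finsupp.smul_single, smul_eq_mul, mul_one]
    conv_lhs => rw [← Finsupp.sum_single (z : F.ι →₀ S)]
    exact (Finset.sum_attach _ fun x => Finsupp.single x ((z : F.ι →₀ S) x)).symm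
  rw [h1]
  exact Submodule.sum_mem _ fun x _ => Submodule.smul_mem_smul (hz x) trivial

section

variable [IsLocalRing S] [IsNoetherianRing S] [Module.Finite S X]

/-- Here `Y` is the previous syzygy, or the module itself when `n = 0`. Once it is projective, the
cover `F_n → Y` splits, and minimality leaves no kernel. -/
lemma syzygy_eq_bot_of_exact {n : ℕ} (hF : F.IsMinimalBelow n) {Y : Type u} [AddCommGroup Y]
    [Module S Y] (hY : HasProjectiveDimensionLT (ModuleCat.of S Y) 1)
    (f : F.degreePart n →ₗ[S] Y) (hf : Function.Surjective f)
    (hex : Function.Exact (F.syzygyIncl n) f) : F.syzygy n = ⊥ := by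
  have hnoeth : IsNoetherian S (F.degreePart n) := isNoetherian_supported (S := S)
    (finite_deg_eq hF.isComplex hF.minimal n)
  have : Module.Projective S Y := (IsProjective.iff_projective Y).2
    (projective_iff_hasProjectiveDimensionLT_one.2 hY)
  have hle : LinearMap.ker f ≤ maximalIdeal S • (⊤ : Submodule S (F.degreePart n)) := by
    intro z hz
    obtain ⟨y, rfl⟩ := (hex z).1 (LinearMap.mem_ker.1 hz)
    exact mem_smul_top_of_forall_mem _ _ (hF.minimal _ y.2.2.1 y.2.2.2)
  have h1 : LinearMap.ker f = ⊥ := ker_eq_bot_of_projective (P := F.degreePart n) (Y := Y) f hf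
    (IsNoetherian.noetherian _) hle
  rw [Submodule.eq_bot_iff]
  intro z hz
  have h2 : F.syzygyIncl n ⟨z, hz⟩ ∈ LinearMap.ker f :=
    LinearMap.mem_ker.2 ((hex _).2 ⟨_, rfl⟩)
  rw [h1, Submodule.mem_bot] at h2
  exact congrArg Subtype.val h2

/-- The `n`-th kernel in a minimal resolution of a module of projective dimension at most `n`
vanishes. -/
lemma syzygy_eq_bot {n : ℕ} (hF : F.IsMinimalBelow n)
    (hX : HasProjectiveDimensionLT (ModuleCat.of S X) (n + 1)) : F.syzygy n = ⊥ := by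
  rcases n with _ | n
  · exact syzygy_eq_bot_of_exact hF hX F.augZero hF.augZero_surjective
      (augZero_exact hF.isComplex)
  · have h := hasProjectiveDimensionLT_syzygy hF.toIsResolutionBelow 0 n n.lt_succ_self
      (by rwa [zero_add])
    exact syzygy_eq_bot_of_exact hF h (toSyzygy hF.isComplex n)
      (hF.toSyzygy_surjective n.lt_succ_self) (toSyzygy_exact hF.isComplex n)

lemma IsMinimalStart.isMinimalFreeResolution {n : ℕ} (hF : F.IsMinimalStart n)
    (hX : HasProjectiveDimensionLE (ModuleCat.of S X) n) : F.IsMinimalFreeResolution := by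
  have hbot := syzygy_eq_bot hF.isMinimalBelow hX
  refine ⟨hF.isComplex, hF.surjective, fun z h1 h2 => ?_, hF.isMinimalBelow.d_mem⟩
  -- The last syzygy is zero, so the empty complex resolves it and the splicing lemma also yields
  -- exactness at the top degree.
  let L : FreeComplex S (F.syzygy n) := ofGenerators (ι := Empty) Empty.elim
  have hL : L.IsMinimalStart 0 := ofGenerators_isMinimalStart _ (fun y => ⟨0, by
    exact Subtype.ext ((Submodule.mem_bot S).1 (hbot.le y.2)).symm⟩) (fun z _ x => x.elim)
  obtain ⟨z', hz'⟩ := exists_splice_D_eq hF.isResolutionBelow hF.deg_le hL.isComplex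
    hL.surjective h1 h2 0
  obtain ⟨u, v, rfl⟩ := exists_spliceJoin_eq z'
  refine ⟨u, ?_⟩
  rw [splice_D, map_zero] at hz'
  have h3 : (L.aug v : F.ι →₀ S) = 0 := (Submodule.mem_bot S).1 (hbot.le (L.aug v).2)
  rw [h3, add_zero] at hz'
  exact congrArg Prod.fst ((spliceJoin F n L).injective hz')

/-- A basis element in degree `n + 1` would be a cycle because its differential lies in the
vanishing syzygy; in higher degrees it would be a cycle because there is nothing one degree lower. A
cycle cannot have coefficient `1`. -/
lemma IsMinimalBelow.deg_le {n : ℕ} (hF : F.IsMinimalBelow n)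
    (hX : HasProjectiveDimensionLE (ModuleCat.of S X) n) (x : F.ι) : F.deg x ≤ n := by
  have hbot := syzygy_eq_bot hF hX
  have key : ∀ k x, F.deg x ≠ n + k + 1 := by
    intro k
    induction k with
    | zero =>
      intro x hx
      have h1 := hF.isComplex.D_mem_syzygy (n := n) (Finsupp.single_mem_supported S (1 : S)
        (show x ∈ {x | F.deg x = n + 1} from hx))
      rw [hbot, Submodule.mem_bot] at h1
      have h2 := hF.minimal _ h1 (by rw [aug_single, hF.isComplex.aug_eq_zero x (by omega),
        smul_zero]) x
      rw [Finsupp.single_eq_same] at h2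
      exact (Ideal.ne_top_iff_one _).1 (maximalIdeal.isMaximal S).ne_top h2
    | succ k ih =>
      intro x hx
      have h1 : F.D (Finsupp.single x 1) = 0 := by
        ext y
        by_contra hy
        rw [D_single, one_smul] at hy
        have := hF.isComplex.deg_d x y hy
        exact ih y (by omega)
      have h2 := hF.minimal _ h1 (by rw [aug_single, hF.isComplex.aug_eq_zero x (by omega),
        smul_zero]) x
      rw [Finsupp.single_eq_same] at h2
      exact (Ideal.ne_top_iff_one _).1 (maximalIdeal.isMaximal S).ne_top h2
  by_contra hlt
  exact key (F.deg x - n - 1) x (by omega)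

end

end FreeComplex

end

noncomputable section

open IsLocalRing

/-! ### Formal calculus of words and of coderivations of the tensor coalgebra. -/

namespace FreeComplex

/-! ### Sums over the decompositions of a word -/

section Words

variable {P Y Z : Type*} [AddCommGroup Y] [AddCommGroup Z]

/-- The sum of `φ v z` over all decompositions `w = v ++ z`. -/
def splitSum {P Y : Type*} [AddCommGroup Y] : (List P → List P → Y) → List P → Y
  | φ, [] => φ [] []
  | φ, x :: w => φ [] (x :: w) + splitSum (fun v z => φ (x :: v) z) w

@[simp] lemma splitSum_nil (φ : List P → List P → Y) : splitSum φ [] = φ [] [] := rfl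

lemma splitSum_cons (φ : List P → List P → Y) (x : P) (w : List P) :
    splitSum φ (x :: w) = φ [] (x :: w) + splitSum (fun v z => φ (x :: v) z) w := rfl

lemma splitSum_congr {φ ψ : List P → List P → Y} {w : List P}
    (h : ∀ v z, v ++ z = w → φ v z = ψ v z) : splitSum φ w = splitSum ψ w := by
  induction w generalizing φ ψ with
  | nil => exact h [] [] rfl
  | cons x w ih =>
    rw [splitSum_cons, splitSum_cons, h [] _ rfl, ih fun v z hvz => h (x :: v) z (by simp [hvz])]

lemma splitSum_add (φ ψ : List P → List P → Y) (w : List P) :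
    splitSum (fun v z => φ v z + ψ v z) w = splitSum φ w + splitSum ψ w := by
  induction w generalizing φ ψ with
  | nil => rfl
  | cons x w ih => rw [splitSum_cons, splitSum_cons, splitSum_cons, ih]; abel

lemma map_splitSum (f : Y →+ Z) (φ : List P → List P → Y) (w : List P) :
    splitSum (fun v z => f (φ v z)) w = f (splitSum φ w) := by
  induction w generalizing φ with
  | nil => rfl
  | cons x w ih => rw [splitSum_cons, splitSum_cons, ih, map_add]

lemma splitSum_eq_zero {φ : List P → List P → Y} {w : List P}
    (h : ∀ v z, v ++ z = w → φ v z = 0) : splitSum φ w = 0 := by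
  have := map_splitSum (0 : Y →+ Y) φ w
  rw [splitSum_congr (ψ := fun v z => (0 : Y →+ Y) (φ v z)) fun v z hvz => h v z hvz, this]
  rfl

lemma zsmul_splitSum (k : ℤ) (φ : List P → List P → Y) (w : List P) :
    k • splitSum φ w = splitSum (fun v z => k • φ v z) w :=
  (map_splitSum (zsmulAddGroupHom k) φ w).symm

lemma splitSum_eq_left {φ : List P → List P → Y} {w : List P}
    (h : ∀ v z, v ++ z = w → v ≠ [] → φ v z = 0) : splitSum φ w = φ [] w := by
  cases w with
  | nil => rfl
  | cons x w =>
    rw [splitSum_cons, splitSum_eq_zero, add_zero]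
    exact fun v z hvz => h (x :: v) z (by simp [hvz]) (List.cons_ne_nil _ _)

/-- Coassociativity of deconcatenation. -/
lemma splitSum_assoc (φ : List P → List P → List P → Y) (w : List P) :
    splitSum (fun v z => splitSum (fun v' z' => φ v' z' z) v) w =
      splitSum (fun v z => splitSum (φ v) z) w := by
  induction w generalizing φ with
  | nil => rfl
  | cons x w ih =>
    simp only [splitSum_cons, splitSum_nil]
    rw [splitSum_add, ih (fun v z => φ (x :: v) z)]
    abel

lemma sum_range_eq_splitSum (φ : List P → List P → Y) (w : List P) :
    ∑ j ∈ Finset.range (w.length + 1), φ (w.take j) (w.drop j) = splitSum φ w := by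
  induction w generalizing φ with
  | nil => simp
  | cons x w ih =>
    rw [splitSum_cons, ← ih, Finset.sum_range_succ', add_comm]
    rfl

/-- The sum of `φ u v z` over all decompositions `w = u ++ v ++ z` with `v` nonempty. -/
def subwordSum {P Y : Type*} [AddCommGroup Y] : (List P → List P → List P → Y) → List P → Y
  | _, [] => 0
  | φ, x :: w => splitSum (fun v z => φ [] (x :: v) z) w +
      subwordSum (fun u v z => φ (x :: u) v z) w

/-- Trades the index sums of the definitions for a recursion on the first letter, so that later
identities can be proved by induction on words. -/
lemma sum_sum_eq_subwordSum (φ : List P → List P → List P → Y) (w : List P) :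
    ∑ i ∈ Finset.Icc 1 w.length, ∑ j ∈ Finset.range (w.length - i + 1),
      φ (w.take j) ((w.drop j).take i) (w.drop (j + i)) = subwordSum φ w := by
  induction w generalizing φ with
  | nil => simp [subwordSum]
  | cons x w ih =>
    rw [subwordSum, ← ih, ← sum_range_eq_splitSum]
    simp only [List.length_cons]
    have h1 : ∀ i ∈ Finset.Icc 1 (w.length + 1), ∑ j ∈ Finset.range (w.length + 1 - i + 1),
        φ ((x :: w).take j) (((x :: w).drop j).take i) ((x :: w).drop (j + i)) =
        φ [] ((x :: w).take i) ((x :: w).drop i) + ∑ j ∈ Finset.range (w.length + 1 - i),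
          φ (x :: w.take j) ((w.drop j).take i) (w.drop (j + i)) := by
      intro i _
      rw [Finset.sum_range_succ', add_comm]
      congr 1
      · simp
      · refine Finset.sum_congr rfl fun j _ => ?_
        rw [show j + 1 + i = j + i + 1 by omega]
        rfl
    rw [Finset.sum_congr rfl h1, Finset.sum_add_distrib]
    congr 1
    · have h2 : Finset.Icc 1 (w.length + 1) =
          (Finset.range (w.length + 1)).image fun i => i + 1 := by
        ext i
        simp only [Finset.mem_Icc, Finset.mem_image, Finset.mem_range]
        exact ⟨fun h => ⟨i - 1, by omega, by omega⟩, by rintro ⟨j, hj, rfl⟩; omega⟩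
      rw [h2, Finset.sum_image (by intro a _ b _ h; simpa using h)]
      rfl
    · rw [Finset.sum_Icc_succ_top (by omega), Nat.sub_self, Finset.range_zero, Finset.sum_empty,
        add_zero]
      refine Finset.sum_congr rfl fun i hi => ?_
      rw [Nat.succ_sub (Finset.mem_Icc.1 hi).2]

end Words

/-! ### Linear combinations -/

section Pair

variable {Q B Y Z : Type*} [CommRing Q] [AddCommGroup Y] [Module Q Y] [AddCommGroup Z] [Module Q Z]

/-- The value at `ℓ` of the linear map given by `g` on the basis. -/
def pair (ℓ : B →₀ Q) (g : B → Y) : Y := Finsupp.linearCombination Q g ℓ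

lemma pair_def (ℓ : B →₀ Q) (g : B → Y) : pair ℓ g = ℓ.sum fun b q => q • g b := rfl

@[simp] lemma pair_zero_left (g : B → Y) : pair (0 : B →₀ Q) g = 0 := map_zero _

@[simp] lemma pair_zero_right (ℓ : B →₀ Q) : pair ℓ (fun _ => (0 : Y)) = 0 := by
  simp [pair_def]

lemma pair_add_left (ℓ ℓ' : B →₀ Q) (g : B → Y) : pair (ℓ + ℓ') g = pair ℓ g + pair ℓ' g :=
  map_add _ _ _

lemma pair_sub_left (ℓ ℓ' : B →₀ Q) (g : B → Y) : pair (ℓ - ℓ') g = pair ℓ g - pair ℓ' g :=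
  map_sub _ _ _

lemma pair_neg_left (ℓ : B →₀ Q) (g : B → Y) : pair (-ℓ) g = -pair ℓ g :=
  map_neg _ _

lemma pair_smul_left (q : Q) (ℓ : B →₀ Q) (g : B → Y) : pair (q • ℓ) g = q • pair ℓ g :=
  map_smul _ _ _

@[simp] lemma pair_single (b : B) (q : Q) (g : B → Y) : pair (Finsupp.single b q) g = q • g b :=
  Finsupp.linearCombination_single ..

lemma map_pair (f : Y →ₗ[Q] Z) (ℓ : B →₀ Q) (g : B → Y) :
    pair ℓ (fun b => f (g b)) = f (pair ℓ g) := by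
  simp [pair_def, map_finsuppSum]

lemma pair_pair {B' : Type*} (ℓ : B →₀ Q) (g : B → B' →₀ Q) (h : B' → Y) :
    pair ℓ (fun b => pair (g b) h) = pair (pair ℓ g) h :=
  map_pair (Finsupp.linearCombination Q h) ℓ g

lemma pair_add_right (ℓ : B →₀ Q) (g h : B → Y) :
    pair ℓ (fun b => g b + h b) = pair ℓ g + pair ℓ h := by
  simp [pair_def, Finsupp.sum_add]

lemma pair_zsmul_right (k : ℤ) (ℓ : B →₀ Q) (g : B → Y) :
    pair ℓ (fun b => k • g b) = k • pair ℓ g := by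
  simp only [pair_def, Finsupp.smul_sum]
  exact Finsupp.sum_congr fun b _ => smul_comm _ _ _

lemma pair_congr {ℓ : B →₀ Q} {g h : B → Y} (H : ∀ b, ℓ b ≠ 0 → g b = h b) :
    pair ℓ g = pair ℓ h :=
  Finsupp.sum_congr fun b hb => congrArg (ℓ b • ·) (H b (Finsupp.mem_support_iff.1 hb))

lemma pair_eq_zero {ℓ : B →₀ Q} {g : B → Y} (H : ∀ b, ℓ b ≠ 0 → g b = 0) : pair ℓ g = 0 :=
  (pair_congr H).trans (pair_zero_right _)

lemma pair_pair_comm {B' : Type*} (ℓ : B →₀ Q) (ℓ' : B' →₀ Q) (g : B → B' → Y) :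
    pair ℓ (fun b => pair ℓ' (g b)) = pair ℓ' (fun c => pair ℓ fun b => g b c) := by
  simp only [pair_def, Finsupp.smul_sum]
  rw [Finsupp.sum_comm]
  simp only [smul_smul, mul_comm]

lemma pair_splitSum {P : Type*} (ℓ : B →₀ Q) (φ : B → List P → List P → Y) (w : List P) :
    pair ℓ (fun b => splitSum (φ b) w) = splitSum (fun v z => pair ℓ fun b => φ b v z) w := by
  induction w generalizing φ with
  | nil => rfl
  | cons x w ih =>
    simp only [splitSum_cons]
    rw [pair_add_right, ih fun b v z => φ b (x :: v) z]

end Pair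

section Coder

variable {Q R : Type u} [CommRing Q] [CommRing R] [Algebra Q R] {A : FreeComplex Q R}
  {Y Z : Type*} [AddCommGroup Y] [Module Q Y] [AddCommGroup Z] [Module Q Z]

@[simp] lemma wordDeg_nil : A.wordDeg [] = 0 := rfl

@[simp] lemma wordDeg_cons (x : A.Pos) (w : List A.Pos) :
    A.wordDeg (x :: w) = A.deg x + 1 + A.wordDeg w := by simp [wordDeg]

@[simp] lemma wordDeg_append (v w : List A.Pos) :
    A.wordDeg (v ++ w) = A.wordDeg v + A.wordDeg w := by simp [wordDeg]

/-- Source of all finiteness: letters have degree at least `1`, hence at least `2` after the shift.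
-/
lemma two_mul_length_le_wordDeg (w : List A.Pos) : 2 * w.length ≤ A.wordDeg w := by
  induction w with
  | nil => simp
  | cons x w ih =>
    have := x.2
    simp only [List.length_cons, wordDeg_cons]
    omega

@[simp] lemma sgn_nil : A.sgn [] = 1 := rfl

lemma sgn_cons (x : A.Pos) (w : List A.Pos) : A.sgn (x :: w) = A.sgn [x] * A.sgn w := by
  simp [sgn, pow_add]

lemma sgn_append (v w : List A.Pos) : A.sgn (v ++ w) = A.sgn v * A.sgn w := by
  simp [sgn, pow_add]

@[simp] lemma sgn_mul_sgn (w : List A.Pos) : A.sgn w * A.sgn w = 1 := by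
  rw [sgn, ← mul_pow]
  simp

/-- The family `m` has degree `-1`. -/
def HasDegree (A : FreeComplex Q R) (m : List A.Pos → (A.Pos →₀ Q)) : Prop :=
  ∀ w y, m w y ≠ 0 → (A.deg y + 1) + 1 = A.wordDeg w

lemma HasDegree.sgn_eq {m : List A.Pos → (A.Pos →₀ Q)} (hm : A.HasDegree m) {w : List A.Pos}
    {b : A.Pos} (h : m w b ≠ 0) : A.sgn [b] = -A.sgn w := by
  rw [sgn, sgn, ← hm w b h, pow_succ _ (A.deg b + 1)]
  simp

/-- The composition of the coderivation given by `m` with `F`. -/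
def coder {Q R : Type u} [CommRing Q] [CommRing R] [Algebra Q R] {A : FreeComplex Q R}
    {Y : Type*} [AddCommGroup Y] [Module Q Y] (m : List A.Pos → (A.Pos →₀ Q)) :
    (List A.Pos → Y) → List A.Pos → Y
  | _, [] => 0
  | F, x :: w => splitSum (fun v z => pair (m (x :: v)) fun b => F (b :: z)) w +
      A.sgn [x] • coder m (fun u => F (x :: u)) w

variable {m : List A.Pos → (A.Pos →₀ Q)}

@[simp] lemma coder_nil (F : List A.Pos → Y) : coder m F [] = 0 := rfl

lemma coder_cons (F : List A.Pos → Y) (x : A.Pos) (w : List A.Pos) : coder m F (x :: w) =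
    splitSum (fun v z => pair (m (x :: v)) fun b => F (b :: z)) w +
      A.sgn [x] • coder m (fun u => F (x :: u)) w := rfl

lemma subwordSum_eq_coder (F : List A.Pos → Y) (k : ℤ) (w : List A.Pos) :
    subwordSum (fun u v z => k • A.sgn u • pair (m v) fun b => F (u ++ b :: z)) w =
      k • coder m F w := by
  induction w generalizing F k with
  | nil => simp [subwordSum]
  | cons x w ih =>
    rw [subwordSum, coder_cons, smul_add, smul_smul, ← ih (fun u => F (x :: u)) (k * A.sgn [x]),
      zsmul_splitSum]
    simp only [sgn_nil, one_smul, List.nil_append, List.cons_append]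
    congr 2
    funext u v z
    rw [sgn_cons, mul_smul, mul_smul]

lemma sum_sum_eq_coder (m : List A.Pos → (A.Pos →₀ Q)) (F : List A.Pos → Y) (w : List A.Pos) :
    ∑ i ∈ Finset.Icc 1 w.length, ∑ j ∈ Finset.range (w.length - i + 1),
      A.sgn (w.take j) • (m ((w.drop j).take i)).sum
        (fun b q => q • F (w.take j ++ b :: w.drop (j + i))) = coder m F w := by
  have := subwordSum_eq_coder (m := m) F 1 w
  rw [one_smul, ← sum_sum_eq_subwordSum] at this
  simp only [one_smul] at this
  exact this

/-- The comparison is needed only at letters `b` that occur in `m v`, so degree information about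
`m` is available to the caller. -/
lemma coder_congr {F F' : List A.Pos → Y} {w : List A.Pos}
    (h : ∀ u v z b, w = u ++ v ++ z → v ≠ [] → m v b ≠ 0 → F (u ++ b :: z) = F' (u ++ b :: z)) :
    coder m F w = coder m F' w := by
  induction w generalizing F F' with
  | nil => rfl
  | cons x w ih =>
    rw [coder_cons, coder_cons]
    congr 1
    · refine splitSum_congr fun v z hvz => pair_congr fun b hb => ?_
      exact h [] (x :: v) z b (by simp [hvz]) (List.cons_ne_nil _ _) hb
    · rw [ih]
      intro u v z b hw hv hb
      exact h (x :: u) v z b (by simp [hw]) hv hb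

@[simp] lemma coder_zero (w : List A.Pos) : coder m (fun _ => (0 : Y)) w = 0 := by
  induction w with
  | nil => rfl
  | cons x w ih =>
    rw [coder_cons, ih, smul_zero, add_zero]
    exact splitSum_eq_zero fun v z _ => pair_zero_right _

lemma coder_eq_zero {F : List A.Pos → Y} {w : List A.Pos}
    (h : ∀ u v z b, w = u ++ v ++ z → v ≠ [] → m v b ≠ 0 → F (u ++ b :: z) = 0) :
    coder m F w = 0 :=
  (coder_congr h).trans (coder_zero w)

lemma coder_add (F F' : List A.Pos → Y) (w : List A.Pos) :
    coder m (fun u => F u + F' u) w = coder m F w + coder m F' w := by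
  induction w generalizing F F' with
  | nil => simp
  | cons x w ih =>
    simp only [coder_cons, ih, pair_add_right, splitSum_add, smul_add]
    abel

lemma coder_add_left (m m' : List A.Pos → (A.Pos →₀ Q)) (F : List A.Pos → Y) (w : List A.Pos) :
    coder (fun u => m u + m' u) F w = coder m F w + coder m' F w := by
  induction w generalizing F with
  | nil => simp
  | cons x w ih =>
    simp only [coder_cons, ih, pair_add_left, splitSum_add, smul_add]
    abel

lemma map_coder (f : Y →ₗ[Q] Z) (F : List A.Pos → Y) (w : List A.Pos) :
    coder m (fun u => f (F u)) w = f (coder m F w) := by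
  induction w generalizing F with
  | nil => simp
  | cons x w ih =>
    simp only [coder_cons, ih, map_pair, map_add, map_zsmul]
    congr 1
    exact map_splitSum f.toAddMonoidHom _ _

lemma coder_zsmul (k : ℤ) (F : List A.Pos → Y) (w : List A.Pos) :
    coder m (fun u => k • F u) w = k • coder m F w := by
  induction w generalizing F with
  | nil => simp
  | cons x w ih =>
    simp only [coder_cons, ih, pair_zsmul_right, smul_add, zsmul_splitSum]
    rw [smul_comm]

lemma pair_coder {B : Type*} (ℓ : B →₀ Q) (F : B → List A.Pos → Y) (w : List A.Pos) :
    pair ℓ (fun b => coder m (F b) w) = coder m (fun u => pair ℓ fun b => F b u) w := by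
  induction w generalizing F with
  | nil => simp
  | cons x w ih =>
    simp only [coder_cons, pair_add_right, pair_zsmul_right]
    rw [ih fun b u => F b (x :: u), pair_splitSum]
    congr 1
    refine splitSum_congr fun v z _ => ?_
    exact pair_pair_comm _ _ fun b c => F b (c :: z)

/-- A map of degree `-1` changes the parity of the word, so it anticommutes with the sign operator.
-/
lemma coder_sgn (hm : A.HasDegree m) (F : List A.Pos → Y) (w : List A.Pos) :
    coder m (fun u => A.sgn u • F u) w = -(A.sgn w • coder m F w) := by
  induction w generalizing F with
  | nil => simp
  | cons x w ih =>
    have h1 : coder m (fun u => A.sgn (x :: u) • F (x :: u)) w =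
        A.sgn [x] • -(A.sgn w • coder m (fun u => F (x :: u)) w) := by
      rw [← ih, ← coder_zsmul]
      refine coder_congr fun u v z b _ _ _ => ?_
      rw [sgn_cons, mul_smul]
    have h2 : splitSum (fun v z => pair (m (x :: v)) fun b => A.sgn (b :: z) • F (b :: z)) w =
        -(A.sgn (x :: w) • splitSum (fun v z => pair (m (x :: v)) fun b => F (b :: z)) w) := by
      rw [← neg_smul, zsmul_splitSum]
      refine splitSum_congr fun v z hvz => ?_
      rw [← pair_zsmul_right]
      refine pair_congr fun b hb => ?_
      rw [sgn_cons, hm.sgn_eq hb, ← hvz, ← List.cons_append, sgn_append, neg_mul]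
    rw [coder_cons, coder_cons, h1, h2, smul_add, smul_neg, neg_add, sgn_cons x w]
    simp only [smul_smul, smul_neg]
    congr 3
    ring

/-- The coderivation property. -/
lemma coder_splitSum (φ : List A.Pos → List A.Pos → Y) (w : List A.Pos) :
    coder m (splitSum φ) w = splitSum (fun v z => coder m (fun u => φ u z) v +
      A.sgn v • coder m (φ v) z) w := by
  induction w generalizing φ with
  | nil => simp
  | cons x w ih =>
    have h1 : splitSum (fun v z => pair (m (x :: v)) fun b => splitSum φ (b :: z)) w =
        splitSum (fun v z => pair (m (x :: v)) fun b => φ [] (b :: z)) w +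
        splitSum (fun v z => splitSum (fun v' z' => pair (m (x :: v')) fun b =>
          φ (b :: z') z) v) w := by
      rw [splitSum_assoc (fun v' z' z => pair (m (x :: v')) fun b => φ (b :: z') z),
        ← splitSum_add]
      refine splitSum_congr fun v z _ => ?_
      simp only [splitSum_cons]
      rw [pair_add_right, pair_splitSum]
    have h2 : coder m (fun u => splitSum φ (x :: u)) w = coder m (fun u => φ [] (x :: u)) w +
        splitSum (fun v z => coder m (fun u => φ (x :: u) z) v +
          A.sgn v • coder m (φ (x :: v)) z) w := by
      simp only [splitSum_cons]
      rw [coder_add, ih]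
    rw [coder_cons, h1, h2, splitSum_cons, coder_nil, zero_add, sgn_nil, one_smul,
      coder_cons (φ [])]
    obtain ⟨s, hs⟩ : ∃ s : ℤ, ∀ v, A.sgn (x :: v) = s * A.sgn v := ⟨A.sgn [x], sgn_cons x⟩
    simp only [coder_cons, hs, sgn_nil, mul_one, splitSum_add, smul_add, zsmul_splitSum, mul_smul]
    abel

/-- Two disjoint operations, one on a block starting at `x` and one behind it, occur in both orders
with opposite signs. Nested operations assemble into `coder m m`. Where both avoid `x`, the sign of
`x` appears twice, which leaves no sign. -/
lemma coder_coder_cons (hm : A.HasDegree m) (F : List A.Pos → Y) (x : A.Pos) (w : List A.Pos) :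
    coder m (coder m F) (x :: w) =
      splitSum (fun v z => pair (coder m m (x :: v)) fun b => F (b :: z)) w +
        coder m (coder m fun u => F (x :: u)) w := by
  have h1 : splitSum (fun v z => pair (m (x :: v)) fun b => coder m F (b :: z)) w =
      splitSum (fun v z => splitSum (fun v' z' => pair (pair (m (x :: v')) fun b => m (b :: z'))
        fun b => F (b :: z)) v) w -
      splitSum (fun v z => A.sgn (x :: v) • coder m
        (fun u => pair (m (x :: v)) fun b => F (b :: u)) z) w := by
    rw [splitSum_assoc (fun v' z' z => pair (pair (m (x :: v')) fun b => m (b :: z'))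
        fun b => F (b :: z)), eq_sub_iff_add_eq, ← splitSum_add]
    refine splitSum_congr fun v z _ => ?_
    have h3 : (pair (m (x :: v)) fun b => coder m F (b :: z)) =
        pair (m (x :: v)) (fun b => splitSum (fun v z => pair (m (b :: v)) fun b => F (b :: z)) z)
        + pair (m (x :: v)) (fun b => (-A.sgn (x :: v)) • coder m (fun u => F (b :: u)) z) := by
      rw [← pair_add_right]
      refine pair_congr fun b hb => ?_
      rw [coder_cons, hm.sgn_eq hb]
    rw [h3, pair_splitSum, pair_zsmul_right, pair_coder, neg_smul]
    simp only [pair_pair]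
    abel
  have h2 : coder m (fun u => coder m F (x :: u)) w =
      splitSum (fun v z => coder m (fun u => pair (m (x :: u)) fun b => F (b :: z)) v) w +
      splitSum (fun v z => A.sgn v • coder m
        (fun u => pair (m (x :: v)) fun b => F (b :: u)) z) w +
      A.sgn [x] • coder m (coder m fun u => F (x :: u)) w := by
    simp only [coder_cons]
    rw [coder_add, coder_zsmul]
    congr 1
    rw [← splitSum_add]
    exact coder_splitSum (fun v z => pair (m (x :: v)) fun b => F (b :: z)) w
  rw [coder_cons, h1, h2]
  have h4 : ∀ v z, pair (coder m m (x :: v)) (fun b => F (b :: z)) =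
      splitSum (fun v' z' => pair (pair (m (x :: v')) fun b => m (b :: z'))
        fun b => F (b :: z)) v +
      A.sgn [x] • coder m (fun u => pair (m (x :: u)) fun b => F (b :: z)) v := by
    intro v z
    have h5 := map_coder (m := m) (Finsupp.linearCombination Q fun b => F (b :: z)) m (x :: v)
    rw [pair, ← h5, coder_cons]
    simp only [← pair_pair]
    rfl
  obtain ⟨s, hs, hs'⟩ : ∃ s : ℤ, s * s = 1 ∧ ∀ v, A.sgn (x :: v) = s * A.sgn v :=
    ⟨A.sgn [x], sgn_mul_sgn _, sgn_cons x⟩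
  simp only [h4, hs', sgn_nil, mul_one, splitSum_add, smul_add, zsmul_splitSum, mul_smul]
  simp only [← zsmul_splitSum, smul_smul, hs, one_smul]
  abel

end Coder

end FreeComplex

end

noncomputable section

open IsLocalRing

/-! ### Squares of coderivations, the curvature, and the bar differential. -/

namespace FreeComplex

section

variable {P Y : Type*} [AddCommGroup Y]

lemma splitSum_sub (φ ψ : List P → List P → Y) (w : List P) :
    splitSum (fun v z => φ v z - ψ v z) w = splitSum φ w - splitSum ψ w := by
  rw [eq_sub_iff_add_eq, ← splitSum_add]
  simp

lemma splitSum_eq_right {φ : List P → List P → Y} {w : List P}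
    (h : ∀ v z, v ++ z = w → z ≠ [] → φ v z = 0) : splitSum φ w = φ w [] := by
  induction w generalizing φ with
  | nil => rfl
  | cons x w ih =>
    rw [splitSum_cons, h [] _ rfl (List.cons_ne_nil _ _), zero_add]
    exact ih fun v z hvz hz => h (x :: v) z (by simp [hvz]) hz

lemma subwordSum_cons (φ : List P → List P → List P → Y) (x : P) (w : List P) :
    subwordSum φ (x :: w) = splitSum (fun v z => φ [] (x :: v) z) w +
      subwordSum (fun u v z => φ (x :: u) v z) w := rfl

lemma subwordSum_sub (φ ψ : List P → List P → List P → Y) (w : List P) :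
    subwordSum (fun u v z => φ u v z - ψ u v z) w = subwordSum φ w - subwordSum ψ w := by
  induction w generalizing φ ψ with
  | nil => simp [subwordSum]
  | cons x w ih =>
    simp only [subwordSum_cons, splitSum_sub]
    rw [ih fun u v z => φ (x :: u) v z]
    abel

lemma subwordSum_eq_zero {φ : List P → List P → List P → Y} {w : List P}
    (h : ∀ u v z, u ++ v ++ z = w → v ≠ [] → φ u v z = 0) : subwordSum φ w = 0 := by
  induction w generalizing φ with
  | nil => rfl
  | cons x w ih =>
    rw [subwordSum_cons, splitSum_eq_zero, ih, add_zero]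
    · exact fun u v z hw hv => h (x :: u) v z (by simp [← hw]) hv
    · exact fun v z hw => h [] (x :: v) z (by simp [← hw]) (List.cons_ne_nil _ _)

lemma subwordSum_eq_self {φ : List P → List P → List P → Y} {w : List P} (hw0 : w ≠ [])
    (h : ∀ u v z, u ++ v ++ z = w → v.length < w.length → v ≠ [] → φ u v z = 0) :
    subwordSum φ w = φ [] w [] := by
  cases w with
  | nil => exact absurd rfl hw0
  | cons x w =>
    rw [subwordSum_cons, subwordSum_eq_zero, add_zero, splitSum_eq_right]
    · intro v z hw hz
      refine h [] (x :: v) z (by simp [← hw]) ?_ (List.cons_ne_nil _ _)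
      have := List.length_pos_of_ne_nil hz
      simp [← hw]
      omega
    · intro u v z hw hv
      refine h (x :: u) v z (by simp [← hw]) ?_ hv
      simp [← hw]
      omega

end

section Curvature

variable {Q R : Type u} [CommRing Q] [CommRing R] [Algebra Q R] {A : FreeComplex Q R}
  {Y Z : Type*} [AddCommGroup Y] [Module Q Y] [AddCommGroup Z] [Module Q Z]
  {m : List A.Pos → (A.Pos →₀ Q)}

/-- The square of an odd coderivation is an even coderivation, with components `coder m m`; hence no
signs on the right. -/
lemma coder_coder (hm : A.HasDegree m) (F : List A.Pos → Y) (w : List A.Pos) :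
    coder m (coder m F) w =
      subwordSum (fun u v z => pair (coder m m v) fun b => F (u ++ b :: z)) w := by
  induction w generalizing F with
  | nil => rfl
  | cons x w ih =>
    rw [coder_coder_cons hm, ih, subwordSum_cons]
    simp only [List.nil_append, List.cons_append]

/-- The linear form on `⨁ A₊[1]^{⊗ n}` which is `d₁` on the summand `n = 1`. -/
def dOne (A : FreeComplex Q R) (e : A.ι) : List A.Pos → Q
  | [x] => A.d x e
  | _ => 0

/-- The projection of `⨁ A₊[1]^{⊗ n}` to the summand `n = 1`. -/
def proj (A : FreeComplex Q R) : List A.Pos → (A.Pos →₀ Q)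
  | [x] => Finsupp.single x 1
  | _ => 0

@[simp] lemma proj_nil : A.proj [] = 0 := rfl

@[simp] lemma proj_singleton (x : A.Pos) : A.proj [x] = Finsupp.single x 1 := rfl

@[simp] lemma proj_cons_cons (x y : A.Pos) (w : List A.Pos) : A.proj (x :: y :: w) = 0 := rfl

variable (e : A.ι)

@[simp] lemma dOne_nil : A.dOne e [] = 0 := rfl

@[simp] lemma dOne_singleton (x : A.Pos) : A.dOne e [x] = A.d x e := rfl

@[simp] lemma dOne_cons_cons (x y : A.Pos) (w : List A.Pos) : A.dOne e (x :: y :: w) = 0 := rfl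

lemma dOne_eq (w : List A.Pos) : A.dOne e w = pair (A.proj w) fun b => A.d b e := by
  rcases w with _ | ⟨x, _ | ⟨y, w⟩⟩ <;> simp

lemma curvature_singleton (x : A.Pos) : A.curvature e [x] = 0 := rfl

lemma curvature_pair (x y : A.Pos) : A.curvature e [x, y] =
    Finsupp.single y (A.d x e) - Finsupp.single x (A.d y e) := rfl

/-- Written over decompositions of the word, the curvature becomes accessible to the coderivation
property `coder_splitSum`. -/
lemma curvature_eq (w : List A.Pos) : A.curvature e w =
    splitSum (fun u z => A.dOne e u • A.proj z - A.dOne e z • A.proj u) w := by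
  rcases w with _ | ⟨x, _ | ⟨y, _ | ⟨z, w⟩⟩⟩
  · exact (sub_eq_zero.2 rfl).symm
  · rw [curvature_singleton]
    simp [splitSum_cons]
  · rw [curvature_pair]
    simp [splitSum_cons]
  · rw [splitSum_eq_zero]
    · rfl
    intro u v huv
    rcases u with _ | ⟨a, _ | ⟨b, u⟩⟩ <;> rcases v with _ | ⟨c, _ | ⟨d, v⟩⟩ <;>
      simp at huv ⊢

lemma coder_proj (w : List A.Pos) (h : m [] = 0) : coder m A.proj w = m w := by
  cases w with
  | nil => rw [h]; rfl
  | cons x w =>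
    rw [coder_cons, coder_eq_zero, smul_zero, add_zero, splitSum_eq_right]
    · change Finsupp.linearCombination Q (fun b => Finsupp.single b 1) (m (x :: w)) = _
      rw [Finsupp.linearCombination_apply]
      simp
    · intro v z _ hz
      obtain ⟨y, z, rfl⟩ := List.exists_cons_of_ne_nil hz
      exact pair_zero_right _
    · intro u v z b _ _ _
      rcases u with _ | ⟨_, u⟩ <;> rfl

lemma splitSum_dOne_smul (F : List A.Pos → Y) (x : A.Pos) (w : List A.Pos) :
    splitSum (fun u z => A.dOne e u • F z) (x :: w) = A.d x e • F w := by
  rw [splitSum_cons]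
  have h0 : A.dOne e [] • F (x :: w) = 0 := zero_smul _ _
  rw [h0, zero_add, splitSum_eq_left]
  · rfl
  · intro v z _ hv
    obtain ⟨y, v, rfl⟩ := List.exists_cons_of_ne_nil hv
    exact zero_smul _ _

/-- The form `d₁` is supported on letters of shifted degree `2`, which is even. -/
lemma sgn_smul_dOne (hA : A.IsComplex) (he : A.deg e = 0) (w : List A.Pos) :
    A.sgn w • A.dOne e w = A.dOne e w := by
  rcases w with _ | ⟨x, _ | ⟨y, w⟩⟩
  · simp
  · by_cases h : A.d x e = 0
    · simp [h]
    · have := hA.deg_d x e h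
      simp [sgn, this, he]
  · simp

/-- The curvature after the coderivation of `m` is `d₁ ⊗ m - m ⊗ d₁`: the coderivation property
applies, and the terms in which `d₁` follows `m` vanish by `h1`. -/
lemma coder_curvature_cons (hA : A.IsComplex) (he : A.deg e = 0) (h0 : m [] = 0)
    (h1 : ∀ w, pair (m w) (fun b => A.d b e) = 0) (x : A.Pos) (w : List A.Pos) :
    coder m (A.curvature e) (x :: w) + splitSum (fun u z => A.dOne e z • m u) (x :: w) =
      A.d x e • m w := by
  have h2 : ∀ w, coder m (A.dOne e) w = 0 := by
    intro w
    have : A.dOne e = fun w => Finsupp.linearCombination Q (fun b : A.Pos => A.d b e)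
      (A.proj w) := funext (dOne_eq e)
    rw [this, map_coder, coder_proj w h0]
    exact h1 w
  have h3 : A.curvature e =
    splitSum (fun u z => A.dOne e u • A.proj z - A.dOne e z • A.proj u) :=
    funext (curvature_eq e)
  rw [h3, coder_splitSum, ← splitSum_dOne_smul e m, ← splitSum_add]
  refine splitSum_congr fun u z _ => ?_
  have h4 : ∀ a : Q, coder m (fun v => a • A.proj v) u = a • m u := fun a => by
    rw [← coder_proj u h0]
    exact map_coder (LinearMap.lsmul Q (A.Pos →₀ Q) a) _ _
  have h4' : ∀ a : Q, coder m (fun v => a • A.proj v) z = a • m z := fun a => by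
    rw [← coder_proj z h0]
    exact map_coder (LinearMap.lsmul Q (A.Pos →₀ Q) a) _ _
  have h5 : ∀ (ℓ : A.Pos →₀ Q) v, coder m (fun v => A.dOne e v • ℓ) v = 0 := fun ℓ v => by
    have := map_coder (m := m) ((LinearMap.lsmul Q (A.Pos →₀ Q)).flip ℓ) (A.dOne e) v
    rw [h2, map_zero] at this
    exact this
  have h6 : ∀ (f g : List A.Pos → A.Pos →₀ Q) v, coder m (fun v => f v - g v) v =
      coder m f v - coder m g v := fun f g v => by
    rw [eq_sub_iff_add_eq, ← coder_add]
    simp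
  rw [h6, h6, h5, h5, h4, h4', sub_zero, ← smul_assoc, sgn_smul_dOne e hA he]
  abel

/-- Telescoping: applying the curvature at consecutive pairs of letters cancels all interior terms,
so only the removal of the first letter and that of the last letter remain. -/
lemma subwordSum_curvature_cons (F : List A.Pos → Y) (x : A.Pos) (w : List A.Pos) :
    subwordSum (fun u v z => pair (A.curvature e v) fun b => F (u ++ b :: z)) (x :: w) +
      splitSum (fun u z => A.dOne e z • F u) (x :: w) = A.d x e • F w := by
  induction w generalizing F x with
  | nil =>
    simp only [subwordSum, curvature_singleton, splitSum_nil, pair_zero_left]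
    simp [splitSum_cons]
  | cons y w ih =>
    have h1 : splitSum (fun v z => pair (A.curvature e (x :: v)) fun b => F ([] ++ b :: z))
        (y :: w) = A.d x e • F (y :: w) - A.d y e • F (x :: w) := by
      rw [splitSum_cons, splitSum_eq_left]
      · rw [curvature_singleton, curvature_pair, pair_sub_left, pair_zero_left, zero_add,
          pair_single, pair_single]
        rfl
      · intro v z _ hv
        obtain ⟨c, v, rfl⟩ := List.exists_cons_of_ne_nil hv
        exact pair_zero_left _
    rw [subwordSum_cons, h1, splitSum_cons]
    have h2 := ih (fun u => F (x :: u)) y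
    simp only [List.cons_append] at h2 ⊢
    rw [add_assoc, add_left_comm (subwordSum _ _), h2]
    simp

/-! ### The differential of the bar construction -/

variable {C : Type} {mG : List A.Pos → C → (C →₀ Q)}

/-- The composition of the differential of the bar construction with `F`. -/
def barDiff {Q R : Type u} [CommRing Q] [CommRing R] [Algebra Q R] {A : FreeComplex Q R}
    {Y : Type*} [AddCommGroup Y] [Module Q Y] {C : Type} (m : List A.Pos → (A.Pos →₀ Q))
    (mG : List A.Pos → C → (C →₀ Q)) (F : List A.Pos → C → Y) (w : List A.Pos) (c : C) : Y :=
  coder m (fun u => F u c) w + splitSum (fun u v => A.sgn u • pair (mG v c) (F u)) w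

lemma sum_eq_barDiff (m : List A.Pos → (A.Pos →₀ Q)) (mG : List A.Pos → C → (C →₀ Q))
    (F : List A.Pos → C → Y) (w : List A.Pos) (c : C) :
    (∑ i ∈ Finset.Icc 1 w.length, ∑ j ∈ Finset.range (w.length - i + 1),
      A.sgn (w.take j) • (m ((w.drop j).take i)).sum
        (fun b q => q • F (w.take j ++ b :: w.drop (j + i)) c)) +
    (∑ j ∈ Finset.range (w.length + 1),
      A.sgn (w.take j) • (mG (w.drop j) c).sum (fun c' q => q • F (w.take j) c')) =
    barDiff m mG F w c := by
  rw [sum_sum_eq_coder m (fun u => F u c), barDiff,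
    ← sum_range_eq_splitSum (fun u v => A.sgn u • pair (mG v c) (F u))]
  rfl

lemma map_barDiff (f : Y →ₗ[Q] Z) (F : List A.Pos → C → Y) (w : List A.Pos) (c : C) :
    barDiff m mG (fun u c => f (F u c)) w c = f (barDiff m mG F w c) := by
  rw [barDiff, barDiff, map_add, map_coder f fun u => F u c]
  congr 1
  refine Eq.trans ?_ (map_splitSum f.toAddMonoidHom _ _)
  refine splitSum_congr fun u v _ => ?_
  rw [map_pair]
  simp

lemma barDiff_cons (F : List A.Pos → C → Y) (x : A.Pos) (w : List A.Pos) (c : C) :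
    barDiff m mG F (x :: w) c =
      splitSum (fun v z => pair (m (x :: v)) fun b => F (b :: z) c) w +
      pair (mG (x :: w) c) (F []) + A.sgn [x] • barDiff m mG (fun u => F (x :: u)) w c := by
  simp only [barDiff, coder_cons, splitSum_cons, sgn_nil, one_smul, smul_add, zsmul_splitSum,
    smul_smul, ← sgn_cons]
  abel

lemma barDiff_nil (F : List A.Pos → C → Y) (c : C) :
    barDiff m mG F [] c = pair (mG [] c) (F []) := by
  simp [barDiff]

lemma barDiff_congr {F F' : List A.Pos → C → Y} {w : List A.Pos} {c : C}
    (h1 : ∀ u v z b, w = u ++ v ++ z → v ≠ [] → m v b ≠ 0 →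
      F (u ++ b :: z) c = F' (u ++ b :: z) c)
    (h2 : ∀ u v c', w = u ++ v → mG v c c' ≠ 0 → F u c' = F' u c') :
    barDiff m mG F w c = barDiff m mG F' w c := by
  rw [barDiff, barDiff]
  congr 1
  · exact coder_congr h1
  · refine splitSum_congr fun u v huv => ?_
    rw [pair_congr fun c' hc' => h2 u v c' huv.symm hc']

lemma barDiff_zero (w : List A.Pos) (c : C) :
    barDiff m mG (fun _ _ => (0 : Y)) w c = 0 := by
  rw [barDiff, coder_zero, zero_add, splitSum_eq_zero]
  intro u v _
  rw [pair_zero_right, smul_zero]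

lemma barDiff_eq_zero {F : List A.Pos → C → Y} {w : List A.Pos} {c : C}
    (h1 : ∀ u v z b, w = u ++ v ++ z → v ≠ [] → m v b ≠ 0 → F (u ++ b :: z) c = 0)
    (h2 : ∀ u v c', w = u ++ v → mG v c c' ≠ 0 → F u c' = 0) :
    barDiff m mG F w c = 0 :=
  (barDiff_congr (F' := fun _ _ => 0) h1 h2).trans (barDiff_zero w c)

/-- As for coderivations, an algebra operation on `u` and a module operation on `v` occur in both
orders with opposite signs; what survives are the squares of the two kinds. -/
lemma barDiff_barDiff (hm : A.HasDegree m) (F : List A.Pos → C → Y) (w : List A.Pos) (c : C) :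
    barDiff m mG (barDiff m mG F) w c = coder m (coder m fun u => F u c) w +
      splitSum (fun u v => pair (barDiff m mG mG v c) (F u)) w := by
  have h1 : coder m (fun u => barDiff m mG F u c) w = coder m (coder m fun u => F u c) w +
      (splitSum (fun u v => -(A.sgn u • coder m (fun u' => pair (mG v c) (F u')) u)) w +
        splitSum (fun u v => coder m (fun v' => pair (mG v' c) (F u)) v) w) := by
    simp only [barDiff]
    rw [coder_add, ← splitSum_add]
    congr 1
    refine (coder_splitSum (fun u v => A.sgn u • pair (mG v c) (F u)) w).trans ?_
    refine splitSum_congr fun u v _ => ?_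
    rw [coder_sgn hm, coder_zsmul, smul_smul, sgn_mul_sgn, one_smul]
  have h2 : splitSum (fun u v => A.sgn u • pair (mG v c) (barDiff m mG F u)) w =
      splitSum (fun u v => A.sgn u • coder m (fun u' => pair (mG v c) (F u')) u) w +
      splitSum (fun u v => splitSum (fun v' v => A.sgn v' •
        pair (pair (mG v c) (mG v')) (F u)) v) w := by
    rw [← splitSum_assoc (fun u v' v => A.sgn v' • pair (pair (mG v c) (mG v')) (F u)),
      ← splitSum_add]
    refine splitSum_congr fun u v _ => ?_
    have h3 : pair (mG v c) (barDiff m mG F u) = pair (mG v c) (fun c' =>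
        coder m (fun u => F u c') u) + pair (mG v c) (fun c' =>
        splitSum (fun u' v' => A.sgn u' • pair (mG v' c') (F u')) u) :=
      pair_add_right _ _ _
    rw [h3, pair_coder, pair_splitSum, smul_add, zsmul_splitSum]
    congr 1
    refine splitSum_congr fun u' v' huv => ?_
    rw [pair_zsmul_right, pair_pair, smul_smul, ← huv, sgn_append, mul_right_comm, sgn_mul_sgn,
      one_mul]
  have h3 : ∀ u v, pair (barDiff m mG mG v c) (F u) =
      coder m (fun v' => pair (mG v' c) (F u)) v +
      splitSum (fun v' v => A.sgn v' • pair (pair (mG v c) (mG v')) (F u)) v := by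
    intro u v
    refine (map_barDiff (Finsupp.linearCombination Q (F u)) mG v c).symm.trans ?_
    rw [barDiff]
    congr 1
    refine splitSum_congr fun v' v _ => ?_
    rw [← pair_pair]
    rfl
  have h4 : splitSum (fun u v => -(A.sgn u • coder m (fun u' => pair (mG v c) (F u')) u)) w =
      -splitSum (fun u v => A.sgn u • coder m (fun u' => pair (mG v c) (F u')) u) w :=
    map_splitSum (-AddMonoidHom.id Y) _ _
  rw [barDiff, h1, h2, h4]
  simp only [h3, splitSum_add]
  abel

end Curvature

end FreeComplex

end

noncomputable section

open IsLocalRing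

/-! ### A-infinity algebra structures by obstruction theory. -/

namespace FreeComplex

section Algebra

variable {Q R : Type u} [CommRing Q] [CommRing R] [Algebra Q R] {A : FreeComplex Q R} {e : A.ι}
  {m : List A.Pos → (A.Pos →₀ Q)}

/-- The inclusion of the part of positive degrees. -/
def extend (A : FreeComplex Q R) : (A.Pos →₀ Q) →ₗ[Q] (A.ι →₀ Q) :=
  Finsupp.lmapDomain Q Q Subtype.val

/-- The projection to the part of positive degrees. -/
def restrict (A : FreeComplex Q R) : (A.ι →₀ Q) →ₗ[Q] (A.Pos →₀ Q) :=
  Finsupp.lsubtypeDomain {x | 0 < A.deg x}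

@[simp] lemma extend_apply (ℓ : A.Pos →₀ Q) (b : A.Pos) : A.extend ℓ b = ℓ b :=
  Finsupp.mapDomain_apply Subtype.val_injective _ _

lemma extend_apply_of_deg_eq_zero (ℓ : A.Pos →₀ Q) {x : A.ι} (hx : A.deg x = 0) :
    A.extend ℓ x = 0 :=
  Finsupp.mapDomain_of_notMem_range _ _ (by rintro ⟨y, rfl⟩; exact y.2.ne' hx)

@[simp] lemma restrict_apply (z : A.ι →₀ Q) (b : A.Pos) : A.restrict z b = z b := rfl

lemma D_extend_restrict (hA : A.IsComplex) (z : A.ι →₀ Q) :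
    A.D (A.extend (A.restrict z)) = A.D z := by
  rw [← sub_eq_zero, ← map_sub]
  refine hA.D_eq_zero (mem_degreePart.2 fun x hx => ?_)
  have := extend_apply (A.restrict z) ⟨x, Nat.pos_of_ne_zero hx⟩
  rw [Finsupp.sub_apply, this]
  simp

@[simp] lemma extend_single (b : A.Pos) (q : Q) :
    A.extend (Finsupp.single b q) = Finsupp.single (b : A.ι) q :=
  Finsupp.mapDomain_single

lemma pair_d_apply (ℓ : A.Pos →₀ Q) (y : A.ι) :
    pair ℓ (fun b => A.d b y) = A.D (A.extend ℓ) y := by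
  induction ℓ using Finsupp.induction_linear with
  | zero => simp
  | add f g hf hg => rw [pair_add_left, hf, hg]; simp
  | single x a => simp

/-- A family of maps of degree `-1` with the correct linear part. -/
structure IsPreAInf (A : FreeComplex Q R) (m : List A.Pos → (A.Pos →₀ Q)) : Prop where
  map_nil : m [] = 0
  map_one : ∀ x : A.Pos, m [x] = -A.restrict (A.d x)
  degree : A.HasDegree m

lemma isAInfAlgebraUpTo_iff {N : ℕ} : A.IsAInfAlgebraUpTo e N m ↔
    A.IsPreAInf m ∧ ∀ w, w.length ≤ N → coder m m w = A.curvature e w := by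
  constructor
  · rintro ⟨h1, h2, h3, h4⟩
    refine ⟨⟨h1, h2, h3⟩, fun w hw => ?_⟩
    rw [← h4 w hw, sum_sum_eq_coder]
  · rintro ⟨⟨h1, h2, h3⟩, h4⟩
    refine ⟨h1, h2, h3, fun w hw => ?_⟩
    rw [← h4 w hw, sum_sum_eq_coder]

lemma isAInfAlgebra_iff : A.IsAInfAlgebra e m ↔
    A.IsPreAInf m ∧ ∀ w, coder m m w = A.curvature e w := by
  constructor
  · intro h
    exact ⟨(isAInfAlgebraUpTo_iff.1 (h 0)).1, fun w => (isAInfAlgebraUpTo_iff.1 (h _)).2 w le_rfl⟩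
  · exact fun h N => isAInfAlgebraUpTo_iff.2 ⟨h.1, fun w _ => h.2 w⟩

lemma IsPreAInf.pair_singleton (hm : A.IsPreAInf m) (ℓ : A.Pos →₀ Q) :
    pair ℓ (fun b => m [b]) = -A.restrict (A.D (A.extend ℓ)) := by
  induction ℓ using Finsupp.induction_linear with
  | zero => simp
  | add f g hf hg => rw [pair_add_left, hf, hg]; simp [add_comm]
  | single x a => simp [hm.map_one]

lemma length_eq_one_of_wordDeg {w : List A.Pos} (h : A.wordDeg w = 3) : ∃ x, w = [x] := by
  have := two_mul_length_le_wordDeg w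
  rcases w with _ | ⟨x, _ | ⟨y, w⟩⟩
  · simp at h
  · exact ⟨x, rfl⟩
  · simp only [List.length_cons] at this
    omega

/-- The form sees only letters of degree `1`, and these are values on words of shifted degree `3`,
that is, on single letters of degree `2`. There the claim is `d² = 0`. -/
lemma IsPreAInf.pair_dOne (hA : A.IsComplex) (he : A.deg e = 0) (hm : A.IsPreAInf m)
    (w : List A.Pos) : pair (m w) (fun b => A.d b e) = 0 := by
  by_cases hw : A.wordDeg w = 3
  · obtain ⟨x, rfl⟩ := length_eq_one_of_wordDeg hw
    rw [hm.map_one, pair_neg_left, pair_d_apply, D_extend_restrict hA]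
    have := hA.D_D (Finsupp.single x 1)
    rw [D_single, one_smul] at this
    rw [this]
    simp
  · refine pair_eq_zero fun b hb => ?_
    by_contra h
    have h1 := hA.deg_d b e h
    have h2 := hm.degree w b hb
    omega

lemma IsPreAInf.coder_singleton (hA : A.IsComplex) (hm : A.IsPreAInf m) (x : A.Pos) :
    coder m m [x] = 0 := by
  have h := hA.D_D (Finsupp.single x 1)
  rw [D_single, one_smul] at h
  rw [coder_cons, coder_nil, smul_zero, add_zero, splitSum_nil, hm.pair_singleton, hm.map_one,
    map_neg, map_neg, D_extend_restrict hA, h]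
  simp

lemma IsPreAInf.coder_eq_of_length_le_one (hA : A.IsComplex) (hm : A.IsPreAInf m)
    {w : List A.Pos} (hw : w.length ≤ 1) : coder m m w = A.curvature e w := by
  rcases w with _ | ⟨x, _ | ⟨y, w⟩⟩
  · rfl
  · exact hm.coder_singleton hA x
  · simp at hw

lemma HasDegree.coder_degree (hm : A.HasDegree m) {w : List A.Pos} {y : A.Pos}
    (h : coder m m w y ≠ 0) : A.deg y + 3 = A.wordDeg w := by
  by_contra hy
  refine h ?_
  have h1 := map_coder (m := m) (Finsupp.lapply (R := Q) y) m w
  rw [Finsupp.lapply_apply] at h1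
  rw [← h1]
  refine coder_eq_zero fun u v z b hw _ hb => ?_
  by_contra hne
  have h2 := hm _ _ hb
  have h3 := hm _ _ hne
  simp only [hw, wordDeg_append, wordDeg_cons] at hy h3
  omega

lemma curvature_degree (hA : A.IsComplex) (he : A.deg e = 0) {w : List A.Pos} {y : A.Pos}
    (h : A.curvature e w y ≠ 0) : A.deg y + 3 = A.wordDeg w := by
  classical
  rcases w with _ | ⟨x, _ | ⟨x', _ | ⟨z, w⟩⟩⟩
  · exact absurd rfl h
  · exact absurd rfl h
  · rw [curvature_pair, Finsupp.sub_apply, Finsupp.single_apply, Finsupp.single_apply] at h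
    simp only [wordDeg_cons, wordDeg_nil]
    by_cases h1 : A.d x e = 0
    · by_cases h2 : A.d x' e = 0
      · simp [h1, h2] at h
      · have := hA.deg_d _ _ h2
        by_cases hxy : x = y
        · subst hxy
          omega
        · simp [h1, hxy] at h
    · have h3 := hA.deg_d _ _ h1
      by_cases hxy : x' = y
      · subst hxy
        omega
      · by_cases hxy' : x = y
        · subst hxy'
          by_cases h2 : A.d x' e = 0
          · simp [h2, hxy] at h
          · have := hA.deg_d _ _ h2
            omega
        · simp [hxy, hxy'] at h
  · exact absurd rfl h

/-- The two hypotheses say that `ℓ` is a cycle of the full complex `A`, the second accounting for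
the component in degree `0`. Its image in `R` vanishes for degree reasons, so exactness applies; the
homogeneous component of a preimage is taken with a minus sign because `m₁ = -d`. -/
lemma IsPreAInf.exists_lift (hA : A.IsFreeResolution) (he : A.IsUnital e) (hm : A.IsPreAInf m)
    {ℓ : A.Pos →₀ Q} {k : ℕ} (hk : ∀ y, ℓ y ≠ 0 → A.deg y = k)
    (h1 : pair ℓ (fun b => m [b]) = 0) (h2 : pair ℓ (fun b => A.d b e) = 0) :
    ∃ h : A.Pos →₀ Q, pair h (fun b => m [b]) = ℓ ∧ ∀ y, h y ≠ 0 → A.deg y = k + 1 := by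
  have hD : A.D (A.extend ℓ) = 0 := by
    ext x
    by_cases hx : A.deg x = 0
    · rw [he.unique x hx, ← pair_d_apply, h2]
      rfl
    · rw [hm.pair_singleton, neg_eq_zero] at h1
      exact DFunLike.congr_fun h1 ⟨x, Nat.pos_of_ne_zero hx⟩
  obtain ⟨z, hz⟩ := hA.exact _ hD
    (aug_eq_zero_of_deg hA.isComplex fun x hx => extend_apply_of_deg_eq_zero ℓ hx)
  refine ⟨-A.restrict (z.filter fun x => A.deg x = k + 1), ?_, fun y hy => ?_⟩
  · rw [hm.pair_singleton, map_neg, map_neg, D_extend_restrict hA.isComplex,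
      hA.isComplex.D_filter_deg, hz, map_neg, neg_neg]
    ext y
    rw [restrict_apply, Finsupp.filter_apply, extend_apply]
    split_ifs with hy
    · rfl
    · by_contra h
      exact hy (hk y (Ne.symm h))
  · by_contra h
    refine hy ?_
    rw [Finsupp.neg_apply, restrict_apply,
      Finsupp.filter_apply_neg (fun x => A.deg x = k + 1) _ h, neg_zero]

/-- The obstruction to satisfying the relation on the word `w` is a cycle. -/
lemma IsPreAInf.obstruction (hA : A.IsComplex) (he : A.deg e = 0) (hm : A.IsPreAInf m)
    {w : List A.Pos} (hw : 2 ≤ w.length)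
    (h1 : ∀ v, v.length < w.length → coder m m v = A.curvature e v)
    (h2 : ∀ v, v.length = w.length → A.wordDeg v < A.wordDeg w →
      coder m m v = A.curvature e v) :
    pair (A.curvature e w - coder m m w) (fun b => m [b]) = 0 ∧
      pair (A.curvature e w - coder m m w) (fun b => A.d b e) = 0 := by
  have hw0 : w ≠ [] := by rintro rfl; simp at hw
  constructor
  · have h3 := coder_coder hm.degree m w
    -- An inner operation on at least two letters shortens the word, and `m₁` lowers its degree;
    -- either way the relation is already known for the resulting word.
    have h4 : coder m (coder m m) w = coder m (A.curvature e) w := by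
      refine coder_congr fun u v z b huv hv hb => ?_
      have h5 := hm.degree v b hb
      have h6 := List.length_pos_of_ne_nil hv
      rcases Nat.lt_or_ge 1 v.length with h7 | h7
      · refine h1 _ ?_
        simp only [huv, List.length_append, List.length_cons]
        omega
      · refine h2 _ ?_ ?_
        · simp only [huv, List.length_append, List.length_cons]
          omega
        · simp only [huv, wordDeg_append, wordDeg_cons]
          omega
    -- Both sides differ from `d₁` of the first letter times `m` of the remaining word by the same
    -- term, the one that applies `d₁` to the last letter.
    have h5 : subwordSum (fun u v z => pair (A.curvature e v) fun b => m (u ++ b :: z)) w =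
        coder m (A.curvature e) w := by
      obtain ⟨x, w, rfl⟩ := List.exists_cons_of_ne_nil hw0
      have h6 := subwordSum_curvature_cons e m x w
      rw [← coder_curvature_cons e hA he hm.map_nil (hm.pair_dOne hA he) x w] at h6
      exact add_right_cancel h6
    -- On proper subwords the relation holds, so in the difference of the two squares only the full
    -- word survives, and it is followed by `m₁`.
    have h6 := subwordSum_eq_self (φ := fun u v z =>
      pair (A.curvature e v) (fun b => m (u ++ b :: z)) -
      pair (coder m m v) (fun b => m (u ++ b :: z))) hw0 (fun u v z _ hv _ => by
        rw [h1 v hv, sub_self])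
    rw [subwordSum_sub, h5, ← h3, h4, sub_self] at h6
    rw [pair_sub_left]
    exact h6.symm
  · have h3 : pair (coder m m w) (fun b => A.d b e) = 0 := by
      have := map_coder (m := m) (Finsupp.linearCombination Q fun b : A.Pos => A.d b e) m w
      refine this.symm.trans (coder_eq_zero fun u v z b _ _ _ => ?_)
      exact hm.pair_dOne hA he _
    rw [pair_sub_left, h3, sub_zero]
    rcases w with _ | ⟨x, _ | ⟨x', _ | ⟨z, w⟩⟩⟩
    · exact pair_zero_left _
    · exact pair_zero_left _
    · rw [curvature_pair, pair_sub_left, pair_single, pair_single, smul_eq_mul, smul_eq_mul,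
        mul_comm, sub_self]
    · exact pair_zero_left _

lemma coder_eq_self {Y : Type*} [AddCommGroup Y] [Module Q Y] {F : List A.Pos → Y}
    {w : List A.Pos} (h0 : m [] = 0) (h : ∀ v, v.length < w.length → m v = 0) :
    coder m F w = pair (m w) fun b => F [b] := by
  cases w with
  | nil => rw [h0, pair_zero_left, coder_nil]
  | cons x w =>
    rw [coder_cons, coder_eq_zero, smul_zero, add_zero, splitSum_eq_right]
    · intro v z hw hz
      rw [h, pair_zero_left]
      have := List.length_pos_of_ne_nil hz
      simp [← hw]
      omega
    · intro u v z b hw hv hb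
      refine absurd (DFunLike.congr_fun (h v ?_) b) hb
      simp [hw]
      omega

/-- The new operation on `N + 1` letters is corrected one degree at a time. A correction `h` in
degree `D` changes the relations of that degree by `m₁ ∘ h` alone, since `h` after an inner `m₁` is
evaluated below degree `D`. Relations in higher degrees may change, but they are treated later. -/
lemma IsPreAInf.exists_step (hA : A.IsFreeResolution) (he : A.IsUnital e) (hm : A.IsPreAInf m)
    {N D : ℕ} (hN : 1 ≤ N) (h1 : ∀ w, w.length ≤ N → coder m m w = A.curvature e w)
    (h2 : ∀ w, w.length = N + 1 → A.wordDeg w < D → coder m m w = A.curvature e w) :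
    ∃ m', A.IsPreAInf m' ∧ (∀ w, w.length ≤ N → m' w = m w) ∧
      (∀ w, w.length ≤ N → coder m' m' w = A.curvature e w) ∧
      ∀ w, w.length = N + 1 → A.wordDeg w < D + 1 → coder m' m' w = A.curvature e w := by
  have hex : ∀ w, ∃ h : A.Pos →₀ Q,
      (w.length = N + 1 → A.wordDeg w = D →
        pair h (fun b => m [b]) = A.curvature e w - coder m m w) ∧
      (¬ (w.length = N + 1 ∧ A.wordDeg w = D) → h = 0) ∧
      ∀ y, h y ≠ 0 → (A.deg y + 1) + 1 = A.wordDeg w := by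
    intro w
    by_cases hw : w.length = N + 1 ∧ A.wordDeg w = D
    · obtain ⟨hw1, hw2⟩ := hw
      obtain ⟨h3, h4⟩ := hm.obstruction hA.isComplex he.deg_eq (w := w) (by omega)
        (fun v hv => h1 v (by omega)) (fun v hv hv' => h2 v (by omega) (by omega))
      have h5 := two_mul_length_le_wordDeg w
      obtain ⟨h, h6, h7⟩ := hm.exists_lift hA he (k := A.wordDeg w - 3) (fun y hy => by
        have : A.deg y + 3 = A.wordDeg w := by
          by_contra hne
          rw [Finsupp.sub_apply, not_imp_comm.1 (curvature_degree hA.isComplex he.deg_eq) hne,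
            not_imp_comm.1 hm.degree.coder_degree hne, sub_zero] at hy
          exact hy rfl
        omega) h3 h4
      exact ⟨h, fun _ _ => h6, fun hn => absurd ⟨hw1, hw2⟩ hn, fun y hy => by
        have := h7 y hy
        omega⟩
    · exact ⟨0, fun h3 h4 => absurd ⟨h3, h4⟩ hw, fun _ => rfl, fun y hy => absurd rfl hy⟩
  choose h hh1 hh2 hh3 using hex
  have hzero : ∀ w b, h w b ≠ 0 → w.length = N + 1 ∧ A.wordDeg w = D := fun w b hb => by
    by_contra hn
    exact hb (by rw [hh2 w hn]; rfl)
  have hsmall : ∀ w, w.length ≤ N → h w = 0 := fun w hw => hh2 w (by omega)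
  have hagree : ∀ w : List A.Pos, w.length ≤ N → m w + h w = m w := fun w hw => by
    rw [hsmall w hw, add_zero]
  have hrel : ∀ w, w.length ≤ N + 1 → (w.length = N + 1 → A.wordDeg w ≤ D) →
      coder (fun u => m u + h u) (fun u => m u + h u) w =
        coder m m w + pair (h w) fun b => m [b] := by
    intro w hw hwD
    -- Of the cross terms, `h` after an inner operation vanishes on words of length at most `N` and
    -- on words of degree below `D`; the inner operation `h` contributes only when it consumes the
    -- whole word.
    rw [coder_add_left, coder_add]
    have h3 : coder m h w = 0 := by
      refine coder_eq_zero fun u v z b huv hv hb => ?_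
      refine hh2 _ ?_
      rintro ⟨h4, h5⟩
      have h6 := hm.degree v b hb
      have h7 := List.length_pos_of_ne_nil hv
      simp only [huv, wordDeg_append, wordDeg_cons, List.length_append, List.length_cons]
        at h4 h5 hw hwD
      have := hwD (by omega)
      omega
    rw [h3, add_zero, coder_eq_self (hsmall [] (by simp)) fun v hv => hsmall v (by omega)]
    congr 1
    refine pair_congr fun b _ => hagree [b] (by simpa using hN)
  refine ⟨fun w => m w + h w, ⟨?_, fun x => ?_, fun w y hy => ?_⟩, hagree, fun w hw => ?_,
    fun w hw hwD => ?_⟩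
  · rw [hagree [] (by simp), hm.map_nil]
  · rw [hagree [x] (by simpa using hN), hm.map_one]
  · by_cases hy' : m w y = 0
    · exact hh3 w y fun h0 => hy (by rw [Finsupp.add_apply, hy', h0, add_zero])
    · exact hm.degree w y hy'
  · rw [hrel w (by omega) (by omega), hsmall w hw, pair_zero_left, add_zero, h1 w hw]
  · rw [hrel w hw.le fun _ => by omega]
    rcases Nat.lt_or_ge (A.wordDeg w) D with hlt | hge
    · rw [hh2 w (by omega), pair_zero_left, add_zero, h2 w hw hlt]
    · rw [hh1 w hw (by omega)]
      abel

lemma wordDeg_le {d : ℕ} (hd : ∀ x, A.deg x ≤ d) (w : List A.Pos) :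
    A.wordDeg w ≤ w.length * (d + 1) := by
  induction w with
  | nil => simp
  | cons x w ih =>
    have := hd x
    rw [wordDeg_cons, List.length_cons, add_mul]
    omega

lemma IsAInfAlgebraUpTo.exists_succ (hA : A.IsFreeResolution) (he : A.IsUnital e) {d : ℕ}
    (hd : ∀ x, A.deg x ≤ d) {N : ℕ} (hm : A.IsAInfAlgebraUpTo e N m) :
    ∃ m', (∀ w, w.length ≤ N → m' w = m w) ∧ A.IsAInfAlgebraUpTo e (N + 1) m' := by
  obtain ⟨hpre, hrel⟩ := isAInfAlgebraUpTo_iff.1 hm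
  rcases Nat.eq_zero_or_pos N with rfl | hN
  -- For single letters the relation is `d² = 0`. This case is separate because `m₁` is prescribed
  -- and may not be corrected.
  · exact ⟨m, fun _ _ => rfl, isAInfAlgebraUpTo_iff.2
      ⟨hpre, fun w hw => hpre.coder_eq_of_length_le_one hA.isComplex hw⟩⟩
  have key : ∀ D, ∃ m', A.IsPreAInf m' ∧ (∀ w, w.length ≤ N → m' w = m w) ∧
      (∀ w, w.length ≤ N → coder m' m' w = A.curvature e w) ∧
      ∀ w, w.length = N + 1 → A.wordDeg w < D → coder m' m' w = A.curvature e w := by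
    intro D
    induction D with
    | zero => exact ⟨m, hpre, fun _ _ => rfl, hrel, fun w _ h => absurd h (Nat.not_lt_zero _)⟩
    | succ D ih =>
      obtain ⟨m₁, h1, h2, h3, h4⟩ := ih
      obtain ⟨m₂, h5, h6, h7, h8⟩ := h1.exists_step hA he hN h3 h4
      exact ⟨m₂, h5, fun w hw => (h6 w hw).trans (h2 w hw), h7, h8⟩
  -- All words of length `N + 1` have degree at most `(N + 1)(d + 1)`, so the corrections terminate.
  obtain ⟨m', h1, h2, h3, h4⟩ := key ((N + 1) * (d + 1) + 1)
  refine ⟨m', h2, isAInfAlgebraUpTo_iff.2 ⟨h1, fun w hw => ?_⟩⟩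
  rcases Nat.lt_or_ge N w.length with hlt | hge
  · have hw' : w.length = N + 1 := by omega
    refine h4 w hw' (Nat.lt_succ_of_le ?_)
    rw [← hw']
    exact wordDeg_le hd w
  · exact h3 w hge

/-- Both sides of the relation lower the degree by `2`. On more than `N` letters the value would
have shifted degree at least `2N ≥ d + 2`, beyond the top degree `d + 1` of `A₊[1]`. -/
lemma IsAInfAlgebraUpTo.isAInfAlgebra (hA : A.IsComplex) (he : A.deg e = 0) {d N : ℕ}
    (hd : ∀ x, A.deg x ≤ d) (hN : d + 2 ≤ 2 * N) (hm : A.IsAInfAlgebraUpTo e N m) :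
    A.IsAInfAlgebra e m := by
  obtain ⟨hpre, hrel⟩ := isAInfAlgebraUpTo_iff.1 hm
  refine isAInfAlgebra_iff.2 ⟨hpre, fun w => ?_⟩
  rcases Nat.lt_or_ge N w.length with hlt | hge
  · ext y
    have h1 := two_mul_length_le_wordDeg w
    have h2 := hd y
    have h3 : ¬ A.deg y + 3 = A.wordDeg w := by omega
    rw [not_imp_comm.1 hpre.degree.coder_degree h3, not_imp_comm.1 (curvature_degree hA he) h3]
  · exact hrel w hge

lemma finite_words [Finite A.ι] (n : ℕ) : {w : List A.Pos | w.length ≤ n}.Finite := by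
  exact List.finite_length_le _ _

lemma HasDegree.finite [Finite A.ι] (hm : A.HasDegree m) {d : ℕ}
    (hd : ∀ x, A.deg x ≤ d) : {w | m w ≠ 0}.Finite := by
  refine (finite_words (A := A) (d + 2)).subset fun w hw => ?_
  obtain ⟨y, hy⟩ := Finsupp.ne_iff.1 hw
  have h1 := hm w y hy
  have h2 := two_mul_length_le_wordDeg w
  have h3 := hd y
  change w.length ≤ d + 2
  omega

lemma exists_isAInfAlgebraUpTo_zero (hA : A.IsComplex) :
    ∃ m, A.IsAInfAlgebraUpTo e 0 m := by
  let m : List A.Pos → (A.Pos →₀ Q) := fun w => match w with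
    | [x] => -A.restrict (A.d x)
    | _ => 0
  refine ⟨m, isAInfAlgebraUpTo_iff.2 ⟨⟨rfl, fun x => rfl, fun w y hy => ?_⟩, fun w hw => ?_⟩⟩
  · rcases w with _ | ⟨x, _ | ⟨x', w⟩⟩
    · exact absurd rfl hy
    · have : A.d x y ≠ 0 := fun h => hy (by
        change (-A.restrict (A.d x)) y = 0
        rw [Finsupp.neg_apply, restrict_apply, h, neg_zero])
      have := hA.deg_d _ _ this
      simp only [wordDeg_cons, wordDeg_nil]
      omega
    · exact absurd rfl hy
  · rw [List.length_eq_zero_iff.1 (Nat.le_zero.1 hw)]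
    rfl

end Algebra

end FreeComplex

end

noncomputable section

open IsLocalRing

/-! ### A-infinity module structures by obstruction theory. -/

namespace FreeComplex

section Module

variable {Q R X : Type u} [CommRing Q] [CommRing R] [Algebra Q R] [AddCommGroup X] [Module Q X]
  {A : FreeComplex Q R} {e : A.ι} {m : List A.Pos → (A.Pos →₀ Q)} {G : FreeComplex Q X}
  {mG : List A.Pos → G.ι → (G.ι →₀ Q)}

/-- A family of maps of degree `-1` starting with the differential of `G`. -/
structure IsPreAInfModule (A : FreeComplex Q R) (G : FreeComplex Q X)
    (mG : List A.Pos → G.ι → (G.ι →₀ Q)) : Prop where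
  map_nil : ∀ c, mG [] c = G.d c
  degree : ∀ w c y, mG w c y ≠ 0 → G.deg y + 1 = A.wordDeg w + G.deg c

lemma isAInfModuleUpTo_iff {N : ℕ} : A.IsAInfModuleUpTo e m G N mG ↔
    A.IsPreAInfModule G mG ∧
      ∀ w c, w.length ≤ N → barDiff m mG mG w c = A.moduleCurvature e G w c := by
  constructor
  · rintro ⟨h1, h2, h3⟩
    refine ⟨⟨h1, h2⟩, fun w c hw => ?_⟩
    rw [← h3 w c hw, ← sum_eq_barDiff]
  · rintro ⟨⟨h1, h2⟩, h3⟩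
    refine ⟨h1, h2, fun w c hw => ?_⟩
    rw [← h3 w c hw, ← sum_eq_barDiff]

lemma isAInfModule_iff : A.IsAInfModule e m G mG ↔
    A.IsPreAInfModule G mG ∧
      ∀ w c, barDiff m mG mG w c = A.moduleCurvature e G w c := by
  constructor
  · intro h
    exact ⟨(isAInfModuleUpTo_iff.1 (h 0)).1,
      fun w c => (isAInfModuleUpTo_iff.1 (h _)).2 w c le_rfl⟩
  · exact fun h N => isAInfModuleUpTo_iff.2 ⟨h.1, fun w c _ => h.2 w c⟩

lemma moduleCurvature_eq (w : List A.Pos) (c : G.ι) :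
    A.moduleCurvature e G w c = A.dOne e w • Finsupp.single c 1 := by
  rcases w with _ | ⟨x, _ | ⟨y, w⟩⟩
  · exact (zero_smul _ _).symm
  · rw [dOne_singleton, Finsupp.smul_single, smul_eq_mul, mul_one]
    rfl
  · exact (zero_smul _ _).symm

lemma pair_moduleCurvature {Y : Type*} [AddCommGroup Y] [Module Q Y] (w : List A.Pos) (c : G.ι)
    (F : G.ι → Y) : pair (A.moduleCurvature e G w c) F = A.dOne e w • F c := by
  rw [moduleCurvature_eq, pair_smul_left, pair_single, one_smul]

/-- The square of the coderivation misses `d₁ ⊗ 1` by the term that removes the last letter. In the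
bar construction the curvature of the module supplies exactly this term. -/
lemma coder_coder_add (hm : A.IsAInfAlgebra e m) {Y : Type*} [AddCommGroup Y] [Module Q Y]
    (F : List A.Pos → Y) (x : A.Pos) (w : List A.Pos) :
    coder m (coder m F) (x :: w) + splitSum (fun u z => A.dOne e z • F u) (x :: w) =
      A.d x e • F w := by
  obtain ⟨hpre, hrel⟩ := isAInfAlgebra_iff.1 hm
  rw [coder_coder hpre.degree, ← subwordSum_curvature_cons]
  simp only [hrel]

/-- The square of the differential of the bar construction. -/
lemma barDiff_barDiff_cons (hm : A.IsAInfAlgebra e m) (hmG : A.IsAInfModule e m G mG)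
    {Y : Type*} [AddCommGroup Y] [Module Q Y] (F : List A.Pos → G.ι → Y) (x : A.Pos)
    (w : List A.Pos) (c : G.ι) :
    barDiff m mG (barDiff m mG F) (x :: w) c = A.d x e • F w c := by
  obtain ⟨hpre, hrel⟩ := isAInfModule_iff.1 hmG
  rw [barDiff_barDiff (isAInfAlgebra_iff.1 hm).1.degree, ← coder_coder_add hm (fun u => F u c) x w]
  simp only [hrel, pair_moduleCurvature]

lemma barDiff_barDiff_nil (hm : A.IsAInfAlgebra e m) (hmG : A.IsAInfModule e m G mG)
    {Y : Type*} [AddCommGroup Y] [Module Q Y] (F : List A.Pos → G.ι → Y) (c : G.ι) :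
    barDiff m mG (barDiff m mG F) [] c = 0 := by
  rw [barDiff_barDiff (isAInfAlgebra_iff.1 hm).1.degree, coder_nil, zero_add, splitSum_nil,
    (isAInfModule_iff.1 hmG).2]
  exact pair_zero_left _

lemma barDiff_moduleCurvature_cons (hA : A.IsComplex) (he : A.deg e = 0) (hm : A.IsPreAInf m)
    (x : A.Pos) (w : List A.Pos) (c : G.ι) :
    barDiff m mG (A.moduleCurvature e G) (x :: w) c = A.d x e • mG w c := by
  have h1 : coder m (fun u => A.moduleCurvature e G u c) (x :: w) = 0 := by
    have h2 : (fun u => A.moduleCurvature e G u c) = fun u =>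
        ((LinearMap.lsmul Q (G.ι →₀ Q)).flip (Finsupp.single c 1) ∘ₗ
          Finsupp.linearCombination Q fun b : A.Pos => A.d b e) (A.proj u) := by
      funext u
      rw [moduleCurvature_eq, dOne_eq]
      rfl
    rw [h2, map_coder, coder_proj _ hm.map_nil]
    have h3 : Finsupp.linearCombination Q (fun b : A.Pos => A.d b e) (m (x :: w)) = 0 :=
      hm.pair_dOne hA he (x :: w)
    rw [LinearMap.comp_apply, h3, map_zero]
  rw [barDiff, h1, zero_add, ← splitSum_dOne_smul e (fun v => mG v c)]
  refine splitSum_congr fun u v _ => ?_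
  rw [← sgn_smul_dOne e hA he u, smul_assoc]
  congr 1
  have h2 : A.moduleCurvature e G u = fun c' => LinearMap.lsmul Q (G.ι →₀ Q) (A.dOne e u)
      (Finsupp.single c' 1) := by
    funext c'
    rw [moduleCurvature_eq]
    rfl
  rw [h2, map_pair, LinearMap.lsmul_apply]
  congr 1
  rw [pair_def]
  simp

lemma IsPreAInfModule.pair_nil (h : A.IsPreAInfModule G mG) (ℓ : G.ι →₀ Q) :
    pair ℓ (mG []) = G.D ℓ := by
  rw [funext h.map_nil]
  rfl

lemma IsPreAInfModule.aug_eq_zero (hG : G.IsComplex) (h : A.IsPreAInfModule G mG)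
    (w : List A.Pos) (c : G.ι) : G.aug (mG w c) = 0 := by
  rcases w with _ | ⟨x, w⟩
  · rw [h.map_nil]
    have := hG.aug_D (Finsupp.single c 1)
    rwa [D_single, one_smul] at this
  · refine aug_eq_zero_of_deg hG fun y hy => ?_
    by_contra hne
    have h1 := h.degree _ _ _ hne
    have h2 := x.2
    rw [wordDeg_cons] at h1
    omega

/-- For `x` of degree `1`, the differential is `d₁(x) e` with `e ↦ 1 ∈ R`, so the vanishing of the
augmentation on boundaries puts `d₁(x)` in the kernel of `Q → R`. -/
lemma algebraMap_d_apply (hA : A.IsComplex) (he : A.IsUnital e) (x : A.Pos) :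
    algebraMap Q R (A.d x e) = 0 := by
  by_cases hx : A.deg x = 1
  · have h1 := hA.aug_D (Finsupp.single x 1)
    have h2 : A.d x = Finsupp.single e (A.d x e) := by
      ext y
      by_cases hy : A.d x y = 0
      · by_cases hye : e = y
        · subst hye
          rw [Finsupp.single_eq_same]
        · rw [hy, Finsupp.single_eq_of_ne' hye]
      · have := hA.deg_d _ _ hy
        rw [he.unique y (by omega), Finsupp.single_eq_same]
    rw [D_single, one_smul, h2, aug_single, he.aug_eq, Algebra.smul_def, mul_one] at h1
    exact h1
  · by_contra h
    have h1 : A.d x e ≠ 0 := fun h0 => h (by rw [h0, map_zero])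
    have h2 := hA.deg_d _ _ h1
    rw [he.deg_eq] at h2
    omega

/-- The place where the `R`-module structure of `X` enters: the kernel of `Q → R` annihilates `X`,
so the obstruction is in the kernel of the augmentation even in degree `0`. -/
lemma aug_moduleCurvature [Module R X] [IsScalarTower Q R X] (hA : A.IsComplex)
    (he : A.IsUnital e) (w : List A.Pos) (c : G.ι) :
    G.aug (A.moduleCurvature e G w c) = 0 := by
  rw [moduleCurvature_eq, map_smul]
  rcases w with _ | ⟨x, _ | ⟨y, w⟩⟩
  · exact zero_smul _ _
  · rw [dOne_singleton, ← algebraMap_smul R, algebraMap_d_apply hA he, zero_smul]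
  · exact zero_smul _ _

/-- The obstruction to satisfying the relation is a cycle. -/
lemma IsPreAInfModule.obstruction (hA : A.IsComplex) (he : A.deg e = 0)
    (hm : A.IsAInfAlgebra e m) (hG : A.IsPreAInfModule G mG) {w : List A.Pos} {c : G.ι}
    (hw : w ≠ [])
    (h1 : ∀ v c', v.length < w.length → barDiff m mG mG v c' = A.moduleCurvature e G v c')
    (h2 : ∀ v c', v.length = w.length → A.wordDeg v + G.deg c' < A.wordDeg w + G.deg c →
      barDiff m mG mG v c' = A.moduleCurvature e G v c') :
    G.D (A.moduleCurvature e G w c - barDiff m mG mG w c) = 0 := by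
  have hpre := (isAInfAlgebra_iff.1 hm).1
  -- Each first operation either shortens the word or lowers the total degree, so the relations for
  -- the resulting pairs are known.
  have h3 : barDiff m mG (barDiff m mG mG) w c = barDiff m mG (A.moduleCurvature e G) w c := by
    refine barDiff_congr (fun u v z b huv hv hb => ?_) fun u v c' huv hc' => ?_
    · have h5 := hpre.degree v b hb
      have h6 := List.length_pos_of_ne_nil hv
      rcases Nat.lt_or_ge 1 v.length with h7 | h7
      · refine h1 _ _ ?_
        simp only [huv, List.length_append, List.length_cons]
        omega
      · refine h2 _ _ ?_ ?_
        · simp only [huv, List.length_append, List.length_cons]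
          omega
        · simp only [huv, wordDeg_append, wordDeg_cons]
          omega
    · have h5 := hG.degree v c c' hc'
      rcases v with _ | ⟨x, v⟩
      · rw [List.append_nil] at huv
        subst huv
        refine h2 _ _ rfl ?_
        rw [wordDeg_nil] at h5
        omega
      · refine h1 _ _ ?_
        simp only [huv, List.length_append, List.length_cons]
        omega
  -- The relation holds on proper final segments of the word, so only the whole word contributes,
  -- and it is followed by `mG [] = d^G`.
  have h4 : splitSum (fun u v => pair (A.moduleCurvature e G v c - barDiff m mG mG v c) (mG u)) w =
      G.D (A.moduleCurvature e G w c - barDiff m mG mG w c) := by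
    rw [splitSum_eq_left, hG.pair_nil]
    intro u v huv hu
    rw [h1 v c (by
      have := List.length_pos_of_ne_nil hu
      simp only [← huv, List.length_append]
      omega), sub_self, pair_zero_left]
  rw [← h4]
  obtain ⟨x, w, rfl⟩ := List.exists_cons_of_ne_nil hw
  rw [barDiff_moduleCurvature_cons hA he hpre, barDiff_barDiff hpre.degree,
    ← coder_coder_add hm (fun u => mG u c)] at h3
  simp only [pair_sub_left, splitSum_sub, pair_moduleCurvature]
  rw [← add_left_cancel h3, sub_self]

lemma IsPreAInfModule.barDiff_degree (hm : A.HasDegree m) (hG : A.IsPreAInfModule G mG)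
    {w : List A.Pos} {c y : G.ι} (h : barDiff m mG mG w c y ≠ 0) :
    G.deg y + 2 = A.wordDeg w + G.deg c := by
  by_contra hy
  refine h ?_
  have h1 := map_barDiff (m := m) (mG := mG) (Finsupp.lapply (R := Q) y) mG w c
  rw [Finsupp.lapply_apply] at h1
  rw [← h1]
  refine barDiff_eq_zero (fun u v z b hw _ hb => ?_) fun u v c' hw hc' => ?_
  · by_contra hne
    have h2 := hm _ _ hb
    have h3 := hG.degree _ _ _ hne
    simp only [hw, wordDeg_append, wordDeg_cons] at hy h3
    omega
  · by_contra hne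
    have h2 := hG.degree _ _ _ hc'
    have h3 := hG.degree _ _ _ hne
    simp only [hw, wordDeg_append] at hy
    omega

lemma moduleCurvature_degree (hA : A.IsComplex) (he : A.deg e = 0) {w : List A.Pos} {c y : G.ι}
    (h : A.moduleCurvature e G w c y ≠ 0) : G.deg y + 2 = A.wordDeg w + G.deg c := by
  classical
  rw [moduleCurvature_eq, Finsupp.smul_apply, Finsupp.single_apply] at h
  rcases w with _ | ⟨x, _ | ⟨y, w⟩⟩
  · exact absurd (zero_smul _ _) h
  · by_cases hc : c = y
    · subst hc
      have h1 : A.d x e ≠ 0 := fun h0 => h (by rw [dOne_singleton, h0, zero_smul])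
      have := hA.deg_d _ _ h1
      simp only [wordDeg_cons, wordDeg_nil]
      omega
    · rw [if_neg hc, smul_zero] at h
      exact absurd rfl h
  · exact absurd (zero_smul _ _) h

/-- Corrections proceed by total degree `D`: an inner `m₁` or `d^G` lowers it, so adding `h` in
degree `D` changes the relations of that degree only by `d^G ∘ h`. -/
lemma IsPreAInfModule.exists_step [Module R X] [IsScalarTower Q R X] (hA : A.IsComplex)
    (he : A.IsUnital e) (hm : A.IsAInfAlgebra e m) (hG : G.IsFreeResolution)
    (hpG : A.IsPreAInfModule G mG) {N D : ℕ}
    (h1 : ∀ w c, w.length ≤ N → barDiff m mG mG w c = A.moduleCurvature e G w c)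
    (h2 : ∀ w c, w.length = N + 1 → A.wordDeg w + G.deg c < D →
      barDiff m mG mG w c = A.moduleCurvature e G w c) :
    ∃ mG', A.IsPreAInfModule G mG' ∧ (∀ w, w.length ≤ N → mG' w = mG w) ∧
      (∀ w c, w.length ≤ N → barDiff m mG' mG' w c = A.moduleCurvature e G w c) ∧
      ∀ w c, w.length = N + 1 → A.wordDeg w + G.deg c < D + 1 →
        barDiff m mG' mG' w c = A.moduleCurvature e G w c := by
  have hpre := (isAInfAlgebra_iff.1 hm).1
  have hex : ∀ w c, ∃ h : G.ι →₀ Q,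
      (w.length = N + 1 → A.wordDeg w + G.deg c = D →
        G.D h = A.moduleCurvature e G w c - barDiff m mG mG w c) ∧
      (¬ (w.length = N + 1 ∧ A.wordDeg w + G.deg c = D) → h = 0) ∧
      ∀ y, h y ≠ 0 → G.deg y + 1 = A.wordDeg w + G.deg c := by
    intro w c
    by_cases hw : w.length = N + 1 ∧ A.wordDeg w + G.deg c = D
    · obtain ⟨hw1, hw2⟩ := hw
      have h3 := hpG.obstruction hA he.deg_eq hm (w := w) (c := c)
        (by rintro rfl; simp at hw1)
        (fun v c' hv => h1 v c' (by omega)) (fun v c' hv hv' => h2 v c' (by omega) (by omega))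
      have h4 : G.aug (A.moduleCurvature e G w c - barDiff m mG mG w c) = 0 := by
        rw [map_sub, aug_moduleCurvature hA he, ← map_barDiff]
        rw [barDiff_eq_zero (fun u v z b _ _ _ => hpG.aug_eq_zero hG.isComplex _ _)
          fun u v c' _ _ => hpG.aug_eq_zero hG.isComplex _ _, sub_zero]
      obtain ⟨z, hz⟩ := hG.exact _ h3 h4
      have h5 := two_mul_length_le_wordDeg w
      -- The truncated subtraction is honest: the word is nonempty, so its degree is at least `2`.
      -- Passing to this component keeps the equation because the obstruction is homogeneous.
      refine ⟨z.filter fun x => G.deg x = A.wordDeg w + G.deg c - 2 + 1, fun _ _ => ?_,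
        fun hn => absurd ⟨hw1, hw2⟩ hn, fun y hy => ?_⟩
      · rw [hG.isComplex.D_filter_deg, hz]
        ext y
        rw [Finsupp.filter_apply]
        split_ifs with hy
        · rfl
        · have hne : ¬ G.deg y + 2 = A.wordDeg w + G.deg c := by omega
          rw [Finsupp.sub_apply, not_imp_comm.1 (moduleCurvature_degree hA he.deg_eq) hne,
            not_imp_comm.1 (hpG.barDiff_degree hpre.degree) hne, sub_zero]
      · have : G.deg y = A.wordDeg w + G.deg c - 2 + 1 := by
          by_contra hne
          exact hy (Finsupp.filter_apply_neg _ _ hne)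
        omega
    · exact ⟨0, fun h3 h4 => absurd ⟨h3, h4⟩ hw, fun _ => rfl, fun y hy => absurd rfl hy⟩
  choose h hh1 hh2 hh3 using hex
  have hsmall : ∀ w c, w.length ≤ N → h w c = 0 := fun w c hw => hh2 w c (by omega)
  have hagree : ∀ w, w.length ≤ N → (fun c => mG w c + h w c) = mG w := fun w hw => by
    funext c
    rw [hsmall w c hw, add_zero]
  have hrel : ∀ w c, w.length ≤ N + 1 → (w.length = N + 1 → A.wordDeg w + G.deg c ≤ D) →
      barDiff m (fun w c => mG w c + h w c) (fun w c => mG w c + h w c) w c =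
        barDiff m mG mG w c + G.D (h w c) := by
    intro w c hw hwD
    have h3 : barDiff m mG h w c = 0 := by
      refine barDiff_eq_zero (fun u v z b huv hv hb => ?_) fun u v c' huv hc' => ?_
      · refine hh2 _ _ ?_
        rintro ⟨h4, h5⟩
        have h6 := hpre.degree v b hb
        have h7 := List.length_pos_of_ne_nil hv
        simp only [huv, wordDeg_append, wordDeg_cons, List.length_append, List.length_cons]
          at h4 h5 hw hwD
        have := hwD (by omega)
        omega
      · refine hh2 _ _ ?_
        rintro ⟨h4, h5⟩
        have h6 := hpG.degree v c c' hc'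
        simp only [huv, wordDeg_append, List.length_append] at hw hwD
        have h7 := hwD (by omega)
        omega
    have h4 : splitSum (fun u v => A.sgn u • pair (h v c) fun c' => mG u c' + h u c') w =
        G.D (h w c) := by
      rw [splitSum_eq_left, sgn_nil, one_smul, hagree [] (by simp), hpG.pair_nil]
      intro u v huv hu
      rw [hsmall v c, pair_zero_left, smul_zero]
      have := List.length_pos_of_ne_nil hu
      simp only [← huv, List.length_append] at hw
      omega
    have h5 : barDiff m (fun w c => mG w c + h w c) (fun w c => mG w c + h w c) w c =
        barDiff m mG mG w c + barDiff m mG h w c +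
          splitSum (fun u v => A.sgn u • pair (h v c) fun c' => mG u c' + h u c') w := by
      simp only [barDiff, pair_add_left, smul_add, splitSum_add]
      rw [coder_add]
      simp only [pair_add_right, smul_add, splitSum_add]
      abel
    rw [h5, h3, h4, add_zero]
  refine ⟨fun w c => mG w c + h w c, ⟨fun c => ?_, fun w c y hy => ?_⟩, hagree, fun w c hw => ?_,
    fun w c hw hwD => ?_⟩
  · exact (congrFun (hagree [] (by simp)) c).trans (hpG.map_nil c)
  · by_cases hy' : mG w c y = 0
    · exact hh3 w c y fun h0 => hy (by rw [Finsupp.add_apply, hy', h0, add_zero])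
    · exact hpG.degree w c y hy'
  · rw [hrel w c (by omega) (by omega), hsmall w c hw, map_zero, add_zero, h1 w c hw]
  · rw [hrel w c hw.le fun _ => by omega]
    rcases Nat.lt_or_ge (A.wordDeg w + G.deg c) D with hlt | hge
    · rw [hh2 w c (by omega), map_zero, add_zero, h2 w c hw hlt]
    · rw [hh1 w c hw (by omega)]
      abel

lemma IsAInfModuleUpTo.exists_succ [Module R X] [IsScalarTower Q R X] (hA : A.IsComplex)
    (he : A.IsUnital e) (hm : A.IsAInfAlgebra e m) (hG : G.IsFreeResolution) {d : ℕ}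
    (hd : ∀ x, A.deg x ≤ d) {d' : ℕ} (hd' : ∀ x, G.deg x ≤ d') {N : ℕ}
    (hmG : A.IsAInfModuleUpTo e m G N mG) :
    ∃ mG', (∀ w, w.length ≤ N → mG' w = mG w) ∧ A.IsAInfModuleUpTo e m G (N + 1) mG' := by
  obtain ⟨hpG, hrel⟩ := isAInfModuleUpTo_iff.1 hmG
  have key : ∀ D, ∃ mG', A.IsPreAInfModule G mG' ∧ (∀ w, w.length ≤ N → mG' w = mG w) ∧
      (∀ w c, w.length ≤ N → barDiff m mG' mG' w c = A.moduleCurvature e G w c) ∧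
      ∀ w c, w.length = N + 1 → A.wordDeg w + G.deg c < D →
        barDiff m mG' mG' w c = A.moduleCurvature e G w c := by
    intro D
    induction D with
    | zero => exact ⟨mG, hpG, fun _ _ => rfl, hrel, fun w _ _ h => absurd h (Nat.not_lt_zero _)⟩
    | succ D ih =>
      obtain ⟨m₁, h1, h2, h3, h4⟩ := ih
      obtain ⟨m₂, h5, h6, h7, h8⟩ := h1.exists_step hA he hm hG h3 h4
      exact ⟨m₂, h5, fun w hw => (h6 w hw).trans (h2 w hw), h7, h8⟩
  obtain ⟨mG', h1, h2, h3, h4⟩ := key ((N + 1) * (d + 1) + d' + 1)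
  refine ⟨mG', h2, isAInfModuleUpTo_iff.2 ⟨h1, fun w c hw => ?_⟩⟩
  rcases Nat.lt_or_ge N w.length with hlt | hge
  · have hw' : w.length = N + 1 := by omega
    refine h4 w c hw' (Nat.lt_succ_of_le ?_)
    rw [← hw']
    exact add_le_add (wordDeg_le hd w) (hd' c)
  · exact h3 w c hge

/-- On more than `N` letters both sides would take values in degree at least `2N ≥ d + 2`, where `G`
vanishes. -/
lemma IsAInfModuleUpTo.isAInfModule (hA : A.IsComplex) (he : A.deg e = 0)
    (hm : A.IsAInfAlgebra e m) {d N : ℕ} (hd : ∀ x, G.deg x ≤ d) (hN : d + 2 ≤ 2 * N)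
    (hmG : A.IsAInfModuleUpTo e m G N mG) : A.IsAInfModule e m G mG := by
  obtain ⟨hpG, hrel⟩ := isAInfModuleUpTo_iff.1 hmG
  refine isAInfModule_iff.2 ⟨hpG, fun w c => ?_⟩
  rcases Nat.lt_or_ge N w.length with hlt | hge
  · ext y
    have h1 := two_mul_length_le_wordDeg w
    have h2 := hd y
    have h3 : ¬ G.deg y + 2 = A.wordDeg w + G.deg c := by omega
    rw [not_imp_comm.1 (hpG.barDiff_degree (isAInfAlgebra_iff.1 hm).1.degree) h3,
      not_imp_comm.1 (moduleCurvature_degree hA he) h3]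
  · exact hrel w c hge

lemma IsPreAInfModule.finite [Finite A.ι] [Finite G.ι] (hpG : A.IsPreAInfModule G mG) {d : ℕ}
    (hd : ∀ x, G.deg x ≤ d) : {p : List A.Pos × G.ι | mG p.1 p.2 ≠ 0}.Finite := by
  refine ((finite_words (A := A) (d + 1)).prod Set.finite_univ).subset fun p hp => ?_
  obtain ⟨y, hy⟩ := Finsupp.ne_iff.1 hp
  have h1 := hpG.degree p.1 p.2 y hy
  have h2 := two_mul_length_le_wordDeg p.1
  have h3 := hd y
  refine ⟨?_, trivial⟩
  change p.1.length ≤ d + 1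
  omega

lemma exists_isAInfModuleUpTo_zero (hG : G.IsComplex) :
    ∃ mG, A.IsAInfModuleUpTo e m G 0 mG := by
  let mG : List A.Pos → G.ι → (G.ι →₀ Q) := fun w c => match w with
    | [] => G.d c
    | _ => 0
  have hpG : A.IsPreAInfModule G mG := ⟨fun c => rfl, fun w c y hy => by
    rcases w with _ | ⟨x, w⟩
    · have := hG.deg_d _ _ hy
      rw [wordDeg_nil]
      omega
    · exact absurd rfl hy⟩
  refine ⟨mG, isAInfModuleUpTo_iff.2 ⟨hpG, fun w c hw => ?_⟩⟩
  rw [List.length_eq_zero_iff.1 (Nat.le_zero.1 hw), barDiff_nil, hpG.pair_nil]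
  have := hG.D_D (Finsupp.single c 1)
  rwa [D_single, one_smul] at this

end Module

end FreeComplex

end

noncomputable section

open IsLocalRing

/-! ### Exactness of the bar resolution. -/

namespace FreeComplex

section Bar

variable {Q R X : Type u} [CommRing Q] [CommRing R] [Algebra Q R] [AddCommGroup X] [Module Q X]
  {A : FreeComplex Q R} {e : A.ι} {m : List A.Pos → (A.Pos →₀ Q)}
  {G : FreeComplex Q X} {mG : List A.Pos → G.ι → (G.ι →₀ Q)}

/-- The degree of a basis element of the bar construction. -/
def barDeg (A : FreeComplex Q R) (G : FreeComplex Q X) (p : List A.Pos × G.ι) : ℕ :=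
  A.wordDeg p.1 + G.deg p.2

/-- The differential of the bar construction over `Q`, which does not square to zero. -/
def preBar (m : List A.Pos → (A.Pos →₀ Q)) (mG : List A.Pos → G.ι → (G.ι →₀ Q)) :
    (List A.Pos × G.ι →₀ Q) →ₗ[Q] (List A.Pos × G.ι →₀ Q) :=
  Finsupp.linearCombination Q fun p =>
    barDiff m mG (fun u c => Finsupp.single (u, c) (1 : Q)) p.1 p.2

lemma map_preBar_single {Y : Type*} [AddCommGroup Y] [Module Q Y]
    (f : (List A.Pos × G.ι →₀ Q) →ₗ[Q] Y) (w : List A.Pos) (c : G.ι) :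
    f (preBar m mG (Finsupp.single (w, c) 1)) =
      barDiff m mG (fun u c' => f (Finsupp.single (u, c') 1)) w c := by
  rw [map_barDiff, preBar, Finsupp.linearCombination_single, one_smul]

lemma preBar_single_apply (p : List A.Pos × G.ι) (w : List A.Pos) (c : G.ι) :
    preBar m mG (Finsupp.single (w, c) 1) p =
      barDiff m mG (fun u c' => (Finsupp.single (u, c') 1 : List A.Pos × G.ι →₀ Q) p) w c :=
  map_preBar_single (Finsupp.lapply p) w c

lemma preBar_apply (v : List A.Pos × G.ι →₀ Q) (p : List A.Pos × G.ι) :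
    preBar m mG v p = v.sum fun q a => a * preBar m mG (Finsupp.single q 1) p := by
  conv_lhs => rw [preBar, Finsupp.linearCombination_apply, Finsupp.sum_apply]
  refine Finsupp.sum_congr fun q _ => ?_
  rw [preBar, Finsupp.linearCombination_single, one_smul, Finsupp.smul_apply, smul_eq_mul]

lemma preBar_single_degree (hm : A.HasDegree m) (hG : A.IsPreAInfModule G mG)
    {p q : List A.Pos × G.ι} (h : preBar m mG (Finsupp.single p 1) q ≠ 0) :
    A.barDeg G p = A.barDeg G q + 1 := by
  obtain ⟨w, c⟩ := p
  by_contra hne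
  refine h ?_
  rw [preBar_single_apply]
  refine barDiff_eq_zero (fun u v z b hw _ hb => ?_) fun u v c' hw hc' => ?_
  · refine Finsupp.single_eq_of_ne' fun hq => ?_
    have := hm v b hb
    subst hq
    simp only [barDeg, hw, wordDeg_append, wordDeg_cons] at hne
    omega
  · refine Finsupp.single_eq_of_ne' fun hq => ?_
    have := hG.degree v c c' hc'
    subst hq
    simp only [barDeg, hw, wordDeg_append] at hne
    omega

lemma preBar_apply_eq_zero (hm : A.HasDegree m) (hG : A.IsPreAInfModule G mG)
    {v : List A.Pos × G.ι →₀ Q} {q : List A.Pos × G.ι}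
    (h : ∀ p, A.barDeg G p = A.barDeg G q + 1 → v p = 0) : preBar m mG v q = 0 := by
  rw [preBar_apply]
  refine Finset.sum_eq_zero fun p _ => ?_
  by_cases hp : preBar m mG (Finsupp.single p 1) q = 0
  · exact (congrArg (v p * ·) hp).trans (mul_zero _)
  · exact (congrArg (· * _) (h p (preBar_single_degree hm hG hp))).trans (zero_mul _)

lemma preBar_single_nil_apply (c : G.ι) (y : A.Pos) (u : List A.Pos) (c' : G.ι) :
    preBar m mG (Finsupp.single ([], c) 1) (y :: u, c') = 0 := by
  rw [preBar_single_apply, barDiff_nil]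
  exact pair_eq_zero fun b _ => Finsupp.single_eq_of_ne' fun h => by simp at h

lemma preBar_apply_cons_eq_zero {v : List A.Pos × G.ι →₀ Q} (hv : ∀ x w c, v (x :: w, c) = 0)
    (y : A.Pos) (u : List A.Pos) (c' : G.ι) : preBar m mG v (y :: u, c') = 0 := by
  rw [preBar_apply]
  refine Finset.sum_eq_zero ?_
  rintro ⟨_ | ⟨x, w⟩, c⟩ _
  · exact (congrArg _ (preBar_single_nil_apply _ _ _ _)).trans (mul_zero _)
  · exact (congrArg (· * _) (hv x w c)).trans (zero_mul _)

/-- Operations behind the first letter lower the degree of the tail, and an operation that absorbs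
further letters shortens the tail. Only `m₁` on the first letter keeps the tail. -/
lemma preBar_single_cons_apply [DecidableEq (List A.Pos × G.ι)] (hm : A.HasDegree m)
    (hG : A.IsPreAInfModule G mG) (x y : A.Pos) (w u : List A.Pos) (c c' : G.ι)
    (h : A.barDeg G (w, c) ≤ A.barDeg G (u, c')) :
    preBar m mG (Finsupp.single (x :: w, c) 1) (y :: u, c') =
      if (w, c) = (u, c') then m [x] y else 0 := by
  rw [preBar_single_apply, barDiff_cons, splitSum_eq_left]
  · have h1 : ∀ d : G.ι, (Finsupp.single ([], d) 1 : List A.Pos × G.ι →₀ Q) (y :: u, c') = 0 :=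
      fun d => Finsupp.single_eq_of_ne' fun h => by simp at h
    have h2 : barDiff m mG (fun u₁ c₁ => (Finsupp.single (x :: u₁, c₁) 1 :
        List A.Pos × G.ι →₀ Q) (y :: u, c')) w c = 0 := by
      refine barDiff_eq_zero (fun u₁ v z b hw _ hb => ?_) fun u₁ v c₁ hw hc' => ?_
      · refine Finsupp.single_eq_of_ne' fun hq => ?_
        simp only [Prod.mk.injEq, List.cons.injEq] at hq
        have := hm v b hb
        rw [← hq.1.2, ← hq.2] at h
        simp only [barDeg, hw, wordDeg_append, wordDeg_cons] at h
        omega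
      · refine Finsupp.single_eq_of_ne' fun hq => ?_
        simp only [Prod.mk.injEq, List.cons.injEq] at hq
        have := hG.degree v c c₁ hc'
        rw [← hq.1.2, ← hq.2] at h
        simp only [barDeg, hw, wordDeg_append] at h
        omega
    rw [pair_eq_zero (fun d _ => h1 d), h2, smul_zero, add_zero, add_zero]
    split_ifs with hwu
    · simp only [Prod.mk.injEq] at hwu
      obtain ⟨rfl, rfl⟩ := hwu
      rw [pair_def, Finsupp.sum_eq_single y]
      · simp
      · intro b _ hb
        rw [Finsupp.single_eq_of_ne' fun h => hb (by simpa using h), smul_zero]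
      · intro _
        exact zero_smul _ _
    · exact pair_eq_zero fun b _ => Finsupp.single_eq_of_ne' fun h => hwu (by simp_all)
  · intro v z hvz hv
    refine pair_eq_zero fun b _ => Finsupp.single_eq_of_ne' fun hq => ?_
    simp only [Prod.mk.injEq, List.cons.injEq] at hq
    rw [← hq.1.2, ← hq.2] at h
    obtain ⟨a, v, rfl⟩ := List.exists_cons_of_ne_nil hv
    simp only [barDeg, ← hvz, wordDeg_append, wordDeg_cons] at h
    omega

/-- The coefficients of the words `x :: u` in an element of the bar construction. -/
def firstLetter (u : List A.Pos) (c : G.ι) :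
    (List A.Pos × G.ι →₀ Q) →ₗ[Q] (A.Pos →₀ Q) :=
  Finsupp.lcomapDomain (fun x : A.Pos => (x :: u, c)) (fun x y h => by simpa using h)

@[simp] lemma firstLetter_apply (u : List A.Pos) (c : G.ι) (v : List A.Pos × G.ι →₀ Q)
    (x : A.Pos) : firstLetter u c v x = v (x :: u, c) := rfl

lemma firstLetter_single_nil (u : List A.Pos) (c c' : G.ι) (a : Q) :
    firstLetter u c (Finsupp.single ([], c') a) = 0 := by
  ext x
  rw [firstLetter_apply]
  exact Finsupp.single_eq_of_ne' fun h => by simp at h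

lemma firstLetter_single_cons [DecidableEq (List A.Pos × G.ι)] (x : A.Pos) (w u : List A.Pos)
    (c c' : G.ι) (a : Q) : firstLetter u c' (Finsupp.single (x :: w, c) a) =
      if (w, c) = (u, c') then Finsupp.single x a else 0 := by
  classical
  ext y
  rw [firstLetter_apply]
  split_ifs with h
  · simp only [Prod.mk.injEq] at h
    obtain ⟨rfl, rfl⟩ := h
    simp [Finsupp.single_apply]
  · exact Finsupp.single_eq_of_ne' fun h' => h (by simp_all)

/-- Leading term: where the tail has maximal degree, the bar differential acts as `m₁` on the first
letter. -/
lemma preBar_apply_cons (hm : A.HasDegree m) (hG : A.IsPreAInfModule G mG)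
    {v : List A.Pos × G.ι →₀ Q} {u : List A.Pos} {c : G.ι}
    (hv : ∀ x w c', A.barDeg G (u, c) < A.barDeg G (w, c') → v (x :: w, c') = 0) (y : A.Pos) :
    preBar m mG v (y :: u, c) = pair (firstLetter u c v) (fun b => m [b]) y := by
  classical
  have h1 : pair (firstLetter u c v) (fun b => m [b]) = v.sum fun q a => a •
      pair (firstLetter u c (Finsupp.single q 1)) (fun b => m [b]) := by
    conv_lhs => rw [← Finsupp.sum_single v, map_finsuppSum]
    refine (map_finsuppSum (Finsupp.linearCombination Q fun b : A.Pos => m [b]) _ _).trans ?_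
    refine Finsupp.sum_congr fun q _ => ?_
    rw [← mul_one (v q), ← smul_eq_mul, ← Finsupp.smul_single, map_smul, smul_eq_mul, mul_one]
    exact map_smul _ _ _
  rw [h1, Finsupp.sum_apply, preBar_apply]
  refine Finsupp.sum_congr ?_
  rintro ⟨_ | ⟨x, w⟩, c'⟩ _
  · rw [preBar_single_nil_apply, firstLetter_single_nil, pair_zero_left, smul_zero, mul_zero]
    rfl
  · rcases Nat.lt_or_ge (A.barDeg G (u, c)) (A.barDeg G (w, c')) with hlt | hge
    · rw [hv x w c' hlt, zero_mul, zero_smul]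
      rfl
    · rw [preBar_single_cons_apply hm hG _ _ _ _ _ _ hge, firstLetter_single_cons,
        Finsupp.smul_apply, smul_eq_mul]
      split_ifs
      · rw [pair_single, one_smul]
      · rw [pair_zero_left]
        rfl

/-- The square of `preBar`. -/
def barCurv (A : FreeComplex Q R) (e : A.ι) (G : FreeComplex Q X) :
    (List A.Pos × G.ι →₀ Q) →ₗ[Q] (List A.Pos × G.ι →₀ Q) :=
  Finsupp.linearCombination Q fun p => match p with
    | ([], _) => 0
    | (x :: w, c) => Finsupp.single (w, c) (A.d x e)

lemma preBar_preBar (hm : A.IsAInfAlgebra e m) (hmG : A.IsAInfModule e m G mG)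
    (v : List A.Pos × G.ι →₀ Q) : preBar m mG (preBar m mG v) = A.barCurv e G v := by
  have h1 : ∀ p, preBar m mG (preBar m mG (Finsupp.single p 1)) =
      A.barCurv e G (Finsupp.single p 1) := by
    rintro ⟨w, c⟩
    rw [map_preBar_single]
    have h2 : (fun u c' => preBar m mG (Finsupp.single (u, c') 1)) =
        barDiff m mG (fun u c => Finsupp.single (u, c) (1 : Q)) := by
      funext u c'
      rw [preBar, Finsupp.linearCombination_single, one_smul]
    rw [h2, barCurv, Finsupp.linearCombination_single, one_smul]
    rcases w with _ | ⟨x, w⟩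
    · exact barDiff_barDiff_nil hm hmG _ c
    · rw [barDiff_barDiff_cons hm hmG, Finsupp.smul_single, smul_eq_mul, mul_one]
  induction v using Finsupp.induction_linear with
  | zero => simp
  | add f g hf hg => rw [map_add, map_add, hf, hg, map_add]
  | single p a =>
    rw [← mul_one a, ← smul_eq_mul, ← Finsupp.smul_single, map_smul, map_smul, map_smul, h1]

lemma barCurv_apply (v : List A.Pos × G.ι →₀ Q) (u : List A.Pos) (c : G.ι) :
    A.barCurv e G v (u, c) = pair (firstLetter u c v) fun b => A.d b e := by
  classical
  induction v using Finsupp.induction_linear with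
  | zero => simp
  | add f g hf hg => rw [map_add, Finsupp.add_apply, hf, hg, map_add, pair_add_left]
  | single p a =>
    rw [barCurv, Finsupp.linearCombination_single]
    obtain ⟨_ | ⟨x, w⟩, c'⟩ := p
    · rw [firstLetter_single_nil, pair_zero_left, smul_zero]
      rfl
    · rw [firstLetter_single_cons, Finsupp.smul_apply, Finsupp.single_apply]
      split_ifs
      · rw [pair_single]
      · rw [pair_zero_left, smul_zero]

lemma barCurv_congr {v v' : List A.Pos × G.ι →₀ Q} (h : ∀ x w c, v (x :: w, c) = v' (x :: w, c)) :
    A.barCurv e G v = A.barCurv e G v' := by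
  ext ⟨u, c⟩
  rw [barCurv_apply, barCurv_apply]
  congr 1
  ext x
  exact h x u c

lemma preBar_apply_cons_congr {v v' : List A.Pos × G.ι →₀ Q}
    (h : ∀ x w c, v (x :: w, c) = v' (x :: w, c)) (y : A.Pos) (u : List A.Pos) (c' : G.ι) :
    preBar m mG v (y :: u, c') = preBar m mG v' (y :: u, c') := by
  rw [← sub_eq_zero, ← Finsupp.sub_apply, ← map_sub]
  refine preBar_apply_cons_eq_zero (fun x w c => ?_) y u c'
  rw [Finsupp.sub_apply, h, sub_self]

lemma algebraMap_barCurv_apply (hA : A.IsComplex) (he : A.IsUnital e)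
    (v : List A.Pos × G.ι →₀ Q) (p : List A.Pos × G.ι) :
    algebraMap Q R (A.barCurv e G v p) = 0 := by
  obtain ⟨u, c⟩ := p
  rw [barCurv_apply, pair_def, map_finsuppSum]
  refine Finset.sum_eq_zero fun x _ => ?_
  dsimp only
  rw [smul_eq_mul, map_mul, algebraMap_d_apply hA he, mul_zero]

/-- Here `a` is a component in `A₀` and `ℓ` one in `A₊`; together they form a cycle of the augmented
complex `A → R`, because `a` dies in `R`. Thus exactness in degree `0` is used along with that in
positive degrees. -/
lemma exists_firstLetter_lift (hA : A.IsFreeResolution) (he : A.IsUnital e) (hm : A.IsPreAInf m)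
    {a : Q} {ℓ : A.Pos →₀ Q} (ha : algebraMap Q R a = 0) (h1 : pair ℓ (fun b => m [b]) = 0)
    (h2 : pair ℓ (fun b => A.d b e) = 0) :
    ∃ h : A.Pos →₀ Q, pair h (fun b => m [b]) = -ℓ ∧ pair h (fun b => A.d b e) = -a := by
  have hD : A.D (A.extend ℓ - Finsupp.single e a) = 0 := by
    have h3 : A.D (Finsupp.single e a) = 0 :=
      hA.isComplex.D_eq_zero (Finsupp.single_mem_supported Q a he.deg_eq)
    rw [map_sub, h3, sub_zero]
    ext x
    by_cases hx : A.deg x = 0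
    · rw [he.unique x hx, ← pair_d_apply, h2]
      rfl
    · rw [hm.pair_singleton, neg_eq_zero] at h1
      exact DFunLike.congr_fun h1 ⟨x, Nat.pos_of_ne_zero hx⟩
  have haug : A.aug (A.extend ℓ - Finsupp.single e a) = 0 := by
    rw [map_sub, aug_single, he.aug_eq, Algebra.smul_def, ha, zero_mul, sub_zero]
    exact aug_eq_zero_of_deg hA.isComplex fun x hx => extend_apply_of_deg_eq_zero ℓ hx
  obtain ⟨z, hz⟩ := hA.exact _ hD haug
  have hne : ∀ b : A.Pos, e ≠ b := fun b hb => b.2.ne' (hb ▸ he.deg_eq)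
  refine ⟨A.restrict z, ?_, ?_⟩
  · rw [hm.pair_singleton, D_extend_restrict hA.isComplex, hz]
    congr 1
    ext b
    rw [restrict_apply, Finsupp.sub_apply, Finsupp.single_eq_of_ne' (hne b), sub_zero,
      extend_apply]
  · rw [pair_d_apply, D_extend_restrict hA.isComplex, hz, Finsupp.sub_apply,
      Finsupp.single_eq_same, extend_apply_of_deg_eq_zero ℓ he.deg_eq, zero_sub]

/-- The acyclicity statement behind the exactness of the bar resolution. -/
lemma exists_barCurv_eq [Finite A.ι] [Finite G.ι] (hA : A.IsFreeResolution) (he : A.IsUnital e)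
    (hm : A.IsAInfAlgebra e m) (hmG : A.IsAInfModule e m G mG) (r : ℕ)
    (a v : List A.Pos × G.ι →₀ Q) (ha : ∀ p, algebraMap Q R (a p) = 0)
    (h1 : preBar m mG a = A.barCurv e G v)
    (h2 : ∀ x u c, a (x :: u, c) = preBar m mG v (x :: u, c))
    (hra : ∀ p, r ≤ A.barDeg G p → a p = 0)
    (hrv : ∀ x u c, r ≤ A.barDeg G (u, c) → v (x :: u, c) = 0) :
    ∃ v', a = -A.barCurv e G v' ∧ ∀ x u c, v (x :: u, c) = -preBar m mG v' (x :: u, c) := by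
  classical
  have hpre := (isAInfAlgebra_iff.1 hm).1
  have hpG := (isAInfModule_iff.1 hmG).1
  -- View `a` as having coefficients in `A₀` and the words `x :: u` of `v` as having coefficients
  -- `x` in `A₊`, so that the pair lives in a twisted product of `A` and the bar construction. The
  -- hypotheses `h1` and `h2` say that it is a cycle; the goal is that it is a boundary. The bound
  -- `r` on the degree of the tails is lowered by clearing the top layer.
  induction r generalizing a v with
  | zero =>
    refine ⟨0, ?_, fun x u c => ?_⟩
    · rw [map_zero, neg_zero]
      ext p
      exact hra p (Nat.zero_le _)
    · rw [hrv x u c (Nat.zero_le _), map_zero]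
      exact neg_zero.symm
  | succ r ih =>
    have hex : ∀ p : List A.Pos × G.ι, ∃ h : A.Pos →₀ Q, A.barDeg G p = r →
        pair h (fun b => m [b]) = -firstLetter p.1 p.2 v ∧
        pair h (fun b => A.d b e) = -a p := by
      rintro ⟨u, c⟩
      by_cases hp : A.barDeg G (u, c) = r
      · have h3 : pair (firstLetter u c v) (fun b => m [b]) = 0 := by
          ext y
          rw [← preBar_apply_cons hpre.degree hpG (fun x w c' h => hrv x w c' (by omega)), ← h2]
          refine hra _ ?_
          simp only [barDeg, wordDeg_cons] at hp ⊢
          omega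
        have h4 : pair (firstLetter u c v) (fun b => A.d b e) = 0 := by
          rw [← barCurv_apply, ← h1]
          exact preBar_apply_eq_zero hpre.degree hpG fun p hp' => hra p (by omega)
        obtain ⟨h, h5, h6⟩ := exists_firstLetter_lift hA he hpre (ha (u, c)) h3 h4
        exact ⟨h, fun _ => ⟨h5, h6⟩⟩
      · exact ⟨0, fun h => absurd h hp⟩
    choose h hh using hex
    let f : List A.Pos × G.ι → Q := fun p => match p with
      | ([], _) => 0
      | (x :: u, c) => if A.barDeg G (u, c) = r then h (u, c) x else 0
    have hf : (Function.support f).Finite := by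
      refine ((finite_words (A := A) (r + 1)).prod (Set.finite_univ (α := G.ι))).subset ?_
      rintro ⟨_ | ⟨x, u⟩, c⟩ hp
      · exact absurd rfl hp
      · have h3 : A.barDeg G (u, c) = r := by
          by_contra hne
          exact hp (if_neg hne)
        have h4 := two_mul_length_le_wordDeg u
        refine ⟨?_, trivial⟩
        change u.length + 1 ≤ r + 1
        rw [barDeg] at h3
        dsimp only at h3
        omega
    let v' : List A.Pos × G.ι →₀ Q := Finsupp.ofSupportFinite f hf
    have hv' : ∀ u c, A.barDeg G (u, c) = r → firstLetter u c v' = h (u, c) := by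
      intro u c hu
      ext x
      exact if_pos hu
    have hv'' : ∀ x u c, A.barDeg G (u, c) ≠ r → v' (x :: u, c) = 0 := fun x u c hu => if_neg hu
    -- The boundary of `v'` is added. Its component on the empty word is dropped, which affects
    -- neither `barCurv` nor the coefficients of the differential at nonempty words.
    let v₁ := v + (preBar m mG v').filter fun p => p.1 ≠ []
    have hv₁ : ∀ x u c, v₁ (x :: u, c) = v (x :: u, c) + preBar m mG v' (x :: u, c) := by
      intro x u c
      rw [Finsupp.add_apply, 
        Finsupp.filter_apply_pos (fun p : List A.Pos × G.ι => p.1 ≠ []) _ (List.cons_ne_nil _ _)]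
    have hv₁' : ∀ x u c, v₁ (x :: u, c) = (v + preBar m mG v') (x :: u, c) := hv₁
    obtain ⟨v'', h3, h4⟩ := ih (a + A.barCurv e G v') v₁ (fun p => by
        rw [Finsupp.add_apply, map_add, ha, algebraMap_barCurv_apply hA.isComplex he, add_zero])
      (by rw [map_add, h1, barCurv_congr hv₁', map_add, ← preBar_preBar hm hmG v',
        ← preBar_preBar hm hmG (preBar m mG v')])
      (fun x u c => by
        rw [Finsupp.add_apply, h2, preBar_apply_cons_congr hv₁', map_add, Finsupp.add_apply,
          preBar_preBar hm hmG])
      (by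
        rintro ⟨u, c⟩ hp
        rw [Finsupp.add_apply, barCurv_apply]
        rcases eq_or_lt_of_le hp with heq | hlt
        · rw [hv' u c heq.symm, (hh (u, c) heq.symm).2, add_neg_cancel]
        · have h5 : firstLetter u c v' = 0 := by
            ext x
            exact hv'' x u c hlt.ne'
          rw [hra _ hlt, h5, pair_zero_left, add_zero])
      (fun x u c hp => by
        rw [hv₁, preBar_apply_cons hpre.degree hpG fun x w c' hlt => hv'' x w c' (by omega)]
        rcases eq_or_lt_of_le hp with heq | hlt
        · rw [hv' u c heq.symm, (hh (u, c) heq.symm).1, Finsupp.neg_apply, firstLetter_apply,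
            add_neg_cancel]
        · have h5 : firstLetter u c v' = 0 := by
            ext x
            exact hv'' x u c hlt.ne'
          rw [hrv _ _ _ hlt, h5, pair_zero_left, zero_add]
          rfl)
    refine ⟨v' + v'', ?_, fun x u c => ?_⟩
    · rw [map_add, neg_add, ← h3]
      abel
    · have h5 := h4 x u c
      rw [hv₁] at h5
      rw [map_add, Finsupp.add_apply, neg_add, ← h5]
      abel

/-! ### Reduction to `R` -/

/-- Reduction of coefficients. -/
def reduce (A : FreeComplex Q R) (G : FreeComplex Q X) :
    (List A.Pos × G.ι →₀ Q) →ₗ[Q] (List A.Pos × G.ι →₀ R) :=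
  Finsupp.mapRange.linearMap (Algebra.linearMap Q R)

@[simp] lemma reduce_single (p : List A.Pos × G.ι) (q : Q) :
    A.reduce G (Finsupp.single p q) = Finsupp.single p (algebraMap Q R q) :=
  Finsupp.mapRange_single (hf := map_zero _)

lemma reduce_surjective (hsurj : Function.Surjective (algebraMap Q R)) :
    Function.Surjective (A.reduce G) :=
  Finsupp.mapRange_surjective _ (map_zero _) hsurj

/-- The inclusion of `G` in the bar construction. -/
def inclBar (A : FreeComplex Q R) (G : FreeComplex Q X) :
    (G.ι →₀ Q) →ₗ[Q] (List A.Pos × G.ι →₀ Q) :=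
  Finsupp.lmapDomain Q Q fun c => ([], c)

lemma inclBar_single (c : G.ι) (a : Q) :
    A.inclBar G (Finsupp.single c a) = Finsupp.single ([], c) a :=
  Finsupp.mapDomain_single

lemma inclBar_apply (g : G.ι →₀ Q) (c : G.ι) : A.inclBar G g ([], c) = g c :=
  Finsupp.mapDomain_apply (fun _ _ h => by simpa using h) _ _

lemma inclBar_apply_cons (g : G.ι →₀ Q) (x : A.Pos) (w : List A.Pos) (c : G.ι) :
    A.inclBar G g (x :: w, c) = 0 :=
  Finsupp.mapDomain_of_notMem_range _ _ (by rintro ⟨y, hy⟩; simp at hy)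

lemma exists_inclBar_eq {z : List A.Pos × G.ι →₀ Q} (h : ∀ x w c, z (x :: w, c) = 0) :
    ∃ g, A.inclBar G g = z := by
  refine ⟨Finsupp.lcomapDomain (R := Q) (fun c : G.ι => (([], c) : List A.Pos × G.ι))
    (fun _ _ h => by simpa using h) z, ?_⟩
  ext ⟨_ | ⟨x, w⟩, c⟩
  · rw [inclBar_apply]
    rfl
  · rw [inclBar_apply_cons, h]

lemma preBar_inclBar (hpG : A.IsPreAInfModule G mG) (g : G.ι →₀ Q) :
    preBar m mG (A.inclBar G g) = A.inclBar G (G.D g) := by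
  induction g using Finsupp.induction_linear with
  | zero => simp
  | add f g hf hg => simp only [map_add, hf, hg]
  | single c a =>
    rw [inclBar_single, D_single, preBar, Finsupp.linearCombination_single, barDiff_nil,
      map_smul, hpG.map_nil]
    congr 1
    rw [pair_def, inclBar, Finsupp.lmapDomain_apply, Finsupp.mapDomain]
    refine Finsupp.sum_congr fun c' _ => ?_
    rw [Finsupp.smul_single, smul_eq_mul, mul_one]

variable [Module R X]

lemma bar_d (w : List A.Pos) (c : G.ι) : (A.bar m G mG).d (w, c) =
    A.reduce G (preBar m mG (Finsupp.single (w, c) 1)) := by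
  rw [map_preBar_single, ← sum_eq_barDiff]
  have h : ∀ (p : List A.Pos × G.ι) (q : Q), Finsupp.single p (algebraMap Q R q) =
      q • A.reduce G (Finsupp.single p 1) := fun p q => by
    rw [reduce_single, map_one, Finsupp.smul_single, Algebra.smul_def, mul_one]
  simp only [← h]
  rfl

lemma bar_D_reduce (z : List A.Pos × G.ι →₀ Q) :
    (A.bar m G mG).D (A.reduce G z) = A.reduce G (preBar m mG z) := by
  induction z using Finsupp.induction_linear with
  | zero => simp only [map_zero]; rfl
  | add f g hf hg =>
    rw [map_add, map_add, map_add, ← hf, ← hg]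
    exact map_add (A.bar m G mG).D _ _
  | single p a =>
    rw [reduce_single]
    refine (D_single (A.bar m G mG) p (algebraMap Q R a)).trans ?_
    obtain ⟨w, c⟩ := p
    have h : A.reduce G (preBar m mG (Finsupp.single (w, c) a)) =
        algebraMap Q R a • A.reduce G (preBar m mG (Finsupp.single (w, c) 1)) := by
      rw [algebraMap_smul, ← map_smul, ← map_smul, Finsupp.smul_single, smul_eq_mul, mul_one]
    rw [bar_d, h]
    rfl

variable [IsScalarTower Q R X]

lemma bar_aug_inclBar (g : G.ι →₀ Q) :
    (A.bar m G mG).aug (A.reduce G (A.inclBar G g)) = G.aug g := by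
  induction g using Finsupp.induction_linear with
  | zero => simp only [map_zero]; exact map_zero _
  | add f g hf hg =>
    rw [map_add, map_add, map_add, ← hf, ← hg]
    exact map_add (A.bar m G mG).aug _ _
  | single c a =>
    rw [inclBar_single, reduce_single, aug_single]
    refine (aug_single (A.bar m G mG) ([], c) (algebraMap Q R a)).trans ?_
    exact algebraMap_smul R a _

lemma bar_aug_preBar (hG : G.IsComplex) (hpG : A.IsPreAInfModule G mG)
    (z : List A.Pos × G.ι →₀ Q) :
    (A.bar m G mG).aug (A.reduce G (preBar m mG z)) = 0 := by
  let f : (List A.Pos × G.ι →₀ Q) →ₗ[Q] X :=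
    ((A.bar m G mG).aug.restrictScalars Q).comp (A.reduce G)
  change f (preBar m mG z) = 0
  have h1 : ∀ w c, f (preBar m mG (Finsupp.single (w, c) 1)) = 0 := by
    intro w c
    have hf : ∀ w c, f (Finsupp.single (w, c) 1) = (A.bar m G mG).ε (w, c) := by
      intro w c
      change (A.bar m G mG).aug (A.reduce G _) = _
      rw [reduce_single, map_one]
      exact (aug_single (A.bar m G mG) (w, c) 1).trans (one_smul _ _)
    rw [map_preBar_single, barDiff, coder_eq_zero, zero_add, splitSum_eq_left]
    · rw [sgn_nil, one_smul]
      simp only [hf]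
      exact hpG.aug_eq_zero hG w c
    · intro u v _ hu
      obtain ⟨y, u, rfl⟩ := List.exists_cons_of_ne_nil hu
      simp only [hf]
      exact (congrArg _ (pair_zero_right _)).trans (smul_zero _)
    · intro u v z b _ _ _
      rw [hf]
      rcases u with _ | ⟨y, u⟩ <;> rfl
  induction z using Finsupp.induction_linear with
  | zero => rw [map_zero, map_zero]
  | add f g hf hg => rw [map_add, map_add, hf, hg, add_zero]
  | single p a =>
    rw [← mul_one a, ← smul_eq_mul, ← Finsupp.smul_single, map_smul, map_smul, h1, smul_zero]

/-- The bar resolution is a free resolution. -/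
theorem bar_isFreeResolution [Finite A.ι] [Finite G.ι]
    (hsurj : Function.Surjective (algebraMap Q R)) (hA : A.IsFreeResolution)
    (he : A.IsUnital e) (hm : A.IsAInfAlgebra e m) (hG : G.IsFreeResolution)
    (hmG : A.IsAInfModule e m G mG) : (A.bar m G mG).IsFreeResolution := by
  classical
  have hpre := (isAInfAlgebra_iff.1 hm).1
  have hpG := (isAInfModule_iff.1 hmG).1
  refine ⟨⟨?_, ?_, fun z => ?_, fun z => ?_⟩, fun x => ?_, fun z h1 h2 => ?_⟩
  · rintro ⟨w, c⟩ q h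
    rw [bar_d] at h
    refine preBar_single_degree hpre.degree hpG (p := (w, c)) (q := q) fun h0 => h ?_
    exact (congrArg (algebraMap Q R) h0).trans (map_zero _)
  · rintro ⟨_ | ⟨x, w⟩, c⟩ h
    · refine hG.isComplex.aug_eq_zero c fun h0 => h ?_
      change A.wordDeg [] + G.deg c = 0
      rw [h0]
      rfl
    · rfl
  · obtain ⟨z, rfl⟩ := reduce_surjective (A := A) (G := G) hsurj z
    rw [bar_D_reduce, bar_D_reduce, preBar_preBar hm hmG]
    ext p
    exact algebraMap_barCurv_apply hA.isComplex he z p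
  · obtain ⟨z, rfl⟩ := reduce_surjective (A := A) (G := G) hsurj z
    rw [bar_D_reduce]
    exact bar_aug_preBar hG.isComplex hpG z
  · obtain ⟨g, rfl⟩ := hG.surjective x
    exact ⟨_, bar_aug_inclBar g⟩
  · obtain ⟨z, rfl⟩ := reduce_surjective (A := A) (G := G) hsurj z
    rw [bar_D_reduce] at h1
    obtain ⟨r, hr⟩ : ∃ r, ∀ p, r ≤ A.barDeg G p → z p = 0 ∧ preBar m mG z p = 0 := by
      refine ⟨(z.support ∪ (preBar m mG z).support).sup (A.barDeg G) + 1, fun p hp => ?_⟩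
      by_contra h
      have : p ∈ z.support ∪ (preBar m mG z).support := by
        rw [Finset.mem_union, Finsupp.mem_support_iff, Finsupp.mem_support_iff]
        tauto
      have := Finset.le_sup (f := A.barDeg G) this
      omega
    -- For a cycle over `R`, the pair formed by the `Q`-boundary of a lift `z` and `z` itself is a
    -- cycle in the above sense: `h1` is the formula for the square and `h2` is a tautology.
    obtain ⟨v, h3, h4⟩ := exists_barCurv_eq hA he hm hmG r (preBar m mG z) z
      (fun p => DFunLike.congr_fun h1 p) (preBar_preBar hm hmG z) (fun x u c => rfl)
      (fun p hp => (hr p hp).2) (fun x u c hp => by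
        refine (hr _ ?_).1
        simp only [barDeg, wordDeg_cons] at hp ⊢
        omega)
    -- Adding the boundary of `v` leaves only the empty word, so the cycle is moved into `G`. There
    -- it is a cycle over `Q`, since the curvature terms cancel, and the exactness of `G` finishes.
    obtain ⟨g, hg⟩ := exists_inclBar_eq (A := A) (G := G) (z := z + preBar m mG v)
      fun x w c => by rw [Finsupp.add_apply, h4, neg_add_cancel]
    have hDg : G.D g = 0 := by
      have h5 := preBar_inclBar (m := m) hpG g
      rw [hg, map_add, preBar_preBar hm hmG, h3, neg_add_cancel] at h5
      ext c
      rw [← inclBar_apply (A := A) (G.D g) c, ← h5]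
      rfl
    have haug : G.aug g = 0 := by
      rw [← bar_aug_inclBar (A := A) (m := m) (mG := mG) g, hg, map_add]
      refine (map_add (A.bar m G mG).aug _ _).trans ?_
      rw [h2, bar_aug_preBar hG.isComplex hpG, add_zero]
    obtain ⟨g', rfl⟩ := hG.exact g hDg haug
    refine ⟨A.reduce G (A.inclBar G g' - v), ?_⟩
    rw [bar_D_reduce, map_sub, preBar_inclBar hpG, hg, add_sub_cancel_right]

end Bar

end FreeComplex

end

noncomputable section

open IsLocalRing

/-! ### Betti numbers -/

section

variable {S : Type u} [CommRing S] [IsLocalRing S] {P Y V : Type u} [AddCommGroup P] [Module S P]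
  [AddCommGroup Y] [Module S Y] [AddCommGroup V] [Module S V] [Module (ResidueField S) V]
  [IsScalarTower S (ResidueField S) V]

lemma smul_eq_zero_of_mem_maximalIdeal {a : S} (ha : a ∈ maximalIdeal S) (v : V) : a • v = 0 := by
  rw [← algebraMap_smul (ResidueField S) a v]
  have : algebraMap S (ResidueField S) a = 0 := (residue_eq_zero_iff a).2 ha
  rw [this, zero_smul]

/-- `V` stands for `P/𝔪P` and `W` for the image of the kernel of `f`, whence `Y/𝔪Y ≅ V/W`. -/
lemma torLength_zero_add_finrank [Module.Finite (ResidueField S) V] {f : P →ₗ[S] Y}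
    (hf : Function.Surjective f) {g : P →ₗ[S] V} (hg : Function.Surjective g)
    (hker : ∀ p, g p = 0 → p ∈ maximalIdeal S • (⊤ : Submodule S P))
    (W : Submodule (ResidueField S) V)
    (hW : ∀ v, v ∈ W ↔ ∃ p, f p = 0 ∧ g p = v) :
    torLength S Y 0 + Module.finrank (ResidueField S) W = Module.finrank (ResidueField S) V := by
  have e1 : TensorProduct S Y (ResidueField S) ≃ₗ[S] Y ⧸ (maximalIdeal S • ⊤ : Submodule S Y) :=
    TensorProduct.tensorQuotEquivQuotSMul Y (maximalIdeal S)
  let φ : P →ₗ[S] Y ⧸ (maximalIdeal S • ⊤ : Submodule S Y) := (Submodule.mkQ _).comp f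
  let ψ : P →ₗ[S] V ⧸ W := ((Submodule.mkQ W).restrictScalars S).comp g
  have hφ : Function.Surjective φ := (Submodule.mkQ_surjective _).comp hf
  have hψ : Function.Surjective ψ := (Submodule.mkQ_surjective W).comp hg
  have hle : (maximalIdeal S • ⊤ : Submodule S P) ≤ LinearMap.ker g := by
    rw [Submodule.smul_le]
    intro a ha p _
    rw [LinearMap.mem_ker, map_smul]
    exact smul_eq_zero_of_mem_maximalIdeal ha _
  have hmap : (maximalIdeal S • ⊤ : Submodule S Y) =
      Submodule.map f (maximalIdeal S • ⊤ : Submodule S P) := by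
    rw [Submodule.map_smul'', Submodule.map_top, LinearMap.range_eq_top.2 hf]
  have hkk : LinearMap.ker φ = LinearMap.ker ψ := by
    ext p
    have h1 : p ∈ LinearMap.ker φ ↔ f p ∈ (maximalIdeal S • ⊤ : Submodule S Y) := by
      rw [LinearMap.mem_ker]
      exact Submodule.Quotient.mk_eq_zero _
    have h2 : p ∈ LinearMap.ker ψ ↔ g p ∈ W := by
      rw [LinearMap.mem_ker]
      exact Submodule.Quotient.mk_eq_zero _
    rw [h1, h2, hmap, hW]
    constructor
    · rintro ⟨q, hq, hqp⟩
      refine ⟨p - q, by rw [map_sub, hqp, sub_self], ?_⟩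
      rw [map_sub, LinearMap.mem_ker.1 (hle hq), sub_zero]
    · rintro ⟨q, hq, hqp⟩
      refine ⟨p - q, hker _ ?_, by rw [map_sub, hq, sub_zero]⟩
      rw [map_sub, hqp, sub_self]
  have e2 : (Y ⧸ (maximalIdeal S • ⊤ : Submodule S Y)) ≃ₗ[S] V ⧸ W :=
    (LinearMap.quotKerEquivOfSurjective φ hφ).symm ≪≫ₗ Submodule.quotEquivOfEq _ _ hkk ≪≫ₗ
      LinearMap.quotKerEquivOfSurjective ψ hψ
  have h3 : Module.length S (V ⧸ W) = Module.length (ResidueField S) (V ⧸ W) :=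
    Module.length_eq_of_surjective (R := ResidueField S) (S := S) residue_surjective
  rw [torLength_zero, e1.length_eq, e2.length_eq, h3, Module.length_eq_finrank,
    ← Submodule.finrank_quotient_add_finrank W, Nat.cast_add]

end

namespace FreeComplex

variable {S X : Type u} [CommRing S] [IsLocalRing S] [AddCommGroup X] [Module S X]
  {F : FreeComplex S X}

/-- Reduction modulo the maximal ideal. -/
def residueMap (S : Type u) [CommRing S] [IsLocalRing S] (ι : Type) :
    (ι →₀ S) →ₗ[S] (ι →₀ ResidueField S) :=
  Finsupp.mapRange.linearMap (Algebra.linearMap S (ResidueField S))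

@[simp] lemma residueMap_apply {ι : Type} (z : ι →₀ S) (x : ι) :
    residueMap S ι z x = residue S (z x) := rfl

lemma residueMap_surjective {ι : Type} : Function.Surjective (residueMap S ι) :=
  Finsupp.mapRange_surjective _ (map_zero _) residue_surjective

/-- The reduction of the differential modulo the maximal ideal. -/
def Dres (F : FreeComplex S X) : (F.ι →₀ ResidueField S) →ₗ[ResidueField S]
    (F.ι →₀ ResidueField S) :=
  Finsupp.linearCombination _ fun x => residueMap S F.ι (F.d x)

lemma Dres_residueMap (z : F.ι →₀ S) :
    F.Dres (residueMap S F.ι z) = residueMap S F.ι (F.D z) := by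
  induction z using Finsupp.induction_linear with
  | zero => simp
  | add f g hf hg => simp only [map_add, hf, hg]
  | single x a =>
    have h : residueMap S F.ι (Finsupp.single x a) = Finsupp.single x (residue S a) :=
      Finsupp.mapRange_single (hf := map_zero _)
    rw [h, Dres, Finsupp.linearCombination_single, D_single, map_smul]
    exact algebraMap_smul (ResidueField S) a _

/-- The part of degree `n` of the reduction. -/
abbrev resPart (F : FreeComplex S X) (n : ℕ) : Submodule (ResidueField S)
    (F.ι →₀ ResidueField S) :=
  Finsupp.supported _ _ {x | F.deg x = n}

/-- The rank of the reduction of the differential `F_n → F_{n-1}`. -/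
def resRank (F : FreeComplex S X) (n : ℕ) : ℕ :=
  Module.finrank (ResidueField S) ((F.resPart n).map F.Dres)

/-- The number of basis elements of degree `n`. -/
def rankAt (F : FreeComplex S X) (n : ℕ) : ℕ := {x | F.deg x = n}.ncard

lemma mem_resPart {n : ℕ} {z : F.ι →₀ ResidueField S} :
    z ∈ F.resPart n ↔ ∀ x, F.deg x ≠ n → z x = 0 :=
  Finsupp.mem_supported' ..

lemma exists_residueMap_eq {n : ℕ} {v : F.ι →₀ ResidueField S} (hv : v ∈ F.resPart n) :
    ∃ z ∈ F.degreePart n, residueMap S F.ι z = v := by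
  obtain ⟨z, rfl⟩ := residueMap_surjective v
  refine ⟨_, filter_mem_degreePart n z, ?_⟩
  ext x
  rw [residueMap_apply, Finsupp.filter_apply]
  split_ifs with hx
  · rfl
  · rw [map_zero]
    exact (mem_resPart.1 hv x hx).symm

lemma residueMap_mem_resPart {n : ℕ} {z : F.ι →₀ S} (hz : z ∈ F.degreePart n) :
    residueMap S F.ι z ∈ F.resPart n :=
  mem_resPart.2 fun x hx => by rw [residueMap_apply, mem_degreePart.1 hz x hx, map_zero]

/-- Reduction on the part of degree `n`. -/
def residuePart (F : FreeComplex S X) (n : ℕ) : F.degreePart n →ₗ[S] F.resPart n :=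
  LinearMap.codRestrict ((F.resPart n).restrictScalars S)
    ((residueMap S F.ι).comp (F.degreePart n).subtype) fun z => residueMap_mem_resPart z.2

lemma residuePart_surjective (n : ℕ) : Function.Surjective (F.residuePart n) := fun v => by
  obtain ⟨z, h1, h2⟩ := exists_residueMap_eq v.2
  exact ⟨⟨z, h1⟩, Subtype.ext h2⟩

lemma mem_smul_top_of_residuePart_eq_zero {n : ℕ} (z : F.degreePart n)
    (hz : F.residuePart n z = 0) : z ∈ maximalIdeal S • (⊤ : Submodule S (F.degreePart n)) :=
  mem_smul_top_of_forall_mem _ _ fun x =>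
    (residue_eq_zero_iff _).1 (DFunLike.congr_fun (congrArg Subtype.val hz) x)

lemma finite_resPart (hfin : ∀ n, {x | F.deg x = n}.Finite) (n : ℕ) :
    Module.Finite (ResidueField S) (F.resPart n) := by
  have := (hfin n).to_subtype
  exact Module.Finite.equiv (Finsupp.supportedEquivFinsupp (M := ResidueField S)
    (R := ResidueField S) {x | F.deg x = n}).symm

lemma finrank_resPart (hfin : ∀ n, {x | F.deg x = n}.Finite) (n : ℕ) :
    Module.finrank (ResidueField S) (F.resPart n) = F.rankAt n := by
  have := (hfin n).fintype
  rw [(Finsupp.supportedEquivFinsupp (M := ResidueField S)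
    (R := ResidueField S) {x | F.deg x = n}).finrank_eq, Module.finrank_finsupp_self, rankAt,
    Set.ncard_eq_toFinset_card', Set.toFinset_card]

lemma mem_comap_map_Dres (hF : F.IsComplex) (n : ℕ) (v : F.resPart n) :
    v ∈ ((F.resPart (n + 1)).map F.Dres).comap (F.resPart n).subtype ↔
      ∃ z ∈ F.degreePart (n + 1), ∃ p : F.degreePart n, F.D z = p ∧ F.residuePart n p = v := by
  constructor
  · rintro ⟨v', hv', hvv⟩
    obtain ⟨z, h1, rfl⟩ := exists_residueMap_eq hv'
    rw [Dres_residueMap] at hvv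
    exact ⟨z, h1, ⟨F.D z, hF.D_mem_degreePart h1⟩, rfl, Subtype.ext hvv⟩
  · rintro ⟨z, h1, p, h2, rfl⟩
    refine ⟨residueMap S F.ι z, residueMap_mem_resPart h1, ?_⟩
    rw [Dres_residueMap, h2]
    rfl

lemma finrank_comap_map_Dres (hF : F.IsComplex) (n : ℕ) : Module.finrank (ResidueField S)
    (((F.resPart (n + 1)).map F.Dres).comap (F.resPart n).subtype) = F.resRank (n + 1) := by
  refine (Submodule.comapSubtypeEquivOfLe ?_).finrank_eq
  rintro _ ⟨v, hv, rfl⟩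
  obtain ⟨z, h1, rfl⟩ := exists_residueMap_eq hv
  rw [Dres_residueMap]
  exact residueMap_mem_resPart (hF.D_mem_degreePart h1)

/-- For `Y` the cokernel of `F_{n+1} → F_n`: the number of generators of `Y` is the rank of `F_n`
minus the rank of the reduced differential. -/
lemma torLength_cokernel_add (hfin : ∀ n, {x | F.deg x = n}.Finite) {Y : Type u}
    [AddCommGroup Y] [Module S Y] (hF : F.IsComplex) (n : ℕ) (f : F.degreePart n →ₗ[S] Y)
    (hf : Function.Surjective f)
    (hker : ∀ z : F.degreePart n, f z = 0 ↔ ∃ z' ∈ F.degreePart (n + 1), F.D z' = z) :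
    torLength S Y 0 + F.resRank (n + 1) = F.rankAt n := by
  have := finite_resPart hfin n
  rw [← finrank_resPart hfin, ← finrank_comap_map_Dres hF n]
  refine torLength_zero_add_finrank (S := S) (P := F.degreePart n) (Y := Y) (V := F.resPart n)
    (f := f) (g := F.residuePart n) hf (residuePart_surjective n)
    mem_smul_top_of_residuePart_eq_zero _
    fun v => ?_
  rw [mem_comap_map_Dres hF]
  constructor
  · rintro ⟨z, h1, p, h2, h3⟩
    exact ⟨p, (hker p).2 ⟨z, h1, h2⟩, h3⟩
  · rintro ⟨p, h1, h2⟩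
    obtain ⟨z, h3, h4⟩ := (hker p).1 h1
    exact ⟨z, h3, p, h4, h2⟩

lemma torLength_degreePart (hfin : ∀ n, {x | F.deg x = n}.Finite) (n : ℕ) :
    torLength S (F.degreePart n) 0 = F.rankAt n := by
  have := finite_resPart hfin n
  have h : torLength S (F.degreePart n) 0 +
      Module.finrank (ResidueField S) (⊥ : Submodule (ResidueField S) (F.resPart n)) =
      Module.finrank (ResidueField S) (F.resPart n) := by
    refine torLength_zero_add_finrank (S := S) (P := F.degreePart n) (Y := F.degreePart n)
      (V := F.resPart n) (f := LinearMap.id) (g := F.residuePart n) Function.surjective_id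
      (residuePart_surjective n) mem_smul_top_of_residuePart_eq_zero ⊥ fun v => ?_
    rw [Submodule.mem_bot]
    constructor
    · rintro rfl
      exact ⟨0, rfl, map_zero _⟩
    · rintro ⟨p, hp, rfl⟩
      rw [show p = 0 from hp]
      exact map_zero _
  rwa [finrank_bot, Nat.cast_zero, add_zero, finrank_resPart hfin] at h

lemma torLength_zero_add_resRank (hfin : ∀ n, {x | F.deg x = n}.Finite)
    (hF : F.IsFreeResolution) : torLength S X 0 + F.resRank 1 = F.rankAt 0 := by
  have h := hF.isResolutionBelow 1
  refine torLength_cokernel_add hfin hF.isComplex 0 F.augZero h.augZero_surjective fun z => ?_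
  constructor
  · intro hz
    exact h.exists_degreePart Nat.one_pos ⟨z.2, hF.isComplex.D_eq_zero z.2, hz⟩
  · rintro ⟨z', _, h2⟩
    change F.aug z = 0
    rw [← h2, hF.isComplex.aug_D]

lemma torLength_syzygy_zero_add_resRank (hfin : ∀ n, {x | F.deg x = n}.Finite)
    (hF : F.IsFreeResolution) (n : ℕ) :
    torLength S (F.syzygy n) 0 + F.resRank (n + 2) = F.rankAt (n + 1) := by
  have h := hF.isResolutionBelow (n + 2)
  refine torLength_cokernel_add hfin hF.isComplex (n + 1) (toSyzygy hF.isComplex n)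
    (h.toSyzygy_surjective (by omega)) fun z => ?_
  constructor
  · intro hz
    exact h.exists_degreePart (by omega) ⟨z.2, congrArg Subtype.val hz,
      hF.isComplex.aug_eq_zero_of_mem z.2⟩
  · rintro ⟨z', _, h2⟩
    refine Subtype.ext ?_
    change F.D z = 0
    rw [← h2, hF.isComplex.D_D]

/-- Each equation with a finite right-hand side forces its terms to be finite; only then is
cancellation permitted. -/
lemma enat_betti_aux {a w x : ℕ∞} {b₀ b₁ r₁ r₂ : ℕ} (h1 : a + b₀ = w + x) (h2 : x + r₁ = b₀)
    (h3 : w + r₂ = b₁) : a + r₂ + r₁ = b₁ := by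
  have hx : x ≠ ⊤ := by rintro rfl; simp at h2
  have hw : w ≠ ⊤ := by rintro rfl; simp at h3
  lift x to ℕ using hx
  lift w to ℕ using hw
  have ha : a ≠ ⊤ := by
    rintro rfl
    rw [top_add] at h1
    exact ENat.natCast_ne_top (w + x) (by rw [Nat.cast_add, h1])
  lift a to ℕ using ha
  norm_cast at h1 h2 h3 ⊢
  omega

lemma torLength_one_add (hfin : ∀ n, {x | F.deg x = n}.Finite) (hF : F.IsFreeResolution) :
    torLength S X 1 + F.resRank 2 + F.resRank 1 = F.rankAt 1 := by
  have h := hF.isResolutionBelow 1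
  have h1 := torLength_one_of_flat (N := F.syzygy 0) (F := F.degreePart 0) (Z := X)
    (f := F.syzygyIncl 0) (g := F.augZero) (syzygyIncl_injective 0) h.augZero_surjective
    (augZero_exact hF.isComplex)
  rw [torLength_degreePart hfin] at h1
  exact enat_betti_aux h1 (torLength_zero_add_resRank hfin hF)
    (torLength_syzygy_zero_add_resRank hfin hF 0)

/-- Dimension shifting along the free modules of the resolution. -/
lemma torLength_eq_syzygy {N : ℕ} (h : F.IsResolutionBelow N) (n i : ℕ) (hn : n ≤ N) :
    torLength S X (i + n + 2) = torLength S (F.syzygy n) (i + 1) := by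
  induction n generalizing i with
  | zero =>
    exact torLength_succ_succ_of_flat (N := F.syzygy 0) (F := F.degreePart 0) (Z := X)
      (f := F.syzygyIncl 0) (g := F.augZero) (syzygyIncl_injective 0) h.augZero_surjective
      (augZero_exact h.isComplex) i
  | succ n ih =>
    rw [show i + (n + 1) + 2 = (i + 1) + n + 2 by omega, ih (i + 1) (by omega)]
    exact torLength_succ_succ_of_flat (N := F.syzygy (n + 1)) (F := F.degreePart (n + 1))
      (Z := F.syzygy n) (f := F.syzygyIncl (n + 1)) (g := toSyzygy h.isComplex n)
      (syzygyIncl_injective (n + 1)) (h.toSyzygy_surjective (by omega))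
      (toSyzygy_exact h.isComplex n) i

lemma torLength_add_two_add (hfin : ∀ n, {x | F.deg x = n}.Finite) (hF : F.IsFreeResolution)
    (n : ℕ) : torLength S X (n + 2) + F.resRank (n + 3) + F.resRank (n + 2) = F.rankAt (n + 2) := by
  have h := hF.isResolutionBelow (n + 1)
  have h1 := torLength_one_of_flat (N := F.syzygy (n + 1)) (F := F.degreePart (n + 1))
    (Z := F.syzygy n) (f := F.syzygyIncl (n + 1)) (g := toSyzygy hF.isComplex n)
    (syzygyIncl_injective (n + 1)) (h.toSyzygy_surjective (by omega))
    (toSyzygy_exact hF.isComplex n)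
  rw [torLength_degreePart hfin] at h1
  have h2 := torLength_eq_syzygy h n 0 (by omega)
  rw [zero_add] at h2
  rw [h2]
  exact enat_betti_aux h1 (torLength_syzygy_zero_add_resRank hfin hF n)
    (torLength_syzygy_zero_add_resRank hfin hF (n + 1))

lemma resRank_eq_zero {n : ℕ} (h : ∀ x, F.deg x = n → ∀ y, F.d x y ∈ maximalIdeal S) :
    F.resRank n = 0 := by
  have h1 : (F.resPart n).map F.Dres = ⊥ := by
    rw [Submodule.eq_bot_iff]
    rintro _ ⟨v, hv, rfl⟩
    rw [Dres, Finsupp.linearCombination_apply]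
    refine Finset.sum_eq_zero fun x _ => ?_
    dsimp only
    by_cases hx : F.deg x = n
    · have : residueMap S F.ι (F.d x) = 0 := by
        ext y
        exact (residue_eq_zero_iff _).2 (h x hx y)
      rw [this, smul_zero]
    · rw [mem_resPart.1 hv x hx, zero_smul]
  rw [resRank, h1, finrank_bot]

lemma resRank_zero (hF : F.IsComplex) : F.resRank 0 = 0 :=
  resRank_eq_zero fun x hx y => by
    by_cases h : F.d x y = 0
    · rw [h]
      exact zero_mem _
    · have := hF.deg_d x y h
      omega

lemma d_mem_of_resRank_eq_zero (hfin : ∀ n, {x | F.deg x = n}.Finite) (x : F.ι)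
    (h : F.resRank (F.deg x) = 0) (y : F.ι) : F.d x y ∈ maximalIdeal S := by
  have := finite_resPart hfin (F.deg x)
  have h1 : (F.resPart (F.deg x)).map F.Dres = ⊥ := Submodule.finrank_eq_zero.1 h
  have h2 : F.Dres (Finsupp.single x 1) ∈ (F.resPart (F.deg x)).map F.Dres :=
    Submodule.mem_map_of_mem (Finsupp.single_mem_supported _ _ rfl)
  rw [h1, Submodule.mem_bot, Dres, Finsupp.linearCombination_single, one_smul] at h2
  exact (residue_eq_zero_iff _).1 (DFunLike.congr_fun h2 y)

lemma torLength_add (hfin : ∀ n, {x | F.deg x = n}.Finite) (hF : F.IsFreeResolution)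
    (n : ℕ) : torLength S X n + F.resRank (n + 1) + F.resRank n = F.rankAt n := by
  rcases n with _ | _ | n
  · rw [resRank_zero hF.isComplex, Nat.cast_zero, add_zero]
    exact torLength_zero_add_resRank hfin hF
  · exact torLength_one_add hfin hF
  · exact torLength_add_two_add hfin hF n

/-- The Betti number `dim_k Tor_n^S(X, k)`. -/
def _root_.bettiNumber (S : Type u) [CommRing S] [IsLocalRing S] (X : Type u) [AddCommGroup X]
    [Module S X] (n : ℕ) : ℕ := (torLength S X n).toNat

lemma torLength_eq_bettiNumber (hfin : ∀ n, {x | F.deg x = n}.Finite) (hF : F.IsFreeResolution)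
    (n : ℕ) : torLength S X n = bettiNumber S X n := by
  refine (ENat.natCast_toNat ?_).symm
  intro h
  have := torLength_add hfin hF n
  rw [h, top_add, top_add] at this
  exact ENat.top_ne_natCast _ this

/-- The Betti numbers in terms of a free resolution that need not be minimal. -/
lemma bettiNumber_add (hfin : ∀ n, {x | F.deg x = n}.Finite) (hF : F.IsFreeResolution)
    (n : ℕ) : bettiNumber S X n + F.resRank (n + 1) + F.resRank n = F.rankAt n := by
  have := torLength_add hfin hF n
  rw [torLength_eq_bettiNumber hfin hF] at this
  exact_mod_cast this

lemma IsMinimalFreeResolution.bettiNumber_eq (hfin : ∀ n, {x | F.deg x = n}.Finite)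
    (hF : F.IsMinimalFreeResolution) (n : ℕ) : bettiNumber S X n = F.rankAt n := by
  have h := bettiNumber_add hfin hF.isFreeResolution n
  rwa [resRank_eq_zero fun x _ => hF.minimal x, resRank_eq_zero fun x _ => hF.minimal x] at h

lemma poincareSeries_eq : poincareSeries S X = PowerSeries.mk fun n => (bettiNumber S X n : ℚ) :=
  rfl

end FreeComplex

end

noncomputable section

open IsLocalRing

namespace FreeComplex

/-! ### Ranks of the bar construction -/

section Count

variable {Q R X : Type u} [CommRing Q] [CommRing R] [Algebra Q R] [AddCommGroup X] [Module Q X]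
  [Module R X] {A : FreeComplex Q R} {m : List A.Pos → (A.Pos →₀ Q)} {G : FreeComplex Q X}
  {mG : List A.Pos → G.ι → (G.ι →₀ Q)}

/-- The coefficients of the product of a power series with `∑ t ^ (deg x + 1)`, where `x` runs
through the basis of `A₊`. -/
def shiftSum (A : FreeComplex Q R) [Fintype A.Pos] {N : Type*} [AddCommMonoid N] (f : ℕ → N)
    (i : ℕ) : N :=
  ∑ x : A.Pos, if A.deg x + 1 ≤ i then f (i - (A.deg x + 1)) else 0

lemma shiftSum_congr [Fintype A.Pos] {N : Type*} [AddCommMonoid N] {f g : ℕ → N} {i : ℕ}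
    (h : ∀ j < i, f j = g j) : A.shiftSum f i = A.shiftSum g i := by
  refine Finset.sum_congr rfl fun x _ => ?_
  split_ifs with hx
  · exact h _ (by omega)
  · rfl

lemma shiftSum_mono [Fintype A.Pos] {f g : ℕ → ℕ} {i : ℕ} (h : ∀ j < i, f j ≤ g j) :
    A.shiftSum f i ≤ A.shiftSum g i := by
  refine Finset.sum_le_sum fun x _ => ?_
  split_ifs with hx
  · exact h _ (by omega)
  · exact le_rfl

lemma shiftSum_add [Fintype A.Pos] {N : Type*} [AddCommMonoid N] (f g : ℕ → N) (i : ℕ) :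
    A.shiftSum (fun j => f j + g j) i = A.shiftSum f i + A.shiftSum g i := by
  rw [shiftSum, shiftSum, shiftSum, ← Finset.sum_add_distrib]
  refine Finset.sum_congr rfl fun x _ => ?_
  split_ifs
  · rfl
  · rw [add_zero]

variable (m mG) in
/-- The basis elements of degree `i` of the bar construction. -/
def barDegEquiv (i : ℕ) : {p : List A.Pos × G.ι // A.barDeg G p = i} ≃
    {c : G.ι // G.deg c = i} ⊕ Σ x : A.Pos, {p : List A.Pos × G.ι //
      A.deg x + 1 + A.barDeg G p = i} where
  toFun := fun p => match p with
    | ⟨([], c), h⟩ => Sum.inl ⟨c, by simpa [barDeg] using h⟩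
    | ⟨(x :: w, c), h⟩ => Sum.inr ⟨x, (w, c), by
        simp only [barDeg, wordDeg_cons] at h ⊢
        omega⟩
  invFun := fun p => match p with
    | Sum.inl c => ⟨([], c), by simpa [barDeg] using c.2⟩
    | Sum.inr ⟨x, ⟨(w, c), h⟩⟩ => ⟨(x :: w, c), by
        simp only [barDeg, wordDeg_cons] at h ⊢
        omega⟩
  left_inv := by rintro ⟨⟨_ | ⟨x, w⟩, c⟩, h⟩ <;> rfl
  right_inv := by rintro (c | ⟨x, ⟨⟨w, c⟩, h⟩⟩) <;> rfl

lemma finite_bar_deg_eq [Finite A.ι] [Finite G.ι] (i : ℕ) :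
    {p | (A.bar m G mG).deg p = i}.Finite := by
  refine ((finite_words (A := A) i).prod (Set.finite_univ (α := G.ι))).subset ?_
  rintro ⟨w, c⟩ (h : A.wordDeg w + G.deg c = i)
  have := two_mul_length_le_wordDeg w
  refine ⟨?_, trivial⟩
  change w.length ≤ i
  omega

/-- A word is empty or has a first letter. This recursion has the shape of the Golod identity. -/
lemma rankAt_bar [Fintype A.Pos] [Finite A.ι] [Finite G.ι] (i : ℕ) :
    (A.bar m G mG).rankAt i = G.rankAt i + A.shiftSum (A.bar m G mG).rankAt i := by
  have hfin : ∀ j, Finite {p : List A.Pos × G.ι // A.barDeg G p = j} := fun j =>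
    (finite_bar_deg_eq (A := A) (m := m) (G := G) (mG := mG) j).to_subtype
  have h1 : (A.bar m G mG).rankAt i = Nat.card {p : List A.Pos × G.ι // A.barDeg G p = i} := rfl
  have h2 : ∀ x : A.Pos, Nat.card {p : List A.Pos × G.ι // A.deg x + 1 + A.barDeg G p = i} =
      if A.deg x + 1 ≤ i then (A.bar m G mG).rankAt (i - (A.deg x + 1)) else 0 := by
    intro x
    split_ifs with hx
    · refine Nat.card_congr (Equiv.subtypeEquivRight fun p => ?_)
      change _ ↔ A.barDeg G p = _
      omega
    · have : IsEmpty {p : List A.Pos × G.ι // A.deg x + 1 + A.barDeg G p = i} :=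
        ⟨fun p => by have := p.2; omega⟩
      exact Nat.card_of_isEmpty
  have hfin' : ∀ x : A.Pos, Finite {p : List A.Pos × G.ι // A.deg x + 1 + A.barDeg G p = i} :=
    fun x => Finite.of_injective (β := {p : List A.Pos × G.ι // A.barDeg G p = i - (A.deg x + 1)})
      (fun p => ⟨p.1, by have := p.2; omega⟩) fun p q h => by simpa [Subtype.ext_iff] using h
  rw [h1, Nat.card_congr (barDegEquiv i), Nat.card_sum, Nat.card_sigma]
  simp only [h2]
  rfl

/-- The operation of adding a first letter to all words. -/
def consMap (k : Type*) [Semiring k] (A : FreeComplex Q R) (ι : Type) (x : A.Pos) :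
    (List A.Pos × ι →₀ k) →ₗ[k] (List A.Pos × ι →₀ k) :=
  Finsupp.lmapDomain k k fun p => (x :: p.1, p.2)

lemma consMap_single (k : Type*) [Semiring k] {ι : Type} (x : A.Pos) (w : List A.Pos) (c : ι)
    (a : k) : consMap k A ι x (Finsupp.single (w, c) a) = Finsupp.single (x :: w, c) a :=
  Finsupp.mapDomain_single

lemma consMap_injective_aux {ι : Type} (x : A.Pos) :
    Function.Injective fun p : List A.Pos × ι => (x :: p.1, p.2) := fun p q h => by
  simp only [Prod.mk.injEq, List.cons.injEq, true_and] at h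
  exact Prod.ext h.1 h.2

lemma consMap_apply (k : Type*) [Semiring k] {ι : Type} (x : A.Pos) (z : List A.Pos × ι →₀ k)
    (w : List A.Pos) (c : ι) : consMap k A ι x z (x :: w, c) = z (w, c) :=
  Finsupp.mapDomain_apply (consMap_injective_aux x) z (w, c)

lemma consMap_apply_of_ne (k : Type*) [Semiring k] {ι : Type} {x y : A.Pos} (hxy : y ≠ x)
    (z : List A.Pos × ι →₀ k) (w : List A.Pos) (c : ι) :
    consMap k A ι x z (y :: w, c) = 0 :=
  Finsupp.mapDomain_of_notMem_range _ _ (by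
    rintro ⟨p, hp⟩
    simp only [Prod.mk.injEq, List.cons.injEq] at hp
    exact hxy hp.1.1.symm)

end Count

section Rank

variable {Q R X : Type u} [CommRing Q] [CommRing R] [Algebra Q R] [IsLocalRing R]
  [AddCommGroup X] [Module Q X] [Module R X] {A : FreeComplex Q R}
  {m : List A.Pos → (A.Pos →₀ Q)} {G : FreeComplex Q X} {mG : List A.Pos → G.ι → (G.ι →₀ Q)}

/-- The reduction from `Q` to the residue field of `R`. -/
def toResidue (A : FreeComplex Q R) (ι : Type) :
    (List A.Pos × ι →₀ Q) →ₗ[Q] (List A.Pos × ι →₀ ResidueField R) :=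
  Finsupp.mapRange.linearMap (Algebra.linearMap Q (ResidueField R))

@[simp] lemma toResidue_single {ι : Type} (p : List A.Pos × ι) (q : Q) :
    A.toResidue ι (Finsupp.single p q) =
      Finsupp.single p (algebraMap Q (ResidueField R) q) :=
  Finsupp.mapRange_single (hf := map_zero _)

/-- The reduction of the differential of the bar construction. -/
def barRes (m : List A.Pos → (A.Pos →₀ Q)) (mG : List A.Pos → G.ι → (G.ι →₀ Q)) :
    (List A.Pos × G.ι →₀ ResidueField R) →ₗ[ResidueField R]
      (List A.Pos × G.ι →₀ ResidueField R) :=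
  Finsupp.linearCombination _ fun p => residueMap R (List A.Pos × G.ι) ((A.bar m G mG).d p)

/-- The part of degree `j` of the reduction of the bar construction. -/
def barPart (A : FreeComplex Q R) (G : FreeComplex Q X) (j : ℕ) :
    Submodule (ResidueField R) (List A.Pos × G.ι →₀ ResidueField R) :=
  Finsupp.supported _ _ {p | A.barDeg G p = j}

lemma barRes_single (w : List A.Pos) (c : G.ι) :
    barRes m mG (Finsupp.single (w, c) 1) =
      barDiff m mG (fun u c' => (Finsupp.single (u, c') 1 :
        List A.Pos × G.ι →₀ ResidueField R)) w c := by
  have h1 : (fun u c' => (Finsupp.single (u, c') 1 : List A.Pos × G.ι →₀ ResidueField R)) =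
      fun u c' => A.toResidue G.ι (Finsupp.single (u, c') 1) := by
    funext u c'
    rw [toResidue_single, map_one]
  rw [h1, ← map_preBar_single, barRes, Finsupp.linearCombination_single, one_smul, bar_d]
  ext p
  rfl

/-- Modulo the maximal ideal the algebra operations vanish by `hm`, and the module operation on the
whole word vanishes because `hdeg` leaves it no target. Nothing can then touch the first letter. -/
lemma barRes_single_cons
    (hm : ∀ w b, algebraMap Q (ResidueField R) (m w b) = 0)
    (hpG : A.IsPreAInfModule G mG) (x : A.Pos) (w : List A.Pos) (c : G.ι)
    (hdeg : ∀ y, G.deg y + 1 ≠ A.wordDeg (x :: w) + G.deg c) :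
    barRes m mG (Finsupp.single (x :: w, c) 1) =
      A.sgn [x] • consMap (ResidueField R) A G.ι x
        (barRes m mG (Finsupp.single (w, c) 1)) := by
  rw [barRes_single]
  refine Eq.trans ?_ (congrArg (fun z => A.sgn [x] • consMap (ResidueField R) A G.ι x z)
    (barRes_single w c).symm)
  have h1 : mG (x :: w) c = 0 := by
    ext y
    by_contra hy
    exact hdeg y (hpG.degree _ _ _ hy)
  rw [barDiff_cons, h1, pair_zero_left, add_zero, splitSum_eq_zero, zero_add]
  · congr 1
    refine Eq.trans ?_ (map_barDiff ((consMap (ResidueField R) A G.ι x).restrictScalars Q) _ w c)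
    congr 1
    funext u c'
    exact (consMap_single _ x u c' 1).symm
  · intro v z _
    rw [pair_def]
    refine Finset.sum_eq_zero fun b _ => ?_
    dsimp only
    rw [← algebraMap_smul (ResidueField R), hm, zero_smul]

/-- In degree at least `c + 2` there are no empty words, and a module operation on a whole word
would land in degree at least `c + 1`, above the top of `G`. The image of the reduced differential
is therefore the direct sum, over first letters, of images in lower degrees. -/
lemma resRank_bar [Fintype A.Pos] [Finite A.ι] [Finite G.ι]
    (hm : ∀ w b, algebraMap Q (ResidueField R) (m w b) = 0)
    (hpG : A.IsPreAInfModule G mG) {c : ℕ} (hc : ∀ y, G.deg y ≤ c) {i : ℕ} (hi : c + 2 ≤ i) :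
    (A.bar m G mG).resRank i = A.shiftSum (A.bar m G mG).resRank i := by
  classical
  -- The summand belonging to the first letter `x`; it is zero if `x` alone exceeds the degree `i`.
  let W : A.Pos → Submodule (ResidueField R) (List A.Pos × G.ι →₀ ResidueField R) := fun x =>
    if A.deg x + 1 ≤ i then
      (A.barPart G (i - (A.deg x + 1))).map (barRes m mG) else ⊥
  have hfinW : ∀ x, Module.Finite (ResidueField R) (W x) := by
    intro x
    have h0 : Module.Finite (ResidueField R)
        (A.barPart G (i - (A.deg x + 1)) : Submodule (ResidueField R) _) :=
      finite_resPart (F := A.bar m G mG) finite_bar_deg_eq _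
    by_cases hx : A.deg x + 1 ≤ i
    · rw [show W x = (A.barPart G (i - (A.deg x + 1))).map (barRes m mG) from if_pos hx]
      exact Module.Finite.map _ _
    · rw [show W x = ⊥ from if_neg hx]
      exact Module.Finite.bot _ _
  let Ψ : (∀ x, W x) →ₗ[ResidueField R] (List A.Pos × G.ι →₀ ResidueField R) :=
    ∑ x, (consMap (ResidueField R) A G.ι x).comp ((W x).subtype.comp (LinearMap.proj x))
  have hΨ : ∀ z, Ψ z = ∑ x, consMap (ResidueField R) A G.ι x (z x) := by
    intro z
    simp [Ψ]
  have hinj : Function.Injective Ψ := by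
    rw [injective_iff_map_eq_zero]
    intro z hz
    funext x
    ext ⟨w, d⟩
    have h := DFunLike.congr_fun hz (x :: w, d)
    rw [hΨ, Finsupp.finsetSum_apply, Finset.sum_eq_single x, consMap_apply] at h
    · exact h
    · intro y _ hy
      exact consMap_apply_of_ne _ hy.symm _ _ _
    · exact fun h => absurd (Finset.mem_univ x) h
  have hrange : LinearMap.range Ψ = (A.barPart G i).map (barRes m mG) := by
    have hcons : ∀ x w d, A.barDeg G (x :: w, d) = i →
        barRes m mG (Finsupp.single (x :: w, d) 1) = A.sgn [x] •
          consMap (ResidueField R) A G.ι x (barRes m mG (Finsupp.single (w, d) 1)) := by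
      intro x w d hd
      refine barRes_single_cons hm hpG x w d fun y hy => ?_
      have := hc y
      simp only [barDeg] at hd
      omega
    have hspan : ∀ j, A.barPart G j = Submodule.span (ResidueField R)
        ((fun p => (Finsupp.single p 1 : List A.Pos × G.ι →₀ ResidueField R)) ''
          {p | A.barDeg G p = j}) :=
      fun j => Finsupp.supported_eq_span_single (ResidueField R) {p | A.barDeg G p = j}
    apply le_antisymm
    · rintro _ ⟨z, rfl⟩
      rw [hΨ]
      refine Submodule.sum_mem _ fun x _ => ?_
      have hz := (z x).2
      generalize ((z x : W x) : List A.Pos × G.ι →₀ ResidueField R) = v at hz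
      dsimp only [W] at hz
      split_ifs at hz with hx
      · have hle : (A.barPart G (i - (A.deg x + 1))).map (barRes m mG) ≤
            ((A.barPart G i).map (barRes m mG)).comap
              (consMap (ResidueField R) A G.ι x) := by
          rw [hspan, Submodule.map_span, Submodule.span_le]
          rintro _ ⟨_, ⟨⟨w, d⟩, hp, rfl⟩, rfl⟩
          rw [SetLike.mem_coe, Submodule.mem_comap]
          have hp' : A.barDeg G (x :: w, d) = i := by
            change A.barDeg G (w, d) = _ at hp
            simp only [barDeg, wordDeg_cons] at hp ⊢
            omega
          have h3 := hcons x w d hp'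
          have h4 : consMap (ResidueField R) A G.ι x
              (barRes m mG (Finsupp.single (w, d) 1)) =
              A.sgn [x] • barRes m mG (Finsupp.single (x :: w, d) 1) := by
            rw [h3, smul_smul, sgn_mul_sgn, one_smul]
          dsimp only
          rw [h4]
          refine zsmul_mem ?_ _
          exact Submodule.mem_map_of_mem (Finsupp.single_mem_supported _ _ hp')
        exact hle hz
      · rw [(Submodule.mem_bot _).1 hz, map_zero]
        exact zero_mem _
    · rw [hspan, Submodule.map_span, Submodule.span_le]
      rintro _ ⟨_, ⟨⟨_ | ⟨x, w⟩, d⟩, hp, rfl⟩, rfl⟩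
      · have := hc d
        change A.wordDeg [] + G.deg d = i at hp
        rw [wordDeg_nil] at hp
        omega
      · change A.wordDeg (x :: w) + G.deg d = i at hp
        have hx : A.deg x + 1 ≤ i := by
          rw [wordDeg_cons] at hp
          omega
        have hmem : barRes m mG (Finsupp.single (w, d) 1) ∈ W x := by
          dsimp only [W]
          rw [if_pos hx]
          refine Submodule.mem_map_of_mem (Finsupp.single_mem_supported _ _ ?_)
          change A.wordDeg w + G.deg d = _
          rw [wordDeg_cons] at hp
          omega
        change barRes m mG (Finsupp.single (x :: w, d) 1) ∈ LinearMap.range Ψ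
        rw [hcons x w d hp]
        refine zsmul_mem (LinearMap.mem_range.2 ⟨Pi.single x ⟨_, hmem⟩, ?_⟩) _
        rw [hΨ, Finset.sum_eq_single x]
        · rw [Pi.single_eq_same]
        · intro y _ hy
          rw [Pi.single_eq_of_ne hy]
          exact map_zero _
        · exact fun h => absurd (Finset.mem_univ x) h
  have h1 : (A.bar m G mG).resRank i = Module.finrank (ResidueField R) (∀ x, W x) := by
    rw [← LinearMap.finrank_range_of_inj hinj, hrange]
    rfl
  have hfree : ∀ x, Module.Free (ResidueField R) (W x) := fun x =>
    Module.Free.of_divisionRing (ResidueField R) (W x)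
  rw [h1, Module.finrank_pi_fintype]
  refine Finset.sum_congr rfl fun x _ => ?_
  split_ifs with hx
  · rw [show W x = (A.barPart G (i - (A.deg x + 1))).map (barRes m mG) from if_pos hx]
    rfl
  · rw [show W x = ⊥ from if_neg hx]
    exact finrank_bot _ _

end Rank

end FreeComplex

end

noncomputable section

open IsLocalRing CategoryTheory

namespace FreeComplex

/-! ### Minimal resolutions over regular local rings -/

section Regular

variable {Q X : Type u} [CommRing Q] [IsRegularLocalRing Q] [AddCommGroup X] [Module Q X]
  {F : FreeComplex Q X}

lemma _root_.IsRegularLocalRing.exists_nat_eq_ringKrullDim (Q : Type u) [CommRing Q]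
    [IsRegularLocalRing Q] : ∃ d : ℕ, ringKrullDim Q = d :=
  ⟨_, (IsRegularLocalRing.spanFinrank_maximalIdeal).symm⟩

variable [Module.Finite Q X]

lemma _root_.IsRegularLocalRing.hasProjectiveDimensionLE {d : ℕ} (hd : ringKrullDim Q ≤ d) :
    HasProjectiveDimensionLE (ModuleCat.of Q X) d :=
  (projectiveDimension_le_iff _ _).1
    ((IsRegularLocalRing.projectiveDimension_le_ringKrullDim X).trans hd)

lemma IsMinimalFreeResolution.deg_le (hF : F.IsMinimalFreeResolution) {d : ℕ}
    (hd : ringKrullDim Q ≤ d) (x : F.ι) : F.deg x ≤ d :=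
  (hF.isMinimalBelow d).deg_le (IsRegularLocalRing.hasProjectiveDimensionLE hd) x

lemma IsMinimalFreeResolution.deg_le_ringKrullDim (hF : F.IsMinimalFreeResolution) (x : F.ι) :
    (F.deg x : WithBot ℕ∞) ≤ ringKrullDim Q := by
  obtain ⟨d, hd⟩ := IsRegularLocalRing.exists_nat_eq_ringKrullDim Q
  rw [hd]
  exact_mod_cast hF.deg_le hd.le x

lemma IsMinimalFreeResolution.finite (hF : F.IsMinimalFreeResolution) : Finite F.ι := by
  obtain ⟨d, hd⟩ := IsRegularLocalRing.exists_nat_eq_ringKrullDim Q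
  rw [← Set.finite_univ_iff]
  refine ((Set.finite_Iic d).biUnion fun m _ => hF.finite_deg_eq m).subset ?_
  exact fun x _ => Set.mem_biUnion (hF.deg_le hd.le x) rfl

lemma IsMinimalStart.isMinimalFreeResolution_of_ringKrullDim_le {n : ℕ}
    (hF : F.IsMinimalStart n) (hn : ringKrullDim Q ≤ n) : F.IsMinimalFreeResolution :=
  hF.isMinimalFreeResolution (IsRegularLocalRing.hasProjectiveDimensionLE hn)

variable (Q X) in
lemma exists_isMinimalFreeResolution : ∃ F : FreeComplex Q X, F.IsMinimalFreeResolution := by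
  obtain ⟨d, hd⟩ := IsRegularLocalRing.exists_nat_eq_ringKrullDim Q
  obtain ⟨F, hF⟩ := exists_isMinimalStart (S := Q) (X := X) d
  exact ⟨F, hF.isMinimalFreeResolution_of_ringKrullDim_le hd.le⟩

end Regular

section Module

variable {Q R X : Type u} [CommRing Q] [CommRing R] [Algebra Q R] [AddCommGroup X] [Module Q X]
  [Module R X] {A : FreeComplex Q R} {e : A.ι} {m : List A.Pos → (A.Pos →₀ Q)}
  {G : FreeComplex Q X} {mG : List A.Pos → G.ι → (G.ι →₀ Q)}

lemma exists_isAInfModule [IsScalarTower Q R X] [Finite A.ι] [Finite G.ι] (hA : A.IsComplex)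
    (he : A.IsUnital e) (hm : A.IsAInfAlgebra e m) (hG : G.IsFreeResolution) :
    ∃ mG, A.IsAInfModule e m G mG := by
  obtain ⟨d, hd⟩ := (Set.finite_range A.deg).bddAbove
  obtain ⟨d', hd'⟩ := (Set.finite_range G.deg).bddAbove
  have hd : ∀ x, A.deg x ≤ d := fun x => hd ⟨x, rfl⟩
  have hd' : ∀ x, G.deg x ≤ d' := fun x => hd' ⟨x, rfl⟩
  have h : ∀ N, ∃ mG, A.IsAInfModuleUpTo e m G N mG := by
    intro N
    induction N with
    | zero => exact exists_isAInfModuleUpTo_zero hG.isComplex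
    | succ N ih =>
      obtain ⟨mG, hmG⟩ := ih
      obtain ⟨mG', -, h⟩ := hmG.exists_succ hA he hm hG hd hd'
      exact ⟨mG', h⟩
  obtain ⟨mG, hmG⟩ := h (d' + 2)
  exact ⟨mG, hmG.isAInfModule hA he.deg_eq hm hd' (by omega)⟩

/-- Every coefficient of every `m_n` is an entry of the bar differential. The module operations do
not interfere: returning the same `c` would require a word of degree `1`, and no word has that
degree. -/
lemma bar_d_singleton_apply (hm : m [] = 0) (hpG : A.IsPreAInfModule G mG) (w : List A.Pos)
    (b : A.Pos) (c : G.ι) :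
    (A.bar m G mG).d (w, c) ([b], c) = algebraMap Q R (m w b) := by
  classical
  have key : barDiff m mG (fun u c' => Finsupp.lapply (R := Q) ([b], c)
      (Finsupp.single (u, c') (1 : Q))) w c = m w b := by
    have h1 : (fun u => Finsupp.lapply (R := Q) ([b], c) (Finsupp.single (u, c) (1 : Q))) =
        fun u => Finsupp.lapply (R := Q) b (A.proj u) := by
      funext u
      rcases u with _ | ⟨x, _ | ⟨y, u⟩⟩
      · simp
      · simp [Finsupp.single_apply]
      · rw [show A.proj (x :: y :: u) = 0 from rfl]
        simp
    rw [barDiff, h1, map_coder, coder_proj w hm, splitSum_eq_zero, add_zero]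
    · rfl
    · intro u v _
      rw [pair_def]
      refine (congrArg _ (Finset.sum_eq_zero fun c' hc' => ?_)).trans (smul_zero _)
      dsimp only
      rw [Finsupp.lapply_apply, Finsupp.single_apply, if_neg, smul_zero]
      intro h
      have h2 : c' = c := congrArg Prod.snd h
      subst h2
      have h3 := hpG.degree _ _ _ (Finsupp.mem_support_iff.1 hc')
      rcases v with _ | ⟨x, v⟩
      · rw [wordDeg_nil] at h3
        omega
      · rw [wordDeg_cons] at h3
        have := x.2
        omega
  refine (DFunLike.congr_fun (bar_d (A := A) (m := m) (G := G) (mG := mG) w c) _).trans ?_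
  rw [← key]
  exact congrArg (algebraMap Q R) (map_preBar_single (Finsupp.lapply (R := Q) ([b], c)) w c)

lemma IsUnital.rankAt_zero (he : A.IsUnital e) : A.rankAt 0 = 1 := by
  rw [rankAt, Set.ncard_eq_one]
  exact ⟨e, Set.ext fun x => ⟨he.unique x, fun h => (congrArg A.deg h).trans he.deg_eq⟩⟩

lemma rankAt_eq_card_pos [Fintype A.Pos] {n : ℕ} (hn : n ≠ 0) :
    A.rankAt n = (Finset.univ.filter fun x : A.Pos => A.deg x = n).card := by
  classical
  rw [← Set.ncard_coe_finset, rankAt, ← Set.ncard_image_of_injective _ Subtype.val_injective]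
  congr 1
  ext x
  simp only [Set.mem_ofPred_eq, Finset.coe_filter, Finset.mem_univ, true_and, Set.mem_image,
    Subtype.exists, exists_and_left, exists_prop, exists_eq_right_right]
  exact ⟨fun h => ⟨h, by omega⟩, fun h => h.1⟩

end Module

/-! ### Golod modules -/

section Golod

variable {Q R X : Type u} [CommRing Q] [IsLocalRing Q] [CommRing R] [Algebra Q R]
  [AddCommGroup X] [Module Q X] [Module R X] {A : FreeComplex Q R} {e : A.ι}
  {m : List A.Pos → (A.Pos →₀ Q)} {G : FreeComplex Q X} {mG : List A.Pos → G.ι → (G.ι →₀ Q)}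

lemma X_mul_poincareSeries_sub_one [Fintype A.Pos] [Finite A.ι] (hA : A.IsMinimalFreeResolution)
    (he : A.IsUnital e) : PowerSeries.X * (poincareSeries Q R - 1) =
      ∑ x : A.Pos, PowerSeries.X ^ (A.deg x + 1) := by
  have hbetti : ∀ n, bettiNumber Q R n = A.rankAt n :=
    hA.bettiNumber_eq fun n => Set.toFinite _
  ext n
  rw [map_sum]
  simp only [PowerSeries.coeff_X_pow]
  rcases n with _ | n
  · simp
  · rw [PowerSeries.coeff_succ_X_mul, map_sub, poincareSeries_eq, PowerSeries.coeff_mk,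
      PowerSeries.coeff_one, hbetti]
    split_ifs with hn
    · subst hn
      rw [he.rankAt_zero, Nat.cast_one, sub_self]
      refine (Finset.sum_eq_zero fun x _ => if_neg ?_).symm
      have := x.2
      omega
    · rw [sub_zero, rankAt_eq_card_pos hn, Finset.sum_boole]
      simp only [Nat.add_right_cancel_iff, eq_comm]

variable [IsLocalRing R]

/-- Golod modules are characterized by a recursion for their Betti numbers. -/
lemma isGolodModule_iff [Fintype A.Pos] [Finite A.ι] (hA : A.IsMinimalFreeResolution)
    (he : A.IsUnital e) : IsGolodModule Q R X ↔ ∀ n,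
      bettiNumber R X n = bettiNumber Q X n + A.shiftSum (bettiNumber R X) n := by
  rw [IsGolodModule, X_mul_poincareSeries_sub_one hA he, PowerSeries.eq_mul_inv_iff_mul_eq (by
    rw [map_sub, map_one, map_sum, Finset.sum_eq_zero, sub_zero]
    · exact one_ne_zero
    · intro x _
      simp), mul_sub, mul_one, sub_eq_iff_eq_add, PowerSeries.ext_iff]
  refine forall_congr' fun n => ?_
  rw [map_add, Finset.mul_sum, map_sum]
  simp only [PowerSeries.coeff_mul_X_pow', poincareSeries_eq, PowerSeries.coeff_mk, shiftSum]
  rw [← Nat.cast_inj (R := ℚ)]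
  push_cast
  rfl

variable [Fintype A.Pos] [Finite A.ι] [Finite G.ι]

/-- If the Betti numbers of `X` over `R` satisfy the recursion of a Golod module as an inequality,
the bar construction is minimal. -/
lemma bar_isMinimalFreeResolution (hL : (A.bar m G mG).IsFreeResolution)
    (hG : G.IsMinimalFreeResolution) (h : ∀ n, bettiNumber Q X n +
      A.shiftSum (bettiNumber R X) n ≤ bettiNumber R X n) :
    (A.bar m G mG).IsMinimalFreeResolution := by
  -- The lower bound on the Betti numbers propagates to a bound on the ranks. As a rank exceeds the
  -- Betti number by the ranks of two reduced differentials, these must be zero.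
  have hle : ∀ n, (A.bar m G mG).rankAt n ≤ bettiNumber R X n := by
    intro n
    induction n using Nat.strong_induction_on with
    | _ n ih =>
      rw [rankAt_bar, ← hG.bettiNumber_eq (fun n => Set.toFinite _)]
      exact (Nat.add_le_add_left (shiftSum_mono ih) _).trans (h n)
  refine ⟨hL.isComplex, hL.surjective, hL.exact, fun p q =>
    d_mem_of_resRank_eq_zero (fun n => finite_bar_deg_eq n) p ?_ q⟩
  have h1 := bettiNumber_add (fun n => finite_bar_deg_eq n) hL ((A.bar m G mG).deg p)
  have h2 := hle ((A.bar m G mG).deg p)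
  omega

lemma isGolodModule_of_bar (hA : A.IsMinimalFreeResolution) (he : A.IsUnital e)
    (hG : G.IsMinimalFreeResolution) (hL : (A.bar m G mG).IsMinimalFreeResolution) :
    IsGolodModule Q R X := by
  rw [isGolodModule_iff hA he]
  intro n
  have h : bettiNumber R X = (A.bar m G mG).rankAt :=
    funext (hL.bettiNumber_eq fun n => finite_bar_deg_eq n)
  rw [h, rankAt_bar, ← hG.bettiNumber_eq (fun n => Set.toFinite _)]

end Golod

/-- Over a Golod ring the operations of an A-infinity structure on the minimal resolution are
minimal. -/
lemma IsGolodRing.algebraMap_residueField_eq_zero {Q R : Type u} [CommRing Q]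
    [IsRegularLocalRing Q] [CommRing R] [IsLocalRing R] [Algebra Q R]
    (hsurj : Function.Surjective (algebraMap Q R)) (hGolod : IsGolodRing Q R)
    {A : FreeComplex Q R} {e : A.ι} {m : List A.Pos → (A.Pos →₀ Q)} [Finite A.ι]
    (hA : A.IsMinimalFreeResolution) (he : A.IsUnital e) (hm : A.IsAInfAlgebra e m)
    (w : List A.Pos) (b : A.Pos) : algebraMap Q (ResidueField R) (m w b) = 0 := by
  have := Fintype.ofFinite A.Pos
  have hfin : Module.Finite Q (ResidueField R) :=
    Module.Finite.of_surjective (Algebra.linearMap Q (ResidueField R))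
      (residue_surjective.comp hsurj)
  obtain ⟨G, hG⟩ := exists_isMinimalFreeResolution Q (ResidueField R)
  have := hG.finite
  obtain ⟨mG, hmG⟩ := exists_isAInfModule hA.isComplex he hm hG.isFreeResolution
  have hL := bar_isFreeResolution hsurj hA.isFreeResolution he hm hG.isFreeResolution hmG
  have hmin := bar_isMinimalFreeResolution hL hG
    fun n => ((isGolodModule_iff hA he).1 hGolod n).ge
  -- The residue field is nonzero, so there is a basis element `c` at which the coefficients of `m`
  -- can be read off the minimal bar differential.
  have hne : Nonempty G.ι := by
    by_contra hempty
    rw [not_nonempty_iff] at hempty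
    obtain ⟨z, hz⟩ := hG.surjective 1
    rw [Subsingleton.elim z 0, map_zero] at hz
    exact zero_ne_one hz
  obtain ⟨c⟩ := hne
  have h := hmin.minimal (w, c) ([b], c)
  rw [bar_d_singleton_apply (isAInfAlgebra_iff.1 hm).1.map_nil (isAInfModule_iff.1 hmG).1] at h
  exact (residue_eq_zero_iff _).2 h

end FreeComplex

end

noncomputable section

open IsLocalRing CategoryTheory

namespace FreeComplex

/-! ### Betti numbers of syzygies -/

section Splice

variable {S X : Type u} [CommRing S] [AddCommGroup X] [Module S X]
  {F : FreeComplex S X} {n : ℕ} {L : FreeComplex S (F.syzygy n)}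

lemma splice_rankAt_of_le {j : ℕ} (hj : j ≤ n) : (F.splice n L).rankAt j = F.rankAt j := by
  refine Eq.trans ?_ (Set.ncard_image_of_injective {x | F.deg x = j}
    (Sum.inl_injective (β := L.ι)))
  refine congrArg Set.ncard (Set.ext (α := F.ι ⊕ L.ι) fun x => ?_)
  constructor
  · intro hx
    rcases x with x | x
    · exact ⟨x, hx, rfl⟩
    · have : L.deg x + n + 1 = j := hx
      omega
  · rintro ⟨x, hx, rfl⟩
    exact hx

lemma splice_rankAt_succ (hF : ∀ x, F.deg x ≤ n) :
    (F.splice n L).rankAt (n + 1) = L.rankAt 0 := by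
  refine Eq.trans ?_ (Set.ncard_image_of_injective {x | L.deg x = 0}
    (Sum.inr_injective (α := F.ι)))
  refine congrArg Set.ncard (Set.ext (α := F.ι ⊕ L.ι) fun x => ?_)
  constructor
  · intro hx
    rcases x with x | x
    · have h1 : F.deg x = n + 1 := hx
      have := hF x
      omega
    · have h1 : L.deg x + n + 1 = n + 1 := hx
      exact ⟨x, show L.deg x = 0 by omega, rfl⟩
  · rintro ⟨x, hx, rfl⟩
    change L.deg x + n + 1 = n + 1
    rw [show L.deg x = 0 from hx, zero_add]

lemma finite_splice_deg_eq [Finite F.ι] (hfin : ∀ j, {x | L.deg x = j}.Finite) (j : ℕ) :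
    {x | (F.splice n L).deg x = j}.Finite := by
  refine (((Set.finite_univ (α := F.ι)).image Sum.inl).union
    ((hfin (j - (n + 1))).image Sum.inr)).subset ?_
  rintro (x | x) hx
  · exact Or.inl ⟨x, trivial, rfl⟩
  · have h1 : L.deg x + n + 1 = j := hx
    exact Or.inr ⟨x, show L.deg x = j - (n + 1) by omega, rfl⟩

variable [IsLocalRing S]

/-- Only the first differential of `L` is assumed minimal. In the splice it starts in degree `n +
2`, and all earlier differentials are minimal because `F` is. -/
lemma splice_d_mem (hF : F.IsMinimalStart n) (hL : L.IsComplex)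
    (hL1 : ∀ x, L.deg x = 1 → ∀ y, L.d x y ∈ maximalIdeal S) (x : (F.splice n L).ι)
    (hx : (F.splice n L).deg x ≤ n + 2) (y : (F.splice n L).ι) :
    (F.splice n L).d x y ∈ maximalIdeal S := by
  rcases x with x | x
  · rw [splice_d_inl]
    rcases y with y | y
    · rw [spliceJoin_inl]
      exact hF.isMinimalBelow.d_mem x y
    · rw [spliceJoin_inr]
      exact zero_mem _
  · change L.deg x + n + 1 ≤ n + 2 at hx
    rw [splice_d_inr]
    rcases y with y | y
    · rw [spliceJoin_inl]
      exact hF.minimal _ (L.ε x).2.2.1 (L.ε x).2.2.2 y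
    · rw [spliceJoin_inr]
      by_cases hxy : L.d x y = 0
      · rw [show (L.ε x, L.d x).2 y = L.d x y from rfl, hxy]
        exact zero_mem _
      · have := hL.deg_d x y hxy
        exact hL1 x (by omega) y

/-- Reading off the Betti number in degree `j` needs minimality of the differentials out of degrees
`j` and `j + 1`, hence the bound `n + 1`. -/
lemma splice_bettiNumber (hF : F.IsMinimalStart n) [Finite F.ι]
    (hfin : ∀ j, {x | L.deg x = j}.Finite) (hL : L.IsFreeResolution)
    (hL1 : ∀ x, L.deg x = 1 → ∀ y, L.d x y ∈ maximalIdeal S) {j : ℕ} (hj : j ≤ n + 1) :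
    bettiNumber S X j = (F.splice n L).rankAt j := by
  have h := bettiNumber_add (finite_splice_deg_eq hfin)
    (IsFreeResolution.splice hF.isResolutionBelow hF.deg_le hL) j
  rwa [resRank_eq_zero fun x hx => splice_d_mem hF hL.isComplex hL1 x (by omega),
    resRank_eq_zero fun x hx => splice_d_mem hF hL.isComplex hL1 x (by omega)] at h

lemma bettiNumber_zero_eq_rankAt (hfin : ∀ j, {x | L.deg x = j}.Finite)
    (hL : L.IsFreeResolution) (hL1 : ∀ x, L.deg x = 1 → ∀ y, L.d x y ∈ maximalIdeal S) :
    bettiNumber S (F.syzygy n) 0 = L.rankAt 0 := by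
  have h := bettiNumber_add hfin hL 0
  rwa [resRank_zero hL.isComplex, resRank_eq_zero hL1] at h

lemma bettiNumber_syzygy_zero (hF : F.IsMinimalStart n) [Finite F.ι]
    (hfin : ∀ j, {x | L.deg x = j}.Finite) (hL : L.IsFreeResolution)
    (hL1 : ∀ x, L.deg x = 1 → ∀ y, L.d x y ∈ maximalIdeal S) :
    bettiNumber S (F.syzygy n) 0 = bettiNumber S X (n + 1) := by
  rw [bettiNumber_zero_eq_rankAt hfin hL hL1, splice_bettiNumber hF hfin hL hL1 le_rfl,
    splice_rankAt_succ hF.deg_le]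

lemma bettiNumber_syzygy_succ (hF : F.IsResolutionBelow n) (i : ℕ) :
    bettiNumber S (F.syzygy n) (i + 1) = bettiNumber S X (i + n + 2) := by
  rw [bettiNumber, bettiNumber, torLength_eq_syzygy hF n i le_rfl]

end Splice

section Restrict

variable {Q R X : Type u} [CommRing Q] [IsLocalRing Q] [CommRing R] [Algebra Q R]
  [AddCommGroup X] [Module R X] {F : FreeComplex R X}

lemma torLength_restrict_degreePart_le [Finite F.ι] (j n : ℕ) :
    torLength Q (F.degreePart j) n ≤ F.rankAt j * torLength Q R n := by
  have e1 : F.degreePart j ≃ₗ[R] ({x | F.deg x = j} →₀ R) :=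
    Finsupp.supportedEquivFinsupp {x | F.deg x = j}
  have e2 : ({x | F.deg x = j} →₀ R) ≃ₗ[R] ({x | F.deg x = j} → R) :=
    Finsupp.linearEquivFunOnFinite R R _
  have e3 : ({x | F.deg x = j} → R) ≃ₗ[R] (Fin (F.rankAt j) → R) :=
    LinearEquiv.funCongrLeft R R (Finite.equivFin {x | F.deg x = j}).symm
  rw [torLength_congr ((e1.trans (e2.trans e3)).restrictScalars Q) n]
  exact torLength_pi_le _ _ _

variable [Module Q X] [IsScalarTower Q R X]

/-- Iteration of the long exact sequence of Tor over `Q` along `F`, each `F_j` being a direct sum of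
copies of `R`. -/
lemma torLength_restrict_syzygy_le [Finite F.ι] {N : ℕ} (hF : F.IsResolutionBelow N) (n i : ℕ)
    (hn : n ≤ N) : torLength Q (F.syzygy n) i ≤ torLength Q X (i + n + 1) +
      ∑ j ∈ Finset.range (n + 1), F.rankAt j * torLength Q R (i + n - j) := by
  induction n generalizing i with
  | zero =>
    have h := torLength_left_le (S := Q) (N := F.syzygy 0) (F := F.degreePart 0) (Z := X)
      (f := (F.syzygyIncl 0).restrictScalars Q) (g := F.augZero.restrictScalars Q)
      (syzygyIncl_injective 0) hF.augZero_surjective (augZero_exact hF.isComplex) i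
    rw [zero_add, Finset.sum_range_one]
    exact h.trans (add_le_add le_rfl (torLength_restrict_degreePart_le 0 i))
  | succ n ih =>
    have h := torLength_left_le (S := Q) (N := F.syzygy (n + 1)) (F := F.degreePart (n + 1))
      (Z := F.syzygy n) (f := (F.syzygyIncl (n + 1)).restrictScalars Q)
      (g := (toSyzygy hF.isComplex n).restrictScalars Q)
      (syzygyIncl_injective (n + 1)) (hF.toSyzygy_surjective (by omega))
      (toSyzygy_exact hF.isComplex n) i
    refine (h.trans (add_le_add (ih (i + 1) (by omega))
      (torLength_restrict_degreePart_le (n + 1) i))).trans ?_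
    rw [Finset.sum_range_succ _ (n + 1), add_assoc, show i + (n + 1) - (n + 1) = i by omega,
      show i + 1 + n = i + (n + 1) by omega]

end Restrict

section Shift

variable {Q R : Type u} [CommRing Q] [CommRing R] [Algebra Q R] {A : FreeComplex Q R}
  [Fintype A.Pos]

lemma shiftSum_succ {f : ℕ → ℕ} (h0 : f 0 = 0) (i : ℕ) :
    A.shiftSum f (i + 1) = A.shiftSum (fun j => f (j + 1)) i := by
  refine Finset.sum_congr rfl fun x _ => ?_
  by_cases h1 : A.deg x + 1 ≤ i
  · rw [if_pos h1, if_pos (by omega), show i + 1 - (A.deg x + 1) = i - (A.deg x + 1) + 1 by omega]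
  · rw [if_neg h1]
    split_ifs with h2
    · rw [show i + 1 - (A.deg x + 1) = 0 by omega, h0]
    · rfl

/-- Separates the arguments of `f` beyond `c` from those up to `c`. The latter are grouped by `j`,
the letters with a given `j` being those of degree `i + c - j`; as `i ≠ 0`, this degree is positive,
so `A.rankAt` counts them all. -/
lemma shiftSum_add_eq (f : ℕ → ℕ) {i : ℕ} (hi : i ≠ 0) (c : ℕ) :
    A.shiftSum f (i + c + 1) = A.shiftSum (fun j => f (j + c + 1)) i +
      ∑ j ∈ Finset.range (c + 1), f j * A.rankAt (i + c - j) := by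
  have h1 : ∀ j ∈ Finset.range (c + 1), f j * A.rankAt (i + c - j) =
      ∑ x : A.Pos, if A.deg x = i + c - j then f j else 0 := by
    intro j hj
    rw [Finset.mem_range] at hj
    rw [rankAt_eq_card_pos (by omega), ← Finset.sum_filter, Finset.sum_const, smul_eq_mul,
      mul_comm]
  rw [Finset.sum_congr rfl h1, Finset.sum_comm, shiftSum, shiftSum, ← Finset.sum_add_distrib]
  refine Finset.sum_congr rfl fun x _ => ?_
  rcases Nat.lt_or_ge (A.deg x) i with h | h
  · rw [if_pos (by omega), if_pos (by omega), Finset.sum_eq_zero, add_zero]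
    · congr 1
      omega
    · intro j hj
      rw [Finset.mem_range] at hj
      exact if_neg (by omega)
  · rw [if_neg (by omega : ¬ A.deg x + 1 ≤ i), zero_add]
    split_ifs with h2
    · rw [Finset.sum_eq_single (i + c - A.deg x), if_pos (by omega)]
      · congr 1
        omega
      · intro j hj hne
        rw [Finset.mem_range] at hj
        exact if_neg (by omega)
      · intro hj
        rw [Finset.mem_range] at hj
        omega
    · refine (Finset.sum_eq_zero fun j hj => ?_).symm
      rw [Finset.mem_range] at hj
      exact if_neg (by omega)

end Shift

section Recursion

variable {Q R X : Type u} [CommRing Q] [CommRing R] [IsLocalRing R] [Algebra Q R]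
  [AddCommGroup X] [Module Q X] [Module R X] {A : FreeComplex Q R} {e : A.ι}
  {m : List A.Pos → (A.Pos →₀ Q)} {G : FreeComplex Q X} {mG : List A.Pos → G.ι → (G.ι →₀ Q)}

/-- The ranks and, by `resRank_bar`, the two ranks of reduced differentials satisfy the same
recursion, and the Betti number is their difference. The term of `G` is absent above degree `c`. -/
lemma bettiNumber_eq_shiftSum [Fintype A.Pos] [Finite A.ι] [Finite G.ι]
    (hm : ∀ w b, algebraMap Q (ResidueField R) (m w b) = 0) (hpG : A.IsPreAInfModule G mG)
    (hL : (A.bar m G mG).IsFreeResolution) {c : ℕ} (hc : ∀ y, G.deg y ≤ c) {i : ℕ}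
    (hi : c + 2 ≤ i) : bettiNumber R X i = A.shiftSum (bettiNumber R X) i := by
  have hB := bettiNumber_add (fun n => finite_bar_deg_eq n) hL
  have h1 : A.shiftSum (A.bar m G mG).rankAt i = A.shiftSum (bettiNumber R X) i +
      A.shiftSum (fun j => (A.bar m G mG).resRank (j + 1)) i +
      A.shiftSum (A.bar m G mG).resRank i := by
    rw [← shiftSum_add, ← shiftSum_add]
    exact shiftSum_congr fun j _ => (hB j).symm
  have h2 : G.rankAt i = 0 := by
    rw [rankAt, Set.ncard_eq_zero]
    ext y
    have := hc y
    simp only [Set.mem_ofPred_eq, Set.mem_empty_iff_false, iff_false]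
    omega
  have h3 := rankAt_bar (A := A) (m := m) (G := G) (mG := mG) i
  have h4 := resRank_bar hm hpG hc hi
  have h5 := resRank_bar hm hpG hc (i := i + 1) (by omega)
  rw [shiftSum_succ (resRank_zero hL.isComplex)] at h5
  have h6 := hB i
  omega

variable [IsLocalRing Q]

lemma algebraMap_mem_maximalIdeal (hsurj : Function.Surjective (algebraMap Q R)) {q : Q}
    (hq : q ∈ maximalIdeal Q) : algebraMap Q R q ∈ maximalIdeal R := by
  have h : RingHom.ker ((residue R).comp (algebraMap Q R)) = maximalIdeal Q :=
    eq_maximalIdeal (RingHom.ker_isMaximal_of_surjective _ (residue_surjective.comp hsurj))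
  rw [← h] at hq
  exact (residue_eq_zero_iff _).1 hq

/-- A nonempty word has degree at least `2`, so in degree `1` only the differential of `G` occurs.
-/
lemma bar_d_mem_of_deg_eq_one (hsurj : Function.Surjective (algebraMap Q R))
    (hG : G.IsMinimalFreeResolution) (hpG : A.IsPreAInfModule G mG) (p : List A.Pos × G.ι)
    (hp : (A.bar m G mG).deg p = 1) (q : List A.Pos × G.ι) :
    (A.bar m G mG).d p q ∈ maximalIdeal R := by
  obtain ⟨w, c⟩ := p
  change A.wordDeg w + G.deg c = 1 at hp
  rcases w with _ | ⟨x, w⟩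
  · rw [show (A.bar m G mG).d ([], c) q = _ from DFunLike.congr_fun
      (bar_d (A := A) (m := m) (G := G) (mG := mG) [] c) q]
    refine algebraMap_mem_maximalIdeal hsurj ?_
    have h := map_preBar_single (m := m) (mG := mG) (Finsupp.lapply (R := Q) q) [] c
    rw [barDiff_nil, hpG.map_nil, pair_def] at h
    change Finsupp.lapply (R := Q) q _ ∈ _
    rw [h]
    exact Ideal.sum_mem _ fun c' _ => Ideal.mul_mem_right _ _ (hG.minimal c c')
  · rw [wordDeg_cons] at hp
    have := x.2
    omega

end Recursion

/-- The Betti numbers of a high syzygy over a Golod ring satisfy the recursion of a Golod module,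
as an inequality. -/
lemma bettiNumber_syzygy_le {Q R M : Type u} [CommRing Q] [IsLocalRing Q] [CommRing R]
    [IsLocalRing R] [Algebra Q R] [AddCommGroup M] [Module R M] [Module Q M] [IsScalarTower Q R M]
    {A : FreeComplex Q R} [Finite A.ι] [Fintype A.Pos] (hA : A.IsMinimalFreeResolution) {c : ℕ}
    (hrec : ∀ i, c + 2 ≤ i → bettiNumber R M i = A.shiftSum (bettiNumber R M) i)
    (hpd : ∀ i, c < i → torLength Q M i = 0) {F : FreeComplex R M} [Finite F.ι]
    (hF : F.IsMinimalStart c) {L : FreeComplex R (F.syzygy c)}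
    (hfin : ∀ j, {x | L.deg x = j}.Finite) (hL : L.IsFreeResolution)
    (hL1 : ∀ x, L.deg x = 1 → ∀ y, L.d x y ∈ maximalIdeal R)
    (h0 : bettiNumber Q (F.syzygy c) 0 ≤ L.rankAt 0) (n : ℕ) :
    bettiNumber Q (F.syzygy c) n + A.shiftSum (bettiNumber R (F.syzygy c)) n ≤
      bettiNumber R (F.syzygy c) n := by
  have hsyz : ∀ j, bettiNumber R (F.syzygy c) j = bettiNumber R M (j + c + 1) := by
    rintro (_ | j)
    · rw [bettiNumber_syzygy_zero hF hfin hL hL1, zero_add]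
    · rw [bettiNumber_syzygy_succ hF.isResolutionBelow]
      congr 1
      omega
  rcases n with _ | n
  · have h1 : A.shiftSum (bettiNumber R (F.syzygy c)) 0 = 0 :=
      Finset.sum_eq_zero fun x _ => if_neg (by omega)
    rw [h1, add_zero, bettiNumber_zero_eq_rankAt hfin hL hL1]
    exact h0
  · have h1 := torLength_restrict_syzygy_le (Q := Q) hF.isResolutionBelow c (n + 1) le_rfl
    rw [hpd _ (by omega), zero_add] at h1
    -- Above the projective dimension `M` contributes no Tor, so only the terms of the free modules
    -- `F_j` remain; their ranks are the Betti numbers of `M`.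
    have h2 : bettiNumber Q (F.syzygy c) (n + 1) ≤
        ∑ j ∈ Finset.range (c + 1), bettiNumber R M j * A.rankAt (n + 1 + c - j) := by
      refine ENat.toNat_le_of_le_natCast (h1.trans_eq ?_)
      push_cast
      refine Finset.sum_congr rfl fun j hj => ?_
      rw [Finset.mem_range] at hj
      rw [torLength_eq_bettiNumber (fun n => Set.toFinite _) hA.isFreeResolution,
        hA.bettiNumber_eq (fun n => Set.toFinite _), splice_bettiNumber hF hfin hL hL1 (by omega),
        splice_rankAt_of_le (by omega)]
    -- The bound `h2` is exactly the part of the recursion for `M` in degree `n + c + 2` with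
    -- arguments at most `c`; the other part is the recursion sum for the syzygy.
    have h3 := shiftSum_add_eq (A := A) (bettiNumber R M) (i := n + 1) (by omega) c
    rw [hsyz, hrec _ (by omega), funext hsyz]
    omega

end FreeComplex

end

noncomputable section

open IsLocalRing CategoryTheory

/-! ### The bar resolution of a high syzygy over a Golod ring, and the theorem. -/

namespace FreeComplex

/-- Starting from the single generator `1 ∈ R` secures `A₀ = Q`, which an arbitrary minimal
resolution provides only up to a unit. -/
lemma exists_isMinimalStart_isUnital {Q R : Type u} [CommRing Q] [IsLocalRing Q]
    [IsNoetherianRing Q] [CommRing R] [Nontrivial R] [Algebra Q R]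
    (hsurj : Function.Surjective (algebraMap Q R)) (n : ℕ) :
    ∃ (A : FreeComplex Q R) (e : A.ι), A.IsMinimalStart n ∧ A.IsUnital e := by
  have : Module.Finite Q R := Module.Finite.of_surjective (Algebra.linearMap Q R) hsurj
  induction n with
  | zero =>
    have h : ∀ z : Unit →₀ Q, Finsupp.linearCombination Q (fun _ : Unit => (1 : R)) z =
        algebraMap Q R (z ()) := by
      intro z
      rw [Finsupp.linearCombination_unique, Algebra.algebraMap_eq_smul_one]
    refine ⟨ofGenerators (fun _ : Unit => (1 : R)), (), ofGenerators_isMinimalStart _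
      (fun r => ?_) (fun z hz x => ?_), rfl, fun _ _ => rfl, rfl⟩
    · obtain ⟨q, rfl⟩ := hsurj r
      exact ⟨Finsupp.single () q, by rw [h, Finsupp.single_eq_same]⟩
    · rw [h] at hz
      intro hu
      exact not_isUnit_zero (hz ▸ hu.map (algebraMap Q R))
  | succ n ih =>
    obtain ⟨A, e, hA, he⟩ := ih
    have := hA.finite_syzygy
    obtain ⟨L, hL⟩ := exists_isMinimalStart_zero (S := Q) (A.syzygy n)
    refine ⟨A.splice n L, Sum.inl e, hA.splice hL, he.deg_eq, ?_, he.aug_eq⟩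
    rintro (x | x) hx
    · exact congrArg Sum.inl (he.unique x hx)
    · exact absurd hx (Nat.succ_ne_zero _)

section

variable {Q R M : Type u} [CommRing Q] [IsRegularLocalRing Q] [CommRing R] [IsLocalRing R]
  [Algebra Q R] [AddCommGroup M] [Module R M] [Module.Finite R M] [Module Q M]
  [IsScalarTower Q R M] {A : FreeComplex Q R} {e : A.ι} {m : List A.Pos → (A.Pos →₀ Q)}

/-- The bar construction is minimal for a high syzygy over a Golod ring. -/
theorem IsGolodRing.bar_syzygy_isMinimalFreeResolution
    (hsurj : Function.Surjective (algebraMap Q R)) (hGolod : IsGolodRing Q R) [Finite A.ι]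
    (hA : A.IsMinimalFreeResolution) (he : A.IsUnital e) (hm : A.IsAInfAlgebra e m) {c : ℕ}
    (hc : HasProjectiveDimensionLE (ModuleCat.of Q M) c) {F : FreeComplex R M} [Finite F.ι]
    (hF : F.IsMinimalStart c) {G : FreeComplex Q (F.syzygy c)} [Finite G.ι]
    (hG : G.IsMinimalFreeResolution) {mG : List A.Pos → G.ι → (G.ι →₀ Q)}
    (hmG : A.IsAInfModule e m G mG) : (A.bar m G mG).IsMinimalFreeResolution := by
  have := Fintype.ofFinite A.Pos
  have hR : Module.Finite Q R := Module.Finite.of_surjective (Algebra.linearMap Q R) hsurj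
  have hM : Module.Finite Q M := Module.Finite.trans R M
  have hres := IsGolodRing.algebraMap_residueField_eq_zero hsurj hGolod hA he hm
  -- A bar resolution of `M` itself, in general not minimal, serves only to derive the recursion for
  -- the Betti numbers of `M` in high degrees.
  obtain ⟨K, hK⟩ := exists_isMinimalFreeResolution Q M
  have := hK.finite
  have hKc := (hK.isMinimalBelow c).deg_le hc
  obtain ⟨mK, hmK⟩ := exists_isAInfModule hA.isComplex he hm hK.isFreeResolution
  have hLK := bar_isFreeResolution hsurj hA.isFreeResolution he hm hK.isFreeResolution hmK
  have hL := bar_isFreeResolution hsurj hA.isFreeResolution he hm hG.isFreeResolution hmG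
  refine bar_isMinimalFreeResolution hL hG (bettiNumber_syzygy_le hA
    (fun i hi => bettiNumber_eq_shiftSum hres (isAInfModule_iff.1 hmK).1 hLK hKc hi)
    (fun i hi => ?_) hF (fun j => finite_bar_deg_eq j) hL
    (bar_d_mem_of_deg_eq_one hsurj hG (isAInfModule_iff.1 hmG).1) ?_)
  · have h : K.rankAt i = 0 := by
      rw [rankAt, Set.ncard_eq_zero]
      ext y
      have := hKc y
      simp only [Set.mem_ofPred_eq, Set.mem_empty_iff_false, iff_false]
      omega
    rw [torLength_eq_bettiNumber (fun n => Set.toFinite _) hK.isFreeResolution,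
      hK.bettiNumber_eq (fun n => Set.toFinite _), h, Nat.cast_zero]
  -- The empty words alone already give the bar construction at least the rank of `G` in degree `0`.
  · rw [rankAt_bar, hG.bettiNumber_eq (fun n => Set.toFinite _)]
    exact Nat.le_add_right _ _

theorem IsGolodRing.isGolodModule_syzygy
    (hsurj : Function.Surjective (algebraMap Q R)) (hGolod : IsGolodRing Q R) [Finite A.ι]
    (hA : A.IsMinimalFreeResolution) (he : A.IsUnital e) (hm : A.IsAInfAlgebra e m) {c : ℕ}
    (hc : HasProjectiveDimensionLE (ModuleCat.of Q M) c) {F : FreeComplex R M} [Finite F.ι]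
    (hF : F.IsMinimalStart c) [Module.Finite Q (F.syzygy c)] :
    IsGolodModule Q R (F.syzygy c) := by
  have := Fintype.ofFinite A.Pos
  obtain ⟨G, hG⟩ := exists_isMinimalFreeResolution Q (F.syzygy c)
  have := hG.finite
  obtain ⟨mG, hmG⟩ := exists_isAInfModule hA.isComplex he hm hG.isFreeResolution
  exact isGolodModule_of_bar hA he hG
    (bar_syzygy_isMinimalFreeResolution hsurj hGolod hA he hm hc hF hG hmG)

end

end FreeComplex

end

theorem mainTheorem12 {Q R : Type u} [CommRing Q] [IsRegularLocalRing Q] [CommRing R]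
    [IsLocalRing R] [Algebra Q R]
    (hsurj : Function.Surjective (algebraMap Q R))
    (hker : RingHom.ker (algebraMap Q R) ≤ IsLocalRing.maximalIdeal Q ^ 2)
    (hGolod : IsGolodRing Q R)
    (M : Type u) [AddCommGroup M] [Module R M] [Module.Finite R M]
    [Module Q M] [IsScalarTower Q R M] :
    -- the minimal `R`-resolution of `M` can be built degree by degree; only the part up to the
    -- finite degree `c = pd_Q M ≤ dim Q` is going to be used
    StepwiseResolvable R M ∧
    CategoryTheory.projectiveDimension (ModuleCat.of Q M) ≤ ringKrullDim Q ∧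
    -- the minimal `Q`-resolution of `R` is built in finitely many steps
    StepwiseResolvable Q R ∧
    (∀ (n : ℕ) (F : FreeComplex Q R), ringKrullDim Q ≤ n → F.IsMinimalStart n →
      F.IsMinimalFreeResolution) ∧
    (∃ (A : FreeComplex Q R) (e : A.ι), A.IsMinimalFreeResolution ∧ A.IsUnital e) ∧
    -- let `A` be a minimal `Q`-resolution of `R`
    ∀ (A : FreeComplex Q R) (e : A.ι), A.IsMinimalFreeResolution → A.IsUnital e →
      -- it is finite, and the maps `m_n` are found one after the other, in finitely many steps
      Finite A.ι ∧ (∀ x, (A.deg x : WithBot ℕ∞) ≤ ringKrullDim Q) ∧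
      (∃ m, A.IsAInfAlgebraUpTo e 0 m) ∧
      (∀ (N : ℕ) (m : List A.Pos → (A.Pos →₀ Q)), A.IsAInfAlgebraUpTo e N m →
        (∃ m', (∀ w, w.length ≤ N → m' w = m w) ∧ A.IsAInfAlgebraUpTo e (N + 1) m') ∧
        (ringKrullDim Q + 2 ≤ ((2 * N : ℕ) : WithBot ℕ∞) → A.IsAInfAlgebra e m)) ∧
      -- let `(m_n)` be an A-infinity structure on `A`; only finitely many `m_n` are nonzero
      ∀ m : List A.Pos → (A.Pos →₀ Q), A.IsAInfAlgebra e m →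
        {w | m w ≠ 0}.Finite ∧
        -- let `F_c → ⋯ → F_0` be the part of degrees `≤ c` of a minimal `R`-resolution of `M`
        ∀ c : ℕ, CategoryTheory.projectiveDimension (ModuleCat.of Q M) ≤ c →
          (∃ F : FreeComplex R M, F.IsMinimalStart c) ∧
          ∀ F : FreeComplex R M, F.IsMinimalStart c →
            -- the `(c+1)`-st syzygy of `M` is Golod, and its minimal `Q`-resolution is built in
            -- finitely many steps
            Finite F.ι ∧
            IsGolodModule Q R (F.syzygy c) ∧
            StepwiseResolvable Q (F.syzygy c) ∧
            (∀ (n : ℕ) (G : FreeComplex Q (F.syzygy c)), ringKrullDim Q ≤ n →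
              G.IsMinimalStart n → G.IsMinimalFreeResolution) ∧
            (∃ G : FreeComplex Q (F.syzygy c), G.IsMinimalFreeResolution) ∧
            -- let `G` be a minimal `Q`-resolution of this syzygy
            ∀ G : FreeComplex Q (F.syzygy c), G.IsMinimalFreeResolution →
              -- it is finite, and the maps `m^G_n` are found one after the other, in finitely
              -- many steps
              Finite G.ι ∧ (∀ x, (G.deg x : WithBot ℕ∞) ≤ ringKrullDim Q) ∧
              (∃ mG, A.IsAInfModuleUpTo e m G 0 mG) ∧
              (∀ (N : ℕ) (mG : List A.Pos → G.ι → (G.ι →₀ Q)), A.IsAInfModuleUpTo e m G N mG →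
                (∃ mG', (∀ w, w.length ≤ N → mG' w = mG w) ∧
                  A.IsAInfModuleUpTo e m G (N + 1) mG') ∧
                (ringKrullDim Q + 2 ≤ ((2 * N : ℕ) : WithBot ℕ∞) → A.IsAInfModule e m G mG)) ∧
              -- let `(m^G_n)` be an A-infinity module structure on `G`; only finitely many
              -- `m^G_n` are nonzero, the bar resolution is the minimal `R`-resolution of the
              -- syzygy, and splicing gives the minimal `R`-resolution of `M`
              ∀ mG : List A.Pos → G.ι → (G.ι →₀ Q), A.IsAInfModule e m G mG →
                {p : List A.Pos × G.ι | mG p.1 p.2 ≠ 0}.Finite ∧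
                (A.bar m G mG).IsMinimalFreeResolution ∧
                (F.splice c (A.bar m G mG)).IsMinimalFreeResolution := by
  have hR : Module.Finite Q R := Module.Finite.of_surjective (Algebra.linearMap Q R) hsurj
  have hRN : IsNoetherianRing R := isNoetherianRing_of_surjective Q R (algebraMap Q R) hsurj
  have hM : Module.Finite Q M := Module.Finite.trans R M
  obtain ⟨d, hd⟩ := IsRegularLocalRing.exists_nat_eq_ringKrullDim Q
  refine ⟨FreeComplex.stepwiseResolvable, IsRegularLocalRing.projectiveDimension_le_ringKrullDim M,
    FreeComplex.stepwiseResolvable,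
    fun n F hn hF => hF.isMinimalFreeResolution_of_ringKrullDim_le hn, ?_, ?_⟩
  · obtain ⟨A, e, hA, he⟩ := FreeComplex.exists_isMinimalStart_isUnital hsurj d
    exact ⟨A, e, hA.isMinimalFreeResolution_of_ringKrullDim_le hd.le, he⟩
  intro A e hA he
  have hAfin := hA.finite
  have hAd := hA.deg_le hd.le
  have hN : ∀ N : ℕ, ringKrullDim Q + 2 ≤ ((2 * N : ℕ) : WithBot ℕ∞) → d + 2 ≤ 2 * N := by
    intro N hN
    rw [hd] at hN
    exact_mod_cast hN
  refine ⟨hAfin, hA.deg_le_ringKrullDim, FreeComplex.exists_isAInfAlgebraUpTo_zero hA.isComplex,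
    fun N m hm => ⟨hm.exists_succ hA.isFreeResolution he hAd, fun h =>
      hm.isAInfAlgebra hA.isComplex he.deg_eq hAd (hN N h)⟩, ?_⟩
  intro m hm
  refine ⟨(FreeComplex.isAInfAlgebra_iff.1 hm).1.degree.finite hAd, ?_⟩
  intro c hc
  have hc' := (CategoryTheory.projectiveDimension_le_iff _ _).1 hc
  refine ⟨FreeComplex.exists_isMinimalStart c, ?_⟩
  intro F hF
  have hFfin := hF.finite
  have hsyz := hF.finite_syzygy
  have hsyzQ : Module.Finite Q (F.syzygy c) := Module.Finite.trans R _
  refine ⟨hFfin, FreeComplex.IsGolodRing.isGolodModule_syzygy hsurj hGolod hA he hm hc' hF,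
    FreeComplex.stepwiseResolvable,
    fun n G hn hG => hG.isMinimalFreeResolution_of_ringKrullDim_le hn,
    FreeComplex.exists_isMinimalFreeResolution Q _, ?_⟩
  intro G hG
  have hGfin := hG.finite
  have hGd := hG.deg_le hd.le
  refine ⟨hGfin, hG.deg_le_ringKrullDim, FreeComplex.exists_isAInfModuleUpTo_zero hG.isComplex,
    fun N mG hmG => ⟨hmG.exists_succ hA.isComplex he hm hG.isFreeResolution hAd hGd, fun h =>
      hmG.isAInfModule hA.isComplex he.deg_eq hm hGd (hN N h)⟩, ?_⟩
  intro mG hmG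
  have hbar := FreeComplex.IsGolodRing.bar_syzygy_isMinimalFreeResolution hsurj hGolod hA he
    hm hc' hF hG hmG
  exact ⟨(FreeComplex.isAInfModule_iff.1 hmG).1.finite hGd, hbar,
    FreeComplex.IsMinimalFreeResolution.splice hF hbar⟩
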